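/- Let $T>0$, let $(M,g)$ be a smooth $n$-dimensional Riemannian manifold without boundary (not necessarily compact or connected), and let $L:\mathbb R/T\mathbb Z\times TM\to\mathbb R$ be a smooth Lagrangian such that $v\mapsto L(t,q,v)$ is a polynomial of degree at most $2$ for all $(t,q)$. Suppose that $L$ is uniformly fibrewise strictly convex: there is $\ell_0>0$ with $\nabla_{vv}L(t,q,v)[w,w]\ge \ell_0\, g_q(w,w)$ for all $(t,q,v)$ and all $w\in T_qM$. Let $x$ be a $T$-periodic $C^2$ solution of the Euler–Lagrange equation of $L$, i.e. a critical point of the action $\mathbb E(x)=\int_0^T L(t,x,x')\,dt$ on the manifold of $T$-periodic $H^1$ loops in $M$. Let $\mathcal H(x)$ be the Hilbert space of $T$-periodic $H^1$ vector fields along $x$, with scalar product $\int_0^T \big[g(\nabla_t\xi,\nabla_t\eta)+g(\xi,\eta)\big]\,dt$, and let $D^2\mathbb E(x)$ be the second variation of $\mathbb E$ at $x$, a symmetric bilinear form on $\mathcal H(x)$. For $s\ge 0$ put $$\mathcal I_s[\xi,\eta]=D^2\mathbb E(x)[\xi,\eta]+s\,\alpha(x)[\xi,\eta],\qquad \alpha(x)[\xi,\eta]=\int_0^T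 \nabla_{vv}L\big(t,x(t),x'(t)\big)[\xi(t),\eta(t)]\,dt .$$ The Morse index $\iota_{\mathrm{Mor}}(x)$ is the supremum of the dimensions of the linear subspaces of $\mathcal H(x)$ on which $D^2\mathbb E(x)$ is negative definite. The spectral index $\iota_{\mathrm{spec}}(x)$ is the spectral flow over $[0,s_0]$ of the path $s\mapsto \mathcal I_s$ of Fredholm quadratic forms (that is, of the path of bounded selfadjoint Fredholm operators on $\mathcal H(x)$ that represent them), where $s_0>0$ is so large that $\mathcal I_s$ is non-degenerate for every $s\ge s_0$. Here the spectral flow is the net number of eigenvalues that cross $0$ upwards, a crossing at the left endpoint being counted with minus the Morse index of the crossing form and one at the right endpoint with plus its coindex. Then $\iota_{\mathrm{Mor}}(x)$ is finite, $\iota_{\mathrm{spec}}(x)$ is well defined (such $s_0$ exist, and the spectral flow over $[0,s_0]$ is defined and is the same for all of them), and $$\iota_{\mathrm{spec}}(x)=\iota_{\mathrm{Mor}}(x).$$ -/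

import Mathlib

open Set Filter Topology MeasureTheory Bundle
open scoped Manifold ContDiff

noncomputable section

namespace LagrangianIndex

/-! ### Bilinear forms, Morse index, spectral flow -/

/-- The Morse index of a (quadratic form associated with a) bilinear form `B`: the supremum of the
dimensions of the linear subspaces on which `B` is negative definite. -/
def morseIndex {V : Type*} [AddCommGroup V] [Module ℝ V] (B : V → V → ℝ) : ℕ∞ :=
  ⨆ W : {W : Submodule ℝ V // ∀ u ∈ W, u ≠ 0 → B u u < 0},
    Cardinal.toENat (Module.rank ℝ W.1)

/-- Nondegeneracy of a symmetric bilinear form. -/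
def Nondegenerate {V : Type*} [AddCommGroup V] (B : V → V → ℝ) : Prop :=
  ∀ u, (∀ v, B u v = 0) → u = 0

section SpectralFlow

variable {H : Type*} [NormedAddCommGroup H] [InnerProductSpace ℝ H]

/-- The dimension of the sum of the eigenspaces of `A` with eigenvalues in `[0, ε]`. -/
def dimEigen (A : H →L[ℝ] H) (ε : ℝ) : ℕ :=
  Module.finrank ℝ
    (⨆ μ ∈ Icc (0 : ℝ) ε, Module.End.eigenspace (A : H →ₗ[ℝ] H) μ : Submodule ℝ H)

/-- `ε > 0` is an admissible spectral gap for `A`: the points `±ε` are not in the spectrum of `A`,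
and `[-ε, ε]` does not meet the essential spectrum of `A` (so that `A` has only finitely many
spectral points in `[-ε, ε]`, all of them eigenvalues of finite multiplicity). -/
def IsGap (A : H →L[ℝ] H) (ε : ℝ) : Prop :=
  0 < ε ∧ ε ∉ spectrum ℝ A ∧ -ε ∉ spectrum ℝ A ∧
    ∀ μ ∈ Icc (-ε) ε, (A - μ • ContinuousLinearMap.id ℝ H).IsFredholm

/-- `k` is the spectral flow over `[a, b]` of the norm continuous path `A` of bounded selfadjoint
Fredholm operators: for some partition `a = t 0 ≤ ⋯ ≤ t m = b` and some `ε i` that are spectral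
gaps of `A s` for all `s ∈ [t i, t (i + 1)]`, the integer `k` is the sum over `i` of
`dim E_{[0, ε i]}(A (t (i + 1))) - dim E_{[0, ε i]}(A (t i))`.
For a `C¹` path with regular crossings this is the sum of the signatures of the crossing forms in
`(a, b)`, minus the Morse index of the crossing form at `a`, plus the coindex of the crossing form
at `b`. -/
def HasSpectralFlow (A : ℝ → H →L[ℝ] H) (a b : ℝ) (k : ℤ) : Prop :=
  ContinuousOn A (Icc a b) ∧
  (∀ s ∈ Icc a b, (A s).IsSymmetric ∧ (A s).IsFredholm) ∧
  ∃ (m : ℕ) (t ε : ℕ → ℝ), t 0 = a ∧ t m = b ∧ Monotone t ∧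
    (∀ i < m, ∀ s ∈ Icc (t i) (t (i + 1)), IsGap (A s) (ε i)) ∧
    k = ∑ i ∈ Finset.range m,
      ((dimEigen (A (t (i + 1))) (ε i) : ℤ) - (dimEigen (A (t i)) (ε i) : ℤ))

/-- `k` is the spectral flow over `[a, b]` of the path `B` of Fredholm quadratic forms, i.e. of the
path of the bounded selfadjoint operators that represent the forms in the scalar product of `H`. -/
def HasFormSpectralFlow (B : ℝ → H → H → ℝ) (a b : ℝ) (k : ℤ) : Prop :=
  ∃ A : ℝ → H →L[ℝ] H,
    (∀ s ∈ Icc a b, ∀ u v, inner ℝ (A s u) v = B s u v) ∧ HasSpectralFlow A a b k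

end SpectralFlow

/-! ### Charts, metric and Levi-Civita connection -/

/-- The model space of an `n`-dimensional manifold. -/
abbrev Model (n : ℕ) : Type := EuclideanSpace ℝ (Fin n)

/-- A smooth Riemannian metric on `M`. -/
abbrev Metric (n : ℕ) (M : Type*) [TopologicalSpace M] [ChartedSpace (Model n) M]
    [IsManifold (𝓡 n) ∞ M] : Type _ :=
  ContMDiffRiemannianMetric (𝓡 n) ∞ (Model n) (fun q : M ↦ TangentSpace (𝓡 n) q)

variable {n : ℕ} {M : Type*} [TopologicalSpace M] [ChartedSpace (Model n) M]
  [IsManifold (𝓡 n) ∞ M]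

/-- The components of a tangent vector at `q` in the chart around `c` (for `q` in its domain). -/
def coords (c q : M) : TangentSpace (𝓡 n) q →L[ℝ] Model n :=
  (trivializationAt (Model n) (TangentSpace (𝓡 n) : M → Type _) c).continuousLinearMapAt ℝ q

/-- The tangent vector at `q` with given components in the chart around `c`. -/
def ofCoords (c q : M) : Model n →L[ℝ] TangentSpace (𝓡 n) q :=
  (trivializationAt (Model n) (TangentSpace (𝓡 n) : M → Type _) c).symmL ℝ q

/-- The metric in the chart around `c`, at the point with coordinates `y`. -/
def chartMetric (g : Metric n M) (c : M) (y : Model n) : Model n →L[ℝ] Model n →L[ℝ] ℝ :=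
  -- `(v, w) ↦ g (ofCoords v) (ofCoords w)`
  (ContinuousLinearMap.precomp ℝ (ofCoords c ((extChartAt (𝓡 n) c).symm y))).comp
    ((g.inner ((extChartAt (𝓡 n) c).symm y)).comp (ofCoords c ((extChartAt (𝓡 n) c).symm y)))

/-- The Christoffel symbols of the Levi-Civita connection in the chart around `c`: with `G` the
metric in the chart, `Γ(v, w)` is the vector such that
`G(Γ(v, w), z) = (1/2) (D_v G(w, z) + D_w G(v, z) - D_z G(v, w))` for all `z`. -/
def christoffel (g : Metric n M) (c : M) (y v w : Model n) : Model n :=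
  (chartMetric g c y).inverse
    ((1 / 2 : ℝ) • (fderiv ℝ (chartMetric g c) y v w + fderiv ℝ (chartMetric g c) y w v
      - ((fderiv ℝ (chartMetric g c) y).flip v).flip w))

/-! ### Loops and `H¹` vector fields along them -/

/-- A `T`-periodic curve of class `C²` in `M`. -/
structure Loop (T : ℝ) (n : ℕ) (M : Type*) [TopologicalSpace M] [ChartedSpace (Model n) M] where
  /-- The underlying curve. -/
  toFun : ℝ → M
  contMDiff : ContMDiff 𝓘(ℝ, ℝ) (𝓡 n) 2 toFun
  periodic : Function.Periodic toFun T

instance {T : ℝ} : CoeFun (Loop T n M) (fun _ ↦ ℝ → M) := ⟨Loop.toFun⟩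

variable {T : ℝ}

/-- The curve `x` in the chart around `c`. -/
def Loop.pos (x : Loop T n M) (c : M) (t : ℝ) : Model n := extChartAt (𝓡 n) c (x t)

/-- The velocity of `x` in the chart around `c`. -/
def Loop.vel (x : Loop T n M) (c : M) (t : ℝ) : Model n := deriv (x.pos c) t

/-- The velocity `x'(t)` as a tangent vector. -/
def Loop.velocity (x : Loop T n M) (t : ℝ) : TangentSpace (𝓡 n) (x t) :=
  mfderiv 𝓘(ℝ, ℝ) (𝓡 n) x.toFun t (1 : ℝ)

/-- The curve `x` maps the interval `[a, b]` into the domain of the chart around `c`. -/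
def Loop.InChart (x : Loop T n M) (c : M) (a b : ℝ) : Prop :=
  a ≤ b ∧ ∀ t ∈ Icc a b, x t ∈ (chartAt (Model n) c).source

/-- Vector fields along `x` (no regularity). -/
abbrev Loop.Field (x : Loop T n M) : Type := (t : ℝ) → TangentSpace (𝓡 n) (x t)

/-- The ordinary derivative of the components, in the chart around `c`, of a field `ξ` with
covariant derivative `η`, i.e. `η - Γ(x', ξ)` in components. -/
def coordDeriv (g : Metric n M) (x : Loop T n M) (ξ η : x.Field) (c : M) (t : ℝ) : Model n :=
  coords c (x t) (η t) - christoffel g c (x.pos c t) (x.vel c t) (coords c (x t) (ξ t))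

/-- `ξ` is locally of Sobolev class `H¹` with covariant derivative `η = ∇_t ξ`: in every chart, the
components of `η` and the derivative `η - Γ(x', ξ)` of the components of `ξ` are locally square
integrable, and the components of `ξ` are the primitive of the latter. -/
structure IsCovDeriv (g : Metric n M) (x : Loop T n M) (ξ η : x.Field) : Prop where
  memLp : ∀ c a b, x.InChart c a b →
    MemLp (fun t ↦ coords c (x t) (η t)) 2 (volume.restrict (Icc a b))
  memLp_coordDeriv : ∀ c a b, x.InChart c a b →
    MemLp (coordDeriv g x ξ η c) 2 (volume.restrict (Icc a b))
  primitive : ∀ c a b, x.InChart c a b →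
    coords c (x b) (ξ b) - coords c (x a) (ξ a) = ∫ t in a..b, coordDeriv g x ξ η c t

theorem ofCoords_coords {c q : M} (hq : q ∈ (chartAt (Model n) c).source)
    (v : TangentSpace (𝓡 n) q) : ofCoords c q (coords c q v) = v :=
  (trivializationAt (Model n) (TangentSpace (𝓡 n) : M → Type _) c).symmL_continuousLinearMapAt
    (by rwa [TangentBundle.trivializationAt_baseSet]) v

theorem christoffel_add (g : Metric n M) (c : M) (y v w w' : Model n) :
    christoffel g c y v (w + w') = christoffel g c y v w + christoffel g c y v w' := by
  unfold christoffel
  generalize fderiv ℝ (chartMetric g c) y = D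
  rw [← ContinuousLinearMap.map_add]
  congr 1
  rw [ContinuousLinearMap.map_add (D v), ContinuousLinearMap.map_add D, add_apply,
    ContinuousLinearMap.map_add (D.flip v).flip]
  module

theorem christoffel_smul (g : Metric n M) (c : M) (y v w : Model n) (r : ℝ) :
    christoffel g c y v (r • w) = r • christoffel g c y v w := by
  unfold christoffel
  generalize fderiv ℝ (chartMetric g c) y = D
  rw [← ContinuousLinearMap.map_smul]
  congr 1
  rw [ContinuousLinearMap.map_smul (D v), ContinuousLinearMap.map_smul D, smul_apply,
    ContinuousLinearMap.map_smul (D.flip v).flip]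
  module

theorem coordDeriv_add (g : Metric n M) (x : Loop T n M) (ξ η ξ' η' : x.Field) (c : M) :
    coordDeriv g x (ξ + ξ') (η + η') c = coordDeriv g x ξ η c + coordDeriv g x ξ' η' c := by
  ext1 t
  simp only [coordDeriv, Pi.add_apply, map_add, christoffel_add]
  abel

theorem coordDeriv_smul (g : Metric n M) (x : Loop T n M) (ξ η : x.Field) (c : M) (r : ℝ) :
    coordDeriv g x (r • ξ) (r • η) c = r • coordDeriv g x ξ η c := by
  ext1 t
  simp only [coordDeriv, Pi.smul_apply, map_smul, christoffel_smul, smul_sub]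

theorem IsCovDeriv.intervalIntegrable {g : Metric n M} {x : Loop T n M} {ξ η : x.Field}
    (h : IsCovDeriv g x ξ η) {c : M} {a b : ℝ} (hc : x.InChart c a b) :
    IntervalIntegrable (coordDeriv g x ξ η c) volume a b := by
  rw [intervalIntegrable_iff_integrableOn_Icc_of_le hc.1]
  exact (h.memLp_coordDeriv c a b hc).integrable (by norm_num)

theorem IsCovDeriv.add {g : Metric n M} {x : Loop T n M} {ξ η ξ' η' : x.Field}
    (h : IsCovDeriv g x ξ η) (h' : IsCovDeriv g x ξ' η') :
    IsCovDeriv g x (ξ + ξ') (η + η') where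
  memLp c a b hc := by
    simp only [Pi.add_apply, map_add]
    exact (h.memLp c a b hc).add (h'.memLp c a b hc)
  memLp_coordDeriv c a b hc := by
    rw [coordDeriv_add]
    exact (h.memLp_coordDeriv c a b hc).add (h'.memLp_coordDeriv c a b hc)
  primitive c a b hc := by
    rw [coordDeriv_add]
    simp only [Pi.add_apply, map_add]
    rw [intervalIntegral.integral_add (h.intervalIntegrable hc) (h'.intervalIntegrable hc),
      ← h.primitive c a b hc, ← h'.primitive c a b hc]
    abel

theorem IsCovDeriv.smul {g : Metric n M} {x : Loop T n M} {ξ η : x.Field}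
    (h : IsCovDeriv g x ξ η) (r : ℝ) : IsCovDeriv g x (r • ξ) (r • η) where
  memLp c a b hc := by
    simp only [Pi.smul_apply, map_smul]
    exact (h.memLp c a b hc).const_smul r
  memLp_coordDeriv c a b hc := by
    rw [coordDeriv_smul]
    exact (h.memLp_coordDeriv c a b hc).const_smul r
  primitive c a b hc := by
    rw [coordDeriv_smul]
    simp only [Pi.smul_apply, map_smul]
    rw [intervalIntegral.integral_smul, ← h.primitive c a b hc, smul_sub]

theorem IsCovDeriv.zero (g : Metric n M) (x : Loop T n M) : IsCovDeriv g x 0 0 := by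
  have h0 : ∀ c, coordDeriv g x 0 0 c = 0 := fun c ↦ by
    have := coordDeriv_smul g x 0 0 c 0
    simpa using this
  refine ⟨fun c a b _ ↦ ?_, fun c a b _ ↦ ?_, fun c a b _ ↦ ?_⟩
  · simp
  · rw [h0]; exact MemLp.zero
  · simp [h0]

/-- The space `{ξ ∈ H¹(ℝ/Tℤ, TM) | τ ∘ ξ = x}` of `T`-periodic `H¹` vector fields along `x`, as a
linear subspace of the space of all fields along `x`. -/
def h1Submodule (g : Metric n M) (x : Loop T n M) : Submodule ℝ x.Field where
  carrier := {ξ | (∀ t, (⟨x (t + T), ξ (t + T)⟩ : TangentBundle (𝓡 n) M) = ⟨x t, ξ t⟩) ∧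
    ∃ η, IsCovDeriv g x ξ η}
  zero_mem' := by
    refine ⟨fun t ↦ ?_, 0, IsCovDeriv.zero g x⟩
    have := x.periodic t
    simp only [Pi.zero_apply]
    rw [this]
    rfl
  add_mem' := by
    rintro ξ ξ' ⟨h1, η, h2⟩ ⟨h1', η', h2'⟩
    refine ⟨fun t ↦ ?_, _, h2.add h2'⟩
    have e := x.periodic t
    have a := h1 t
    have a' := h1' t
    simp only [Pi.add_apply]
    generalize ξ (t + T) = u at *
    generalize ξ' (t + T) = u' at *
    revert u u'
    rw [e]
    intro u a u' a'
    simp only [TotalSpace.mk_inj] at a a' ⊢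
    rw [a, a']
    rfl
  smul_mem' := by
    rintro r ξ ⟨h1, η, h2⟩
    refine ⟨fun t ↦ ?_, _, h2.smul r⟩
    have e := x.periodic t
    have a := h1 t
    simp only [Pi.smul_apply]
    generalize ξ (t + T) = u at *
    revert u
    rw [e]
    intro u a
    simp only [TotalSpace.mk_inj] at a ⊢
    rw [a]
    rfl

set_option linter.unusedSectionVars false in
/-- There is a subdivision of `[0, T]` each interval of which is mapped by `x` into a chart. -/
theorem exists_subdivision [Fact (0 < T)] (x : Loop T n M) :
    ∃ p : ℕ × (ℕ → ℝ) × (ℕ → M), p.2.1 0 = 0 ∧ p.2.1 p.1 = T ∧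
      ∀ i, x.InChart (p.2.2 i) (p.2.1 i) (p.2.1 (i + 1)) := by
  have hT : 0 < T := Fact.out
  obtain ⟨t, h0, hmono, ⟨m, hm⟩, hc⟩ := exists_monotone_Icc_subset_open_cover_Icc hT.le
    (c := fun c : M ↦ (fun s : Icc 0 T ↦ x s) ⁻¹' (chartAt (Model n) c).source)
    (fun c ↦ (chartAt (Model n) c).open_source.preimage
      (x.contMDiff.continuous.comp continuous_subtype_val))
    (fun s _ ↦ mem_iUnion.2 ⟨x s, mem_chart_source _ _⟩)
  choose c hc using hc
  refine ⟨⟨m, fun i ↦ t i, c⟩, h0, by simp [hm m le_rfl], fun i ↦ ⟨hmono (Nat.le_succ i), ?_⟩⟩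
  intro s hs
  have hs1 : ((t i : Icc 0 T) : ℝ) ≤ s := hs.1
  have hs2 : s ≤ ((t (i + 1) : Icc 0 T) : ℝ) := hs.2
  exact hc i (a := ⟨s, (t i).2.1.trans hs1, hs2.trans (t (i + 1)).2.2⟩) ⟨hs1, hs2⟩

/-- A property of almost every time holds on `[0, T]` if it does on all chart intervals. -/
theorem ae_of_inChart [Fact (0 < T)] (x : Loop T n M) {p : ℝ → Prop}
    (h : ∀ c a b, x.InChart c a b → ∀ᵐ t ∂volume.restrict (Icc a b), p t) :
    ∀ᵐ t ∂volume.restrict (Ioc 0 T), p t := by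
  obtain ⟨⟨m, s, c⟩, h0, hm, hc⟩ := exists_subdivision x
  have key : ∀ i, ∀ᵐ t ∂volume.restrict (Ioc 0 (s i)), p t := by
    intro i
    induction i with
    | zero => simp only at h0; simp [h0]
    | succ i ih =>
      have := h _ _ _ (hc i)
      refine ae_restrict_of_ae_restrict_of_subset
        (t := Ioc 0 (s i) ∪ Icc (s i) (s (i + 1))) ?_ ?_
      · intro u hu
        rcases le_total u (s i) with h | h
        · exact Or.inl ⟨hu.1, h⟩
        · exact Or.inr ⟨h, hu.2⟩
      · rw [ae_restrict_union_iff]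
        exact ⟨ih, this⟩
  rw [← show s m = T from hm]
  exact key m

/-- Integrability over `[0, T]` can be checked on chart intervals. -/
theorem intervalIntegrable_of_inChart [Fact (0 < T)] (x : Loop T n M) {f : ℝ → ℝ}
    (h : ∀ c a b, x.InChart c a b → IntegrableOn f (Icc a b)) :
    IntervalIntegrable f volume 0 T := by
  obtain ⟨⟨m, s, c⟩, h0, hm, hc⟩ := exists_subdivision x
  have := IntervalIntegrable.trans_iterate (μ := volume) (f := f) (a := s) (n := m) fun k _ ↦
    (intervalIntegrable_iff_integrableOn_Icc_of_le (hc k).1).2 (h _ _ _ (hc k))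
  simpa only [show s 0 = 0 from h0, show s m = T from hm] using this

/-- The covariant derivative is unique almost everywhere. -/
theorem IsCovDeriv.unique [Fact (0 < T)] {g : Metric n M} {x : Loop T n M} {ξ η η' : x.Field}
    (h : IsCovDeriv g x ξ η) (h' : IsCovDeriv g x ξ η') :
    ∀ᵐ t ∂volume.restrict (Ioc 0 T), η t = η' t := by
  refine ae_of_inChart x fun c a b hc ↦ ?_
  have hsub : ∀ t ∈ Icc a b, x.InChart c a t := fun t ht ↦
    ⟨ht.1, fun u hu ↦ hc.2 u ⟨hu.1, hu.2.trans ht.2⟩⟩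
  have e : ∀ t ∈ Icc a b, ∫ u in a..t, coordDeriv g x ξ η c u
      = ∫ u in a..t, coordDeriv g x ξ η' c u := fun t ht ↦ by
    rw [← h.primitive c a t (hsub t ht), ← h'.primitive c a t (hsub t ht)]
  have d := (h.intervalIntegrable hc).ae_hasDerivAt_integral
  have d' := (h'.intervalIntegrable hc).ae_hasDerivAt_integral
  rw [uIcc_of_le hc.1] at d d'
  rw [← restrict_Ioo_eq_restrict_Icc]
  refine (ae_restrict_iff' measurableSet_Ioo).2 ?_
  filter_upwards [d, d'] with t ht ht' hab
  have hab' := Ioo_subset_Icc_self hab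
  have h1 := ht hab' a (left_mem_Icc.2 hc.1)
  have h2 := ht' hab' a (left_mem_Icc.2 hc.1)
  have h3 := h1.unique (h2.congr_of_eventuallyEq
    (by filter_upwards [Ioo_mem_nhds hab.1 hab.2] with u hu using e u (Ioo_subset_Icc_self hu)))
  have h4 : coords c (x t) (η t) = coords c (x t) (η' t) := by
    simpa [coordDeriv] using h3
  rw [← ofCoords_coords (hc.2 t hab') (η t), h4, ofCoords_coords (hc.2 t hab') (η' t)]

/-- In a chart, the components of an `H¹` field are continuous. -/
theorem IsCovDeriv.continuousOn {g : Metric n M} {x : Loop T n M} {ξ η : x.Field}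
    (h : IsCovDeriv g x ξ η) {c : M} {a b : ℝ} (hc : x.InChart c a b) :
    ContinuousOn (fun t ↦ coords c (x t) (ξ t)) (Icc a b) := by
  have hi := h.intervalIntegrable hc
  rw [intervalIntegrable_iff_integrableOn_Icc_of_le hc.1, ← uIcc_of_le hc.1] at hi
  have h1 := intervalIntegral.continuousOn_primitive_interval hi
  rw [uIcc_of_le hc.1] at h1
  refine (h1.const_add (coords c (x a) (ξ a))).congr fun t ht ↦ ?_
  have := h.primitive c a t ⟨ht.1, fun u hu ↦ hc.2 u ⟨hu.1, hu.2.trans ht.2⟩⟩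
  simp only [← this]
  abel

theorem IsCovDeriv.memLp_field {g : Metric n M} {x : Loop T n M} {ξ η : x.Field}
    (h : IsCovDeriv g x ξ η) (c : M) (a b : ℝ) (hc : x.InChart c a b) :
    MemLp (fun t ↦ coords c (x t) (ξ t)) 2 (volume.restrict (Icc a b)) := by
  have hco := h.continuousOn hc
  obtain ⟨C, hC⟩ := isCompact_Icc.exists_bound_of_continuousOn hco
  exact MemLp.of_bound (hco.aestronglyMeasurable measurableSet_Icc) C
    ((ae_restrict_iff' measurableSet_Icc).2 (ae_of_all _ hC))

/-- The metric coefficients are continuous along `x`. -/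
theorem continuousOn_metric (g : Metric n M) (x : Loop T n M) {c : M} {a b : ℝ}
    (hc : x.InChart c a b) (v w : Model n) :
    ContinuousOn (fun t ↦ g.inner (x t) (ofCoords c (x t) v) (ofCoords c (x t) w)) (Icc a b) := by
  have hs : ∀ v : Model n, ContinuousOn
      (fun t ↦ (⟨x t, ofCoords c (x t) v⟩ : TangentBundle (𝓡 n) M)) (Icc a b) := fun v ↦ by
    have h1 : ContinuousOn (fun t ↦ (x t, v)) (Icc a b) :=
      (x.contMDiff.continuous.prodMk continuous_const).continuousOn
    refine (((trivializationAt (Model n)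
      (TangentSpace (𝓡 n) : M → Type _) c).continuousOn_symm).comp h1 (fun t ht ↦ ⟨by
        rw [TangentBundle.trivializationAt_baseSet]; exact hc.2 t ht, mem_univ _⟩)).congr
      fun t _ ↦ ?_
    rw [ofCoords, Trivialization.symmL_apply]
    · rfl
    · rw [TangentBundle.trivializationAt_baseSet]
      exact hc.2 t ‹_›
  let _ : RiemannianBundle (fun q : M ↦ TangentSpace (𝓡 n) q) :=
    ⟨g.toContinuousRiemannianMetric.toRiemannianMetric⟩
  exact ContinuousOn.inner_bundle (F := Model n) (E := fun q : M ↦ TangentSpace (𝓡 n) q)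
    (hs v) (hs w)

/-- The scalar product of two fields that are square integrable in charts is integrable. -/
theorem intervalIntegrable_inner [Fact (0 < T)] (g : Metric n M) (x : Loop T n M)
    {η η' : x.Field}
    (h : ∀ c a b, x.InChart c a b →
      MemLp (fun t ↦ coords c (x t) (η t)) 2 (volume.restrict (Icc a b)))
    (h' : ∀ c a b, x.InChart c a b →
      MemLp (fun t ↦ coords c (x t) (η' t)) 2 (volume.restrict (Icc a b))) :
    IntervalIntegrable (fun t ↦ g.inner (x t) (η t) (η' t)) volume 0 T := by
  refine intervalIntegrable_of_inChart x fun c a b hc ↦ ?_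
  let e := EuclideanSpace.basisFun (Fin n) ℝ
  have hsum : ∀ t ∈ Icc a b, ∀ ζ : TangentSpace (𝓡 n) (x t),
      ζ = ∑ i, coords c (x t) ζ i • ofCoords c (x t) (e i) := by
    intro t ht ζ
    conv_lhs => rw [← ofCoords_coords (hc.2 t ht) ζ, ← e.sum_repr (coords c (x t) ζ)]
    simp [e]
  have hcomp : ∀ {ζ : x.Field}, MemLp (fun t ↦ coords c (x t) (ζ t)) 2
      (volume.restrict (Icc a b)) → ∀ i, MemLp (fun t ↦ coords c (x t) (ζ t) i) 2
      (volume.restrict (Icc a b)) := by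
    intro ζ hζ i
    exact (EuclideanSpace.proj (𝕜 := ℝ) i : Model n →L[ℝ] ℝ).comp_memLp' hζ
  have hint : IntegrableOn (fun t ↦ ∑ i, ∑ j,
      g.inner (x t) (ofCoords c (x t) (e i)) (ofCoords c (x t) (e j)) *
        (coords c (x t) (η t) i * coords c (x t) (η' t) j)) (Icc a b) := by
    refine integrable_finsetSum _ fun i _ ↦ integrable_finsetSum _ fun j _ ↦ ?_
    exact IntegrableOn.continuousOn_mul (continuousOn_metric g x hc (e i) (e j))
      (MemLp.integrable_mul (hcomp (h c a b hc) i) (hcomp (h' c a b hc) j)) isCompact_Icc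
  refine hint.congr_fun (fun t ht ↦ ?_) measurableSet_Icc
  conv_rhs => rw [hsum t ht (η t), hsum t ht (η' t)]
  simp only [map_sum, sum_apply, map_smul, smul_apply,
    smul_eq_mul, Finset.mul_sum]
  rw [Finset.sum_comm]
  refine Finset.sum_congr rfl fun i _ ↦ Finset.sum_congr rfl fun j _ ↦ ?_
  ring

/-- The space `H(x)` of `T`-periodic `H¹` vector fields along `x`. -/
def H1 (g : Metric n M) (x : Loop T n M) : Type := h1Submodule g x

instance (g : Metric n M) (x : Loop T n M) : AddCommGroup (H1 g x) :=
  inferInstanceAs (AddCommGroup (h1Submodule g x))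

instance (g : Metric n M) (x : Loop T n M) : Module ℝ (H1 g x) :=
  inferInstanceAs (Module ℝ (h1Submodule g x))

namespace H1

variable {g : Metric n M} {x : Loop T n M}

/-- The field underlying an element of `H(x)`. -/
def field (ξ : H1 g x) : x.Field := ξ.1

/-- The covariant derivative `∇_t ξ`, well defined up to null sets. -/
def covDeriv (ξ : H1 g x) : x.Field := Classical.choose ξ.2.2

theorem isCovDeriv (ξ : H1 g x) : IsCovDeriv g x ξ.field ξ.covDeriv :=
  Classical.choose_spec ξ.2.2

/-- The scalar product `∫₀ᵀ g(∇_t ξ, ∇_t η) + g(ξ, η) dt`. -/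
def h1Inner (ξ η : H1 g x) : ℝ :=
  ∫ t in 0..T, (g.inner (x t) (ξ.covDeriv t) (η.covDeriv t) + g.inner (x t) (ξ.field t) (η.field t))

variable [Fact (0 < T)]

theorem intervalIntegrable_covDeriv (ξ η : H1 g x) : IntervalIntegrable
    (fun t ↦ g.inner (x t) (ξ.covDeriv t) (η.covDeriv t)) volume 0 T :=
  intervalIntegrable_inner g x ξ.isCovDeriv.memLp η.isCovDeriv.memLp

theorem intervalIntegrable_field (ξ η : H1 g x) : IntervalIntegrable
    (fun t ↦ g.inner (x t) (ξ.field t) (η.field t)) volume 0 T :=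
  intervalIntegrable_inner g x ξ.isCovDeriv.memLp_field η.isCovDeriv.memLp_field

theorem covDeriv_add (ξ ξ' : H1 g x) : ∀ᵐ t ∂volume.restrict (Ioc 0 T),
    (ξ + ξ').covDeriv t = ξ.covDeriv t + ξ'.covDeriv t :=
  (ξ + ξ').isCovDeriv.unique (ξ.isCovDeriv.add ξ'.isCovDeriv)

theorem covDeriv_smul (r : ℝ) (ξ : H1 g x) : ∀ᵐ t ∂volume.restrict (Ioc 0 T),
    (r • ξ).covDeriv t = r • ξ.covDeriv t :=
  (r • ξ).isCovDeriv.unique (ξ.isCovDeriv.smul r)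

theorem inner_self_nonneg (q : M) (v : TangentSpace (𝓡 n) q) : 0 ≤ g.inner q v v := by
  rcases eq_or_ne v 0 with rfl | hv
  · simp
  · exact (g.pos q v hv).le

theorem eq_zero_of_h1Inner (ξ : H1 g x) (h : h1Inner ξ ξ = 0) : ξ = 0 := by
  have hT : 0 < T := Fact.out
  have h1 : ∫ t in 0..T, g.inner (x t) (ξ.field t) (ξ.field t) = 0 := by
    rw [h1Inner, intervalIntegral.integral_add (intervalIntegrable_covDeriv ξ ξ)
      (intervalIntegrable_field ξ ξ)] at h
    have a := intervalIntegral.integral_nonneg (μ := volume) hT.le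
      (fun t _ ↦ inner_self_nonneg (g := g) (x t) (ξ.covDeriv t))
    have b := intervalIntegral.integral_nonneg (μ := volume) hT.le
      (fun t _ ↦ inner_self_nonneg (g := g) (x t) (ξ.field t))
    linarith
  rw [intervalIntegral.integral_eq_zero_iff_of_le_of_nonneg_ae hT.le
    (ae_of_all _ fun t ↦ inner_self_nonneg (x t) _) (intervalIntegrable_field ξ ξ)] at h1
  have hae : ∀ᵐ t ∂volume.restrict (Ioc 0 T), ξ.field t = 0 := by
    filter_upwards [h1] with t ht
    by_contra hne
    exact (g.pos (x t) _ hne).ne' ht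
  have hIco : ∀ t ∈ Ico 0 T, ξ.field t = 0 := by
    intro t ht
    have hopen : (fun s ↦ x s) ⁻¹' (chartAt (Model n) (x t)).source ∈ 𝓝 t :=
      ((chartAt (Model n) (x t)).open_source.preimage x.contMDiff.continuous).mem_nhds
        (mem_chart_source _ _)
    obtain ⟨δ, hδ, hball⟩ := Metric.mem_nhds_iff.1 hopen
    obtain ⟨b, htb, hb⟩ := exists_between (lt_min ht.2 (lt_add_of_pos_right t hδ))
    have hbT := hb.trans_le (min_le_left _ _)
    have hbδ := hb.trans_le (min_le_right _ _)
    have hc : x.InChart (x t) t b := ⟨htb.le, fun s hs ↦ hball (by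
      rw [Metric.mem_ball, Real.dist_eq, abs_lt]
      exact ⟨by linarith [hs.1], by linarith [hs.2]⟩)⟩
    have key := MeasureTheory.Measure.eqOn_Icc_of_ae_eq volume htb.ne
      (f := fun s ↦ coords (x t) (x s) (ξ.field s)) (g := fun _ ↦ 0) (by
        rw [← restrict_Ioc_eq_restrict_Icc]
        have := ae_restrict_of_ae_restrict_of_subset (μ := volume) (s := Ioc t b)
          (Ioc_subset_Ioc ht.1 hbT.le) hae
        filter_upwards [this] with s hs
        simp [hs])
      (ξ.isCovDeriv.continuousOn hc) continuousOn_const (left_mem_Icc.2 htb.le)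
    have key' : coords (x t) (x t) (ξ.field t) = 0 := key
    rw [← ofCoords_coords (mem_chart_source _ (x t)) (ξ.field t), key', map_zero]
  apply Subtype.ext
  funext t
  have hper : Function.Periodic (fun t ↦ (⟨x t, ξ.field t⟩ : TangentBundle (𝓡 n) M)) T := ξ.2.1
  obtain ⟨s, hs, hst⟩ := hper.exists_mem_Ico₀ hT t
  have hx : x t = x s := congrArg TotalSpace.proj hst
  have h0 := hIco s hs
  change ξ.field t = 0
  rw [h0] at hst
  generalize ξ.field t = u at *
  revert u
  rw [hx]
  intro u hu
  simpa using hu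

/-- The scalar product of `H(x)`. -/
@[reducible] def core (g : Metric n M) (x : Loop T n M) :
    InnerProductSpace.Core ℝ (H1 g x) where
  inner := h1Inner
  conj_inner_symm ξ η := by
    simp only [h1Inner, conj_trivial]
    congr 1
    funext t
    rw [g.symm _ (η.covDeriv t), g.symm _ (η.field t)]
  re_inner_nonneg ξ := by
    have hT : 0 < T := Fact.out
    exact intervalIntegral.integral_nonneg hT.le fun t _ ↦
      add_nonneg (inner_self_nonneg _ _) (inner_self_nonneg _ _)
  add_left ξ ξ' η := by
    have hT : 0 < T := Fact.out
    simp only [h1Inner]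
    rw [← intervalIntegral.integral_add
      ((intervalIntegrable_covDeriv ξ η).add (intervalIntegrable_field ξ η))
      ((intervalIntegrable_covDeriv ξ' η).add (intervalIntegrable_field ξ' η))]
    refine intervalIntegral.integral_congr_ae_restrict ?_
    rw [uIoc_of_le hT.le]
    filter_upwards [covDeriv_add ξ ξ'] with t ht
    rw [ht, show (ξ + ξ').field t = ξ.field t + ξ'.field t from rfl]
    simp only [map_add, add_apply]
    ring
  smul_left ξ η r := by
    have hT : 0 < T := Fact.out
    simp only [h1Inner, conj_trivial]
    rw [← intervalIntegral.integral_const_mul]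
    refine intervalIntegral.integral_congr_ae_restrict ?_
    rw [uIoc_of_le hT.le]
    filter_upwards [covDeriv_smul r ξ] with t ht
    rw [ht, show (r • ξ).field t = r • ξ.field t from rfl]
    simp only [map_smul, smul_apply, smul_eq_mul]
    ring
  definite ξ h := eq_zero_of_h1Inner ξ h

instance : NormedAddCommGroup (H1 g x) :=
  (core g x).toNormedAddCommGroup

instance : InnerProductSpace ℝ (H1 g x) := InnerProductSpace.ofCore (core g x).toCore

end H1

/-! ### Lagrangians -/

/-- Time dependent Lagrangians, as functions on `ℝ × TM` (periodicity in time is a hypothesis). -/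
abbrev Lagrangian (n : ℕ) (M : Type*) [TopologicalSpace M] [ChartedSpace (Model n) M] : Type _ :=
  ℝ → TangentBundle (𝓡 n) M → ℝ

/-- `L` is smooth and `T`-periodic in time, i.e. a smooth function on `(ℝ/Tℤ) × TM`. -/
structure IsSmoothPeriodic (T : ℝ) (L : Lagrangian n M) : Prop where
  smooth : ContMDiff (𝓘(ℝ, ℝ).prod (𝓡 n).tangent) 𝓘(ℝ, ℝ) ∞
    (fun p : ℝ × TangentBundle (𝓡 n) M ↦ L p.1 p.2)
  periodic : ∀ t p, L (t + T) p = L t p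

/-- `L` is a polynomial of degree at most `2` in the velocities. -/
def IsQuadraticInVelocity (L : Lagrangian n M) : Prop :=
  ∀ (t : ℝ) (q : M), ∃ (a : TangentSpace (𝓡 n) q →L[ℝ] TangentSpace (𝓡 n) q →L[ℝ] ℝ)
    (b : TangentSpace (𝓡 n) q →L[ℝ] ℝ) (e : ℝ), ∀ v, L t ⟨q, v⟩ = a v v + b v + e

/-- The fibre Hessian `∇_vv L(t, q, v)`, as a bilinear form on `T_q M`: the second derivative at
`v` of the restriction of `L(t, ·)` to the vector space `T_q M`. -/
def fiberHessian (L : Lagrangian n M) (t : ℝ) (q : M) (v u w : TangentSpace (𝓡 n) q) : ℝ :=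
  fderiv ℝ (fderiv ℝ (fun z : Model n ↦ L t (⟨q, z⟩ : TangentBundle (𝓡 n) M))) v u w

/-- The Lagrangian in the chart around `c`, as a function of position and velocity. -/
def chartLagrangian (L : Lagrangian n M) (c : M) (t : ℝ) (p : Model n × Model n) : ℝ :=
  L t ⟨(extChartAt (𝓡 n) c).symm p.1, ofCoords c _ p.2⟩

/-- `x` is a periodic solution of the Euler-Lagrange equation `d/dt (∂_v L) = ∂_q L` (in charts),
i.e. a critical point of the action functional. -/
def IsEulerLagrange (L : Lagrangian n M) (x : Loop T n M) : Prop :=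
  ∀ (c : M) (t : ℝ), x t ∈ (chartAt (Model n) c).source →
    HasDerivAt
      (fun s ↦ (fderiv ℝ (chartLagrangian L c s) (x.pos c s, x.vel c s)).comp
        (ContinuousLinearMap.inr ℝ (Model n) (Model n)))
      ((fderiv ℝ (chartLagrangian L c t) (x.pos c t, x.vel c t)).comp
        (ContinuousLinearMap.inl ℝ (Model n) (Model n))) t

/-- The integrand of the second variation of the action at `x`, computed in the chart around `c`;
`ξ`, `η` are fields along `x` with covariant derivatives `Dξ`, `Dη`.
It is the mixed derivative `∂_ε ∂_δ` at `ε = δ = 0` of `L(t, X, ∂_t X)` for a variation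
`X(ε, δ, t)` of `x` with `∂_ε X = ξ`, `∂_δ X = η` and `∇_ε ∂_δ X = 0` at `ε = δ = 0`, which means
`∂_ε ∂_δ X = -Γ(ξ, η)` in the chart; in particular it does not depend on the chart. -/
def secondVariationIntegrand (g : Metric n M) (L : Lagrangian n M) (x : Loop T n M) (c : M)
    (ξ Dξ η Dη : x.Field) (t : ℝ) : ℝ :=
  let y := x.pos c t
  let v := x.vel c t
  let u := coords c (x t) (ξ t)
  let w := coords c (x t) (η t)
  -- the time derivatives of the components of `ξ` and `η`
  let u' := coordDeriv g x ξ Dξ c t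
  let w' := coordDeriv g x η Dη c t
  -- the time derivative of `Γ(ξ, η)`
  let Γ' := fderiv ℝ (fun z ↦ christoffel g c z u w) y v
    + christoffel g c y u' w + christoffel g c y u w'
  fderiv ℝ (fderiv ℝ (chartLagrangian L c t)) (y, v) (u, u') (w, w')
    - fderiv ℝ (chartLagrangian L c t) (y, v) (christoffel g c y u w, Γ')

variable [Fact (0 < T)]

/-- The second variation `D²𝔼(x)` of the action `𝔼(x) = ∫₀ᵀ L(t, x, x') dt` on `H(x)`. As the
integrand does not depend on the chart, `[0, T]` is subdivided into chart intervals. -/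
def secondVariation (g : Metric n M) (L : Lagrangian n M) (x : Loop T n M) (ξ η : H1 g x) : ℝ :=
  let p := Classical.choose (exists_subdivision x)
  ∑ i ∈ Finset.range p.1, ∫ t in (p.2.1 i)..(p.2.1 (i + 1)),
    secondVariationIntegrand g L x (p.2.2 i) ξ.field ξ.covDeriv η.field η.covDeriv t

/-- The form `α(ξ, η) = ∫₀ᵀ ⟨P ξ, η⟩ dt` with `P(t) = ∇_vv L(t, x(t), x'(t))`. -/
def alpha (g : Metric n M) (L : Lagrangian n M) (x : Loop T n M) (ξ η : H1 g x) : ℝ :=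
  ∫ t in 0..T, fiberHessian L t (x t) (x.velocity t) (ξ.field t) (η.field t)

/-- The index form `I_s = D²𝔼(x) + s α`. -/
def indexForm (g : Metric n M) (L : Lagrangian n M) (x : Loop T n M) (s : ℝ) (ξ η : H1 g x) : ℝ :=
  secondVariation g L x ξ η + s * alpha g L x ξ η

/-- `k` is the spectral index of `x`: the path `s ↦ I_s` has spectral flow `k` over `[0, s₀]` for
all large `s₀`, i.e. for all `s₀ > 0` such that `I_s` is nondegenerate for every `s ≥ s₀`; and
there is such an `s₀`. -/
def IsSpectralIndex (g : Metric n M) (L : Lagrangian n M) (x : Loop T n M) (k : ℤ) : Prop :=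
  (∃ s₀ > 0, ∀ s ≥ s₀, Nondegenerate (indexForm g L x s)) ∧
  ∀ s₀ > 0, (∀ s ≥ s₀, Nondegenerate (indexForm g L x s)) →
    HasFormSpectralFlow (indexForm g L x) 0 s₀ k

end LagrangianIndex

end

open Set Filter Topology MeasureTheory Bundle
open scoped Manifold ContDiff

noncomputable section

namespace LagrangianIndex

set_option linter.unusedSectionVars false

/-! ### Computing the Morse index from a splitting of the space. -/

section MorseIndex

variable {V : Type*} [AddCommGroup V] [Module ℝ V]

/-! In the scalar product of `H(x)` the form `I_s` is represented by an operator `A s = A₀ + s K`.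
Three estimates control this path. The part of `D²𝔼(x)` that is quadratic in the derivative of the
field is `∇_vv L`, so convexity gives a Gårding inequality: `D²𝔼(x)` is at least a multiple of the
squared `H¹` norm minus a multiple of the squared `L²` norm (`exists_garding`). The form `α` lies
between two positive multiples of the squared `L²` norm (`exists_fieldForm_le`, `exists_alpha_le`).
By the Poincaré inequality the `L²` norm is arbitrarily small relative to the `H¹` norm on subspaces
of finite codimension (`exists_coFG_fieldForm_le`). Hence there is `c > 0` such that, for all `s`
and all `μ < c`, the form of `A s - μ` is coercive on a subspace of finite codimension, so `A s - μ`
is Fredholm; and `A s` is positive definite for large `s`.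

The rest is abstract (`morseIndex_eq_spectralFlow`). Below any level less than `c` the operator `A
s` has only finitely many eigenvalues, with multiplicity (`exists_spectralSplit`), so its Morse
index `N s` is finite. While a gap `ε` stays outside the spectrum, the number of eigenvalues below
`ε` is constant in `s` (`morseIndex_shift_eq_of_isPreconnected`), and that number is `N s + dim
E_{[0, ε]}(A s)`. So each summand of the spectral flow is the drop of `N` over its interval, and the
sum telescopes to `N 0 - N s₀`. Finally `N s₀ = 0`: `N` is constant on `[s₀, ∞)`, where the forms
are nondegenerate, and vanishes for large `s`. Neither crossing forms nor the spectral theorem in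
infinite dimension is needed.

All forms on `H(x)` are sums of integrals over chart intervals of continuous families of symmetric
forms in the components of a field and their derivatives (`pieceForm`), so the estimates come down
to compactness in finite dimension. The operators and the Fredholm theory require `H(x)` to be
complete, which is `H1.completeSpace`. -/

theorem morseIndex_eq_finrank {B : V → V → ℝ} {X Y : Submodule ℝ V} [FiniteDimensional ℝ X]
    (hX : ∀ u ∈ X, u ≠ 0 → B u u < 0) (hY : ∀ u ∈ Y, 0 ≤ B u u) (hXY : X ⊔ Y = ⊤) :
    morseIndex B = Module.finrank ℝ X := by
  apply le_antisymm
  -- A negative definite `W` meets `Y` trivially, so it embeds in `V ⧸ Y`, while `X` maps onto `V ⧸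
  -- Y`; this gives `dim W ≤ dim X`.
  · refine iSup_le fun W ↦ ?_
    have hdisj : Disjoint W.1 Y := by
      rw [Submodule.disjoint_def]
      intro u hu hu'
      by_contra hne
      exact absurd (W.2 u hu hne) (not_lt.2 (hY u hu'))
    have h1 : Function.Injective (Y.mkQ.domRestrict W.1) := by
      rw [← LinearMap.ker_eq_bot, LinearMap.ker_eq_bot']
      intro w hw
      have : (w : V) ∈ Y := by simpa using hw
      exact Subtype.ext ((Submodule.disjoint_def.1 hdisj) _ w.2 this)
    have h2 : Function.Surjective (Y.mkQ.domRestrict X) := by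
      intro z
      obtain ⟨v, rfl⟩ := Y.mkQ_surjective z
      obtain ⟨a, ha, b, hb, hab⟩ := Submodule.mem_sup.1 (hXY ▸ Submodule.mem_top (x := v))
      refine ⟨⟨a, ha⟩, ?_⟩
      rw [LinearMap.domRestrict_apply, ← hab, map_add]
      simp [hb]
    have : FiniteDimensional ℝ (V ⧸ Y) := Module.Finite.of_surjective _ h2
    have : FiniteDimensional ℝ W.1 := Module.Finite.of_injective _ h1
    rw [← Module.finrank_eq_rank]
    simp only [map_natCast, Nat.cast_le]
    exact (LinearMap.finrank_le_finrank_of_injective h1).trans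
      (LinearMap.finrank_le_finrank_of_surjective h2)
  · refine le_iSup_of_le (⟨X, hX⟩ : {W : Submodule ℝ V // ∀ u ∈ W, u ≠ 0 → B u u < 0}) ?_
    rw [← Module.finrank_eq_rank]
    simp

end MorseIndex

/-! ### Coercive forms, Fredholm operators and lower bounds. -/

section Hilbert

variable {H : Type*} [NormedAddCommGroup H] [InnerProductSpace ℝ H]

/-- A bounded operator whose form is coercive on a subspace of finite codimension is Fredholm. -/
theorem isFredholm_of_coercive_on [CompleteSpace H] {S : H →L[ℝ] H} {V : Submodule ℝ H}
    (hV : V.CoFG) {c : ℝ} (hc : 0 < c) (h : ∀ v ∈ V, c * ‖v‖ ^ 2 ≤ inner ℝ (S v) v) :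
    S.IsFredholm := by
  -- The estimate passes to the closure of `V`, which is complete and so has an orthogonal
  -- projection. The compression `R` of `S` to it is coercive, hence invertible.
  set U := V.topologicalClosure
  have hU : U.CoFG := hV.of_le V.le_topologicalClosure
  have hUc : IsClosed (U : Set H) := V.isClosed_topologicalClosure
  have : CompleteSpace U := hUc.completeSpace_coe
  have hU' : ∀ v ∈ U, c * ‖v‖ ^ 2 ≤ inner ℝ (S v) v := by
    intro v hv
    have : IsClosed {v : H | c * ‖v‖ ^ 2 ≤ inner ℝ (S v) v} :=
      isClosed_le (by fun_prop) (by fun_prop)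
    exact this.closure_subset_iff.2 (fun w hw ↦ h w hw) hv
  let P := U.orthogonalProjectionOnto
  let R : U →L[ℝ] U := P ∘L S ∘L U.subtypeL
  have hR : ∀ u : U, inner ℝ (R u) u = inner ℝ (S u) (u : H) := fun u ↦ by
    simp [R, P]
  obtain ⟨Q, hQ⟩ : IsUnit R :=
    ContinuousLinearMap.isUnit_of_forall_le_norm_inner_map R (c := ⟨c, hc.le⟩) hc fun u ↦ by
      rw [hR]
      refine le_trans ?_ (le_abs_self _)
      have := hU' u u.2
      rw [mul_comm]
      exact this
  have hQ1 : ∀ u, R (Q.inv u) = u := fun u ↦ by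
    rw [← hQ]; exact congr($(Q.mul_inv) u)
  have hQ2 : ∀ u, Q.inv (R u) = u := fun u ↦ by
    rw [← hQ]; exact congr($(Q.inv_mul) u)
  -- The quasi-inverse is `R⁻¹ P`. On one side the composition with `S` is the identity on `U`; on
  -- the other it differs from the identity by an operator with values in `Uᗮ`, which is finite
  -- dimensional.
  refine ContinuousLinearMap.IsFredholm.of_isQuasiInverse (v := U.subtypeL ∘L Q.inv ∘L P) ⟨?_, ?_⟩
  · refine LinearMap.FiniteRangeSetoid.equiv_of_eqOn_coFG (A := U) (A_coFG := hU) ?_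
    intro u hu
    have := hQ2 ⟨u, hu⟩
    simpa [R] using congrArg Subtype.val this
  · refine LinearMap.FiniteRangeSetoid.equiv_iff_hasFiniteRange.2 ?_
    have hfin : FiniteDimensional ℝ Uᗮ :=
      .of_fg (hU.fg_of_isCompl (Submodule.isCompl_orthogonal U))
    rw [LinearMap.hasFiniteRange_iff_range]
    rw [Submodule.fg_iff_finiteDimensional]
    refine Submodule.finiteDimensional_of_le (S₂ := Uᗮ) ?_
    rintro _ ⟨y, rfl⟩
    have := hQ1 (P y)
    rw [← Submodule.orthogonalProjectionOnto_eq_zero_iff]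
    have h2 : P (S (Q.inv (P y))) = P y := this
    simp only [LinearMap.sub_apply, map_sub]
    exact sub_eq_zero.2 h2

/-- A Fredholm operator is bounded below on the orthogonal complement of its kernel. -/
theorem _root_.ContinuousLinearMap.IsFredholm.exists_le_norm {S : H →L[ℝ] H} (hS : S.IsFredholm) :
    ∃ δ > 0, ∀ v ∈ S.kerᗮ, δ * ‖v‖ ≤ ‖S v‖ := by
  obtain ⟨p⟩ := hS.nonempty_fredholmPackage
  let N : ℝ := ‖(p.equiv.symm : p.decCodom.X₁ →L[ℝ] p.decDom.X₁)‖
  have hN : 0 ≤ N := by positivity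
  refine ⟨(N + 1)⁻¹, by positivity, fun v hv ↦ ?_⟩
  set w := p.decDom.proj v
  have hSv : S v = p.equiv w := congr($(p.eq_equiv) v)
  have hSw : S w = p.equiv w := by
    refine (congr($(p.eq_equiv) w)).trans ?_
    simp
  have hker : v - w ∈ S.ker := by
    simp [hSv, hSw]
  have h0 : inner ℝ (v - w) v = 0 := hv _ hker
  have h1 : ‖v‖ ≤ ‖(w : H)‖ := by
    have h2 : ‖v‖ ^ 2 ≤ ‖(w : H)‖ * ‖v‖ := by
      rw [inner_sub_left, real_inner_self_eq_norm_sq] at h0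
      have := real_inner_le_norm (w : H) v
      linarith
    by_contra! hlt
    have : 0 < ‖v‖ := (norm_nonneg _).trans_lt hlt
    nlinarith
  have h2 : ‖(w : H)‖ ≤ N * ‖S v‖ := by
    have := (p.equiv.symm : p.decCodom.X₁ →L[ℝ] p.decDom.X₁).le_opNorm (p.equiv w)
    simp only [ContinuousLinearEquiv.coe_coe, ContinuousLinearEquiv.symm_apply_apply] at this
    rw [hSv]
    exact this
  rw [inv_mul_le_iff₀ (by positivity)]
  nlinarith [norm_nonneg (S v)]

/-- Cauchy-Schwarz for the form of a symmetric operator which is nonnegative on a subspace. -/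
theorem inner_sq_le_of_nonneg {S : H →L[ℝ] H} (hS : S.IsSymmetric) {V : Submodule ℝ H}
    (h : ∀ v ∈ V, 0 ≤ inner ℝ (S v) v) {u v : H} (hu : u ∈ V) (hv : v ∈ V) :
    inner ℝ (S u) v ^ 2 ≤ inner ℝ (S u) u * inner ℝ (S v) v := by
  have hsymm : inner ℝ (S v) u = inner ℝ (S u) v := by
    rw [real_inner_comm]; exact (hS u v).symm
  -- The form at `t • v + u` is a nonnegative quadratic polynomial in `t`, so its discriminant is
  -- nonpositive.
  have key : ∀ t : ℝ, 0 ≤ inner ℝ (S v) v * (t * t) + 2 * inner ℝ (S u) v * t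
      + inner ℝ (S u) u := by
    intro t
    have := h (t • v + u) (V.add_mem (V.smul_mem t hv) hu)
    simp only [map_add, map_smul, inner_add_left, inner_add_right, inner_smul_left,
      inner_smul_right, hsymm, conj_trivial] at this
    linarith
  have := discrim_le_zero key
  rw [discrim] at this
  linarith

/-- If a symmetric operator is bounded below by `δ` on an invariant subspace, and its form by `-η`
with `η < δ`, then its form is bounded below by `δ`. -/
theorem le_inner_of_le_norm {S : H →L[ℝ] H} (hS : S.IsSymmetric) {V : Submodule ℝ H}
    (hV : ∀ v ∈ V, S v ∈ V) {δ η : ℝ} (hηδ : η < δ) (h1 : ∀ v ∈ V, δ * ‖v‖ ≤ ‖S v‖)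
    (h2 : ∀ v ∈ V, -η * ‖v‖ ^ 2 ≤ inner ℝ (S v) v) :
    ∀ v ∈ V, δ * ‖v‖ ^ 2 ≤ inner ℝ (S v) v := by
  by_contra! hcon
  obtain ⟨v₀, hv₀, hlt⟩ := hcon
  have hne : v₀ ≠ 0 := by rintro rfl; simp at hlt
  -- The infimum `l` of the Rayleigh quotients would satisfy `|l| < δ`. Then `R = S - l` is
  -- nonnegative and bounded below by `r = δ - |l|` on `V`, which contradicts that `l` is an
  -- infimum: the bottom of a form is always an approximate eigenvalue.
  let D : Set ℝ := {r | ∃ v ∈ V, v ≠ 0 ∧ r = inner ℝ (S v) v / ‖v‖ ^ 2}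
  have hD : BddBelow D := ⟨-η, by
    rintro _ ⟨v, hv, hv0, rfl⟩
    have : 0 < ‖v‖ := norm_pos_iff.2 hv0
    rw [le_div_iff₀ (by positivity)]
    exact h2 v hv⟩
  have hD0 : D.Nonempty := ⟨_, v₀, hv₀, hne, rfl⟩
  set l := sInf D
  have hl1 : -η ≤ l := le_csInf hD0 (by
    rintro _ ⟨v, hv, hv0, rfl⟩
    have : 0 < ‖v‖ := norm_pos_iff.2 hv0
    rw [le_div_iff₀ (by positivity)]
    exact h2 v hv)
  have hl2 : l < δ := by
    refine (csInf_le hD ⟨v₀, hv₀, hne, rfl⟩).trans_lt ?_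
    have : 0 < ‖v₀‖ := norm_pos_iff.2 hne
    rw [div_lt_iff₀ (by positivity)]
    exact hlt
  set r := δ - |l| with hr
  have hr0 : 0 < r := by
    rw [hr, sub_pos, abs_lt]
    exact ⟨by linarith, hl2⟩
  let R : H →L[ℝ] H := S - l • ContinuousLinearMap.id ℝ H
  have hRa : ∀ v, R v = S v - l • v := fun v ↦ rfl
  have hRs : R.IsSymmetric := by
    intro u v
    have := hS u v
    simp only [ContinuousLinearMap.coe_coe, hRa, inner_sub_left, inner_sub_right, inner_smul_left,
      inner_smul_right, conj_trivial] at this ⊢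
    rw [this]
  have hRi : ∀ v, inner ℝ (R v) v = inner ℝ (S v) v - l * ‖v‖ ^ 2 := fun v ↦ by
    rw [hRa, inner_sub_left, inner_smul_left, real_inner_self_eq_norm_sq]
    simp
  have hR0 : ∀ v ∈ V, 0 ≤ inner ℝ (R v) v := by
    intro v hv
    rcases eq_or_ne v 0 with rfl | hv0
    · simp
    have : 0 < ‖v‖ := norm_pos_iff.2 hv0
    have h3 : l ≤ inner ℝ (S v) v / ‖v‖ ^ 2 := csInf_le hD ⟨v, hv, hv0, rfl⟩
    rw [le_div_iff₀ (by positivity)] at h3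
    rw [hRi]
    linarith
  have hlow : ∀ v ∈ V, v ≠ 0 → l + r ^ 2 / (‖R‖ + 1) ≤ inner ℝ (S v) v / ‖v‖ ^ 2 := by
    intro v hv hv0
    have hvp : 0 < ‖v‖ := norm_pos_iff.2 hv0
    have hRV : R v ∈ V := V.sub_mem (hV v hv) (V.smul_mem _ hv)
    have h4 : r * ‖v‖ ≤ ‖R v‖ := by
      have := norm_sub_norm_le (S v) (l • v)
      rw [norm_smul, Real.norm_eq_abs] at this
      rw [hRa, hr]
      nlinarith [h1 v hv]
    have hRp : 0 < ‖R v‖ := lt_of_lt_of_le (by positivity) h4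
    -- Cauchy-Schwarz for the form of `R`, applied to `v` and `R v`, gives `‖R v‖² ≤ ‖R‖ ⟪R v, v⟫`;
    -- invariance of `V` is needed for `R v ∈ V`. The `+ 1` in the bound avoids a division by zero.
    have h5 := inner_sq_le_of_nonneg hRs hR0 hv hRV
    rw [real_inner_self_eq_norm_sq] at h5
    have h6 : inner ℝ (R (R v)) (R v) ≤ ‖R‖ * ‖R v‖ ^ 2 := by
      refine (real_inner_le_norm _ _).trans ?_
      have := R.le_opNorm (R v)
      nlinarith
    have h7 : ‖R v‖ ^ 2 ≤ inner ℝ (R v) v * ‖R‖ := by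
      have h8 := h5.trans (mul_le_mul_of_nonneg_left h6 (hR0 v hv))
      have h9 : 0 < ‖R v‖ ^ 2 := by positivity
      nlinarith
    have h8 : (r * ‖v‖) ^ 2 ≤ ‖R v‖ ^ 2 := pow_le_pow_left₀ (by positivity) h4 2
    rw [le_div_iff₀ (by positivity)]
    have h9 : r ^ 2 / (‖R‖ + 1) * ‖v‖ ^ 2 ≤ inner ℝ (R v) v := by
      rw [div_mul_eq_mul_div, div_le_iff₀ (by positivity)]
      nlinarith [hR0 v hv, norm_nonneg R]
    rw [hRi] at h9
    linarith
  have : l + r ^ 2 / (‖R‖ + 1) ≤ l := le_csInf hD0 (by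
    rintro _ ⟨v, hv, hv0, rfl⟩
    exact hlow v hv hv0)
  have h10 : 0 < r ^ 2 / (‖R‖ + 1) := by positivity
  linarith

end Hilbert

/-! ### The spectrum at the bottom of a symmetric operator: finitely many eigenvectors. -/

section SpectralSplit

variable {H : Type*} [NormedAddCommGroup H] [InnerProductSpace ℝ H]

/-- The operator `A - μ`. -/
abbrev shift (A : H →L[ℝ] H) (μ : ℝ) : H →L[ℝ] H := A - μ • ContinuousLinearMap.id ℝ H

theorem inner_shift (A : H →L[ℝ] H) (μ : ℝ) (v : H) :
    inner ℝ (shift A μ v) v = inner ℝ (A v) v - μ * ‖v‖ ^ 2 := by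
  simp [shift, inner_sub_left, inner_smul_left]

theorem shift_isSymmetric {A : H →L[ℝ] H} (hA : A.IsSymmetric) (μ : ℝ) :
    (shift A μ).IsSymmetric := by
  intro u v
  have := hA u v
  simp only [ContinuousLinearMap.coe_coe, shift, sub_apply, smul_apply,
    ContinuousLinearMap.id_apply, inner_sub_left, inner_sub_right, inner_smul_left,
    inner_smul_right, conj_trivial] at this ⊢
  rw [this]

theorem mapsTo_orthogonal {A : H →L[ℝ] H} (hA : A.IsSymmetric) {W : Submodule ℝ H}
    (hW : ∀ w ∈ W, A w ∈ W) : ∀ v ∈ Wᗮ, A v ∈ Wᗮ := by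
  intro v hv w hw
  rw [← show inner ℝ (A w) v = inner ℝ w (A v) from hA w v]
  exact hv _ (hW w hw)

/-- If `A - μ` is Fredholm for all `μ ≤ l`, then the form of `A` is bounded below by some
`μ > l` on the complement of a finite dimensional invariant subspace. -/
theorem exists_invariant_subspace {A : H →L[ℝ] H} (hA : A.IsSymmetric) {l : ℝ}
    (hF : ∀ μ ≤ l, (shift A μ).IsFredholm) :
    ∃ μ > l, ∃ W : Submodule ℝ H, FiniteDimensional ℝ W ∧ (∀ w ∈ W, A w ∈ W) ∧
      ∀ v ∈ Wᗮ, μ * ‖v‖ ^ 2 ≤ inner ℝ (A v) v := by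
  -- `D` is the set of lower bounds that can be reached by removing a finite dimensional invariant
  -- subspace. If its supremum `s` were at most `l`, then `A - s` would be Fredholm, and removing
  -- its kernel as well would raise the bound to `s + δ`.
  let D : Set ℝ := {μ | ∃ W : Submodule ℝ H, FiniteDimensional ℝ W ∧ (∀ w ∈ W, A w ∈ W) ∧
      ∀ v ∈ Wᗮ, μ * ‖v‖ ^ 2 ≤ inner ℝ (A v) v}
  by_contra! hcon
  have hbdd : ∀ μ ∈ D, μ ≤ l := by
    intro μ hμ
    by_contra! hlt
    obtain ⟨W, h1, h2, h3⟩ := hμ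
    obtain ⟨v, hv, hv'⟩ := hcon μ hlt W h1 h2
    exact absurd (h3 v hv) (not_le.2 hv')
  have hne : D.Nonempty := by
    refine ⟨-‖A‖, ⊥, inferInstance, by simp, fun v _ ↦ ?_⟩
    have h1 := abs_le.1 (abs_real_inner_le_norm (A v) v)
    have h2 := A.le_opNorm v
    nlinarith [norm_nonneg v, h1.1]
  have hs : sSup D ≤ l := csSup_le hne hbdd
  obtain ⟨δ, hδ, hgap⟩ := (hF _ hs).exists_le_norm
  have hfin := (hF _ hs).finite_ker
  set s := sSup D with hsdef
  set S := shift A s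
  obtain ⟨μ, ⟨W, hW, hinv, hlow⟩, hμ⟩ := exists_lt_of_lt_csSup hne
    (show s - δ < s by linarith)
  have hS : S.IsSymmetric := shift_isSymmetric hA s
  have hSA : ∀ v, A v = S v + s • v := fun v ↦ by simp [S, shift]
  have hinv' : ∀ w ∈ W ⊔ S.ker, A w ∈ W ⊔ S.ker := by
    intro w hw
    obtain ⟨a, ha, b, hb, rfl⟩ := Submodule.mem_sup.1 hw
    rw [map_add]
    refine add_mem (Submodule.mem_sup_left (hinv a ha)) (Submodule.mem_sup_right ?_)
    have hb' : S b = 0 := hb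
    rw [hSA, hb', zero_add]
    exact Submodule.smul_mem _ _ hb
  -- On the complement of `W ⊔ S.ker` the form of `S = A - s` is at least `-(s - μ)` with `s - μ <
  -- δ`, while `S` is bounded below by `δ`; together these force the form to be at least `δ`.
  have key := le_inner_of_le_norm hS (V := (W ⊔ S.ker)ᗮ) (δ := δ) (η := s - μ)
    (fun v hv ↦ ?_) (by linarith)
    (fun v hv ↦ hgap v (Submodule.orthogonal_le le_sup_right hv))
    (fun v hv ↦ ?_)
  · have : s + δ ∈ D := ⟨W ⊔ S.ker, inferInstance, hinv', fun v hv ↦ by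
      have := key v hv
      rw [inner_shift] at this
      linarith⟩
    have h1 := le_csSup ⟨l, hbdd⟩ this
    linarith
  · exact (Submodule.sub_mem _ (mapsTo_orthogonal hA hinv' v hv) (Submodule.smul_mem _ _ hv))
  · have := hlow v (Submodule.orthogonal_le le_sup_left hv)
    rw [inner_shift]
    linarith

/-- Finitely many orthonormal eigenvectors `b i` of `A`, with eigenvalues `ν i`, such that the form
of `A` is bounded below by `μ` on their orthogonal complement. -/
structure SpectralSplit (A : H →L[ℝ] H) (μ : ℝ) where
  /-- The number of eigenvectors. -/
  d : ℕ
  /-- The eigenvectors. -/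
  b : Fin d → H
  /-- The eigenvalues. -/
  ν : Fin d → ℝ
  orthonormal : Orthonormal ℝ b
  apply_b : ∀ i, A (b i) = ν i • b i
  le_inner : ∀ v, (∀ i, inner ℝ (b i) v = 0) → μ * ‖v‖ ^ 2 ≤ inner ℝ (A v) v

/-- The finite dimensional spectral theorem diagonalizes `A` on the invariant subspace of
`exists_invariant_subspace`. -/
theorem exists_spectralSplit {A : H →L[ℝ] H} (hA : A.IsSymmetric) {l : ℝ}
    (hF : ∀ μ ≤ l, (shift A μ).IsFredholm) : ∃ μ > l, Nonempty (SpectralSplit A μ) := by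
  obtain ⟨μ, hμ, W, hW, hinv, hlow⟩ := exists_invariant_subspace hA hF
  have hsym : ((A : H →ₗ[ℝ] H).restrict hinv).IsSymmetric := hA.restrict_invariant hinv
  let b := hsym.eigenvectorBasis rfl
  refine ⟨μ, hμ, ⟨_, fun i ↦ (b i : H), fun i ↦ hsym.eigenvalues rfl i,
    b.orthonormal.comp_linearIsometry W.subtypeₗᵢ, fun i ↦ ?_, fun v hv ↦ hlow v ?_⟩⟩
  · have := hsym.apply_eigenvectorBasis rfl i
    exact congrArg Subtype.val this
  · intro w hw
    have h1 : (⟨w, hw⟩ : W) = ∑ i, inner ℝ (b i) ⟨w, hw⟩ • b i := (b.sum_repr' _).symm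
    have h2 : w = ∑ i, inner ℝ (b i) (⟨w, hw⟩ : W) • (b i : H) := by
      simpa using congrArg Subtype.val h1
    rw [h2, sum_inner]
    exact Finset.sum_eq_zero fun i _ ↦ by rw [inner_smul_left, hv i, mul_zero]

namespace SpectralSplit

variable {A : H →L[ℝ] H} {μ : ℝ} (P : SpectralSplit A μ)

/-- The component orthogonal to the eigenvectors. -/
def rest (v : H) : H := v - ∑ i, inner ℝ (P.b i) v • P.b i

theorem inner_b_rest (v : H) (i : Fin P.d) : inner ℝ (P.b i) (P.rest v) = 0 := by
  rw [rest, inner_sub_right, P.orthonormal.inner_right_fintype, sub_self]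

theorem eq_add_rest (v : H) : v = ∑ i, inner ℝ (P.b i) v • P.b i + P.rest v := by
  rw [rest]; abel

theorem norm_sq_eq (v : H) : ‖v‖ ^ 2 = ∑ i, inner ℝ (P.b i) v ^ 2 + ‖P.rest v‖ ^ 2 := by
  set w := P.rest v
  have h0 : ∀ i, inner ℝ (P.b i) w = 0 := P.inner_b_rest v
  have h1 : inner ℝ (∑ i, inner ℝ (P.b i) v • P.b i) w = (0 : ℝ) := by
    rw [sum_inner]
    exact Finset.sum_eq_zero fun i _ ↦ by rw [inner_smul_left, h0, mul_zero]
  conv_lhs => rw [P.eq_add_rest v]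
  rw [norm_add_sq_real, h1, ← real_inner_self_eq_norm_sq (∑ i, _), P.orthonormal.inner_sum]
  simp only [conj_trivial, mul_zero, add_zero, sq]
  rfl

theorem inner_apply_eq (hA : A.IsSymmetric) (v : H) : inner ℝ (A v) v =
    ∑ i, P.ν i * inner ℝ (P.b i) v ^ 2 + inner ℝ (A (P.rest v)) (P.rest v) := by
  set w := P.rest v with hw
  have h0 : ∀ i, inner ℝ (P.b i) w = 0 := P.inner_b_rest v
  set z := ∑ i, inner ℝ (P.b i) v • P.b i with hz
  have hv : v = z + w := P.eq_add_rest v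
  have hAz : A z = ∑ i, (P.ν i * inner ℝ (P.b i) v) • P.b i := by
    rw [hz, map_sum]
    refine Finset.sum_congr rfl fun i _ ↦ ?_
    rw [map_smul, P.apply_b, smul_smul, mul_comm]
  have h1 : inner ℝ (A z) w = 0 := by
    rw [hAz, sum_inner]
    exact Finset.sum_eq_zero fun i _ ↦ by rw [inner_smul_left, h0, mul_zero]
  have h2 : inner ℝ (A w) z = 0 := by
    rw [← h1, real_inner_comm]; exact (hA z w).symm
  have h3 : inner ℝ (A z) z = ∑ i, P.ν i * inner ℝ (P.b i) v ^ 2 := by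
    rw [hAz, hz, P.orthonormal.inner_sum]
    refine Finset.sum_congr rfl fun i _ ↦ ?_
    rw [conj_trivial]; ring
  conv_lhs => rw [hv]
  rw [map_add, inner_add_left, inner_add_right, inner_add_right, h1, h2, h3]
  ring

/-- The span of some of the eigenvectors. -/
def sub (I : Finset (Fin P.d)) : Submodule ℝ H := Submodule.span ℝ (P.b '' I)

instance (I : Finset (Fin P.d)) : FiniteDimensional ℝ (P.sub I) :=
  FiniteDimensional.span_of_finite ℝ (I.finite_toSet.image _)

theorem finrank_sub (I : Finset (Fin P.d)) : Module.finrank ℝ (P.sub I) = I.card := by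
  have h := P.orthonormal.linearIndependent.comp (Subtype.val : I → Fin P.d) Subtype.val_injective
  have := finrank_span_eq_card h
  rw [Fintype.card_coe] at this
  have e : P.b '' I = range (P.b ∘ (Subtype.val : I → Fin P.d)) := by
    ext v
    simp
  rw [sub, e, this]

theorem inner_b_of_mem_sub {I : Finset (Fin P.d)} {v : H} (hv : v ∈ P.sub I) {i : Fin P.d}
    (hi : i ∉ I) : inner ℝ (P.b i) v = 0 := by
  induction hv using Submodule.span_induction with
  | mem x hx =>
    obtain ⟨j, hj, rfl⟩ := hx
    exact P.orthonormal.2 (fun h ↦ hi (h ▸ hj))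
  | zero => simp
  | add x y _ _ hx hy => rw [inner_add_right, hx, hy, add_zero]
  | smul a x _ hx => rw [inner_smul_right, hx, mul_zero]

theorem mem_sub {I : Finset (Fin P.d)} {v : H} (hv : ∀ i ∉ I, inner ℝ (P.b i) v = 0)
    (hr : P.rest v = 0) : v ∈ P.sub I := by
  rw [P.eq_add_rest v, hr, add_zero]
  refine Submodule.sum_mem _ fun i _ ↦ ?_
  by_cases hi : i ∈ I
  · exact Submodule.smul_mem _ _ (Submodule.subset_span ⟨i, hi, rfl⟩)
  · rw [hv i hi, zero_smul]; exact zero_mem _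

theorem rest_eq_zero {I : Finset (Fin P.d)} {v : H} (hv : v ∈ P.sub I) : P.rest v = 0 := by
  induction hv using Submodule.span_induction with
  | mem x hx =>
    obtain ⟨j, hj, rfl⟩ := hx
    rw [rest, Finset.sum_eq_single j, real_inner_self_eq_norm_sq, P.orthonormal.1]
    · simp
    · intro i _ hij
      rw [P.orthonormal.2 hij, zero_smul]
    · simp
  | zero => simp [rest]
  | add x y _ _ hx hy =>
    have : P.rest (x + y) = P.rest x + P.rest y := by
      simp only [rest, inner_add_right, add_smul, Finset.sum_add_distrib]; abel
    rw [this, hx, hy, add_zero]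
  | smul a x _ hx =>
    have : P.rest (a • x) = a • P.rest x := by
      simp only [rest, inner_smul_right, smul_sub, Finset.smul_sum, smul_smul]
    rw [this, hx, smul_zero]

theorem inner_le_of_mem_sub (hA : A.IsSymmetric) {I : Finset (Fin P.d)} {p : ℝ}
    (hp : ∀ i ∈ I, P.ν i ≤ p) {v : H} (hv : v ∈ P.sub I) : inner ℝ (A v) v ≤ p * ‖v‖ ^ 2 := by
  rw [P.inner_apply_eq hA, P.norm_sq_eq, P.rest_eq_zero hv]
  simp only [map_zero, inner_zero_left, add_zero, norm_zero, ne_eq, OfNat.ofNat_ne_zero,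
    not_false_eq_true, zero_pow, Finset.mul_sum]
  refine Finset.sum_le_sum fun i _ ↦ ?_
  by_cases hi : i ∈ I
  · exact mul_le_mul_of_nonneg_right (hp i hi) (sq_nonneg _)
  · rw [P.inner_b_of_mem_sub hv hi]; simp

theorem le_inner_of_mem_orthogonal (hA : A.IsSymmetric) {I : Finset (Fin P.d)} {q : ℝ}
    (hq : ∀ i ∉ I, q ≤ P.ν i) (hqμ : q ≤ μ) {v : H} (hv : v ∈ (P.sub I)ᗮ) :
    q * ‖v‖ ^ 2 ≤ inner ℝ (A v) v := by
  rw [P.inner_apply_eq hA, P.norm_sq_eq, mul_add, Finset.mul_sum]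
  refine add_le_add (Finset.sum_le_sum fun i _ ↦ ?_) ?_
  · by_cases hi : i ∈ I
    · rw [hv _ (Submodule.subset_span ⟨i, hi, rfl⟩)]; simp
    · exact mul_le_mul_of_nonneg_right (hq i hi) (sq_nonneg _)
  · exact (mul_le_mul_of_nonneg_right hqμ (sq_nonneg _)).trans (P.le_inner _ (P.inner_b_rest v))

/-- The number of eigenvalues `< l` is the Morse index of `A - l`. -/
theorem morseIndex_shift (hA : A.IsSymmetric) {l : ℝ} (hl : l ≤ μ) :
    morseIndex (fun u v ↦ inner ℝ (shift A l u) v) = (Finset.univ.filter (P.ν · < l)).card := by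
  set I := Finset.univ.filter (P.ν · < l) with hI
  rw [morseIndex_eq_finrank (X := P.sub I) (Y := (P.sub I)ᗮ), finrank_sub]
  · intro u hu hu0
    -- Strict negativity needs a bound `p < l`: the largest of the eigenvalues below `l`, or any
    -- number below `l` if there are none.
    obtain ⟨p, hp, hpl⟩ : ∃ p, (∀ i ∈ I, P.ν i ≤ p) ∧ p < l := by
      rcases I.eq_empty_or_nonempty with h | h
      · exact ⟨l - 1, by simp [h], by linarith⟩
      · obtain ⟨j, hj, hmax⟩ := I.exists_max_image P.ν h
        exact ⟨P.ν j, hmax, (Finset.mem_filter.1 hj).2⟩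
    have h1 := P.inner_le_of_mem_sub hA hp hu
    rw [inner_shift]
    have : 0 < ‖u‖ := norm_pos_iff.2 hu0
    nlinarith [sq_pos_of_pos this]
  · intro u hu
    have := P.le_inner_of_mem_orthogonal hA (q := l) (fun i hi ↦ by simpa [hI] using hi) hl hu
    rw [inner_shift]
    linarith
  · exact Submodule.sup_orthogonal_of_hasOrthogonalProjection

/-- Eigenvectors for different eigenvalues are orthogonal, and the remainder of `v` is again mapped
to `r` times itself. On the complement the form is at least `μ > r`, so the remainder vanishes. -/
theorem eigenvector_mem_sub (hA : A.IsSymmetric) {r : ℝ} (hr : r < μ) {v : H} (hv : A v = r • v)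
    {I : Finset (Fin P.d)} (hI : ∀ i ∉ I, P.ν i ≠ r) : v ∈ P.sub I := by
  have h1 : ∀ i, P.ν i * inner ℝ (P.b i) v = r * inner ℝ (P.b i) v := by
    intro i
    have : inner ℝ (A (P.b i)) v = inner ℝ (P.b i) (A v) := hA _ _
    rwa [P.apply_b, hv, inner_smul_left, inner_smul_right, conj_trivial] at this
  refine P.mem_sub (fun i hi ↦ ?_) ?_
  · by_contra hne
    exact hI i hi (mul_right_cancel₀ hne (h1 i))
  · have h2 : A (P.rest v) = r • P.rest v := by
      simp only [rest, map_sub, map_sum, map_smul, P.apply_b, hv, smul_sub, Finset.smul_sum,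
        smul_smul]
      congr 1
      refine Finset.sum_congr rfl fun i _ ↦ ?_
      rw [mul_comm, h1]
    have h3 := P.le_inner _ (P.inner_b_rest v)
    rw [h2, inner_smul_left, real_inner_self_eq_norm_sq, conj_trivial] at h3
    by_contra hne
    have : 0 < ‖P.rest v‖ := norm_pos_iff.2 hne
    nlinarith [sq_pos_of_pos this]

theorem dimEigen_eq (hA : A.IsSymmetric) {ε : ℝ} (hε : ε < μ) :
    dimEigen A ε = (Finset.univ.filter fun i ↦ 0 ≤ P.ν i ∧ P.ν i ≤ ε).card := by
  set I := Finset.univ.filter fun i ↦ 0 ≤ P.ν i ∧ P.ν i ≤ ε with hI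
  have : (⨆ r ∈ Icc (0 : ℝ) ε, Module.End.eigenspace (A : H →ₗ[ℝ] H) r) = P.sub I := by
    apply le_antisymm
    · refine iSup₂_le fun r hr v hv ↦ ?_
      rw [Module.End.mem_eigenspace_iff] at hv
      refine P.eigenvector_mem_sub hA (hr.2.trans_lt hε) hv fun i hi h ↦ hi ?_
      rw [hI, Finset.mem_filter, h]
      exact ⟨Finset.mem_univ _, hr⟩
    · rw [sub, Submodule.span_le]
      rintro _ ⟨i, hi, rfl⟩
      have hi' : 0 ≤ P.ν i ∧ P.ν i ≤ ε := by simpa [hI] using hi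
      refine Submodule.mem_iSup_of_mem (P.ν i) (Submodule.mem_iSup_of_mem hi' ?_)
      rw [Module.End.mem_eigenspace_iff]
      exact P.apply_b i
  rw [dimEigen, this, finrank_sub]

end SpectralSplit

end SpectralSplit

/-! ### Paths of operators: invariance of the Morse index and the spectral flow. -/

section Path

variable {H : Type*} [NormedAddCommGroup H] [InnerProductSpace ℝ H]

theorem isUnit_shift_iff {A : H →L[ℝ] H} {l : ℝ} : l ∉ spectrum ℝ A ↔ IsUnit (shift A l) := by
  rw [spectrum.notMem_iff, ← IsUnit.neg_iff, neg_sub, Algebra.algebraMap_eq_smul_one]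
  rfl

theorem eq_zero_of_notMem_spectrum {A : H →L[ℝ] H} {l : ℝ} (h : l ∉ spectrum ℝ A) {v : H}
    (hv : A v = l • v) : v = 0 := by
  obtain ⟨Q, hQ⟩ := isUnit_shift_iff.1 h
  have h1 : Q.inv (shift A l v) = v := by
    rw [← hQ]; exact congr($(Q.inv_mul) v)
  rw [← h1, show shift A l v = A v - l • v from rfl, hv, sub_self, map_zero]

/-- An injective symmetric Fredholm operator is invertible. -/
theorem isUnit_of_isFredholm [CompleteSpace H] {S : H →L[ℝ] H} (hS : S.IsSymmetric)
    (hF : S.IsFredholm) (h : ∀ v, S v = 0 → v = 0) : IsUnit S := by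
  rw [ContinuousLinearMap.isUnit_iff_bijective]
  refine ⟨(injective_iff_map_eq_zero S).2 h, ?_⟩
  have : CompleteSpace S.range := hF.isClosed_range.completeSpace_coe
  -- The range is closed. If `v` is orthogonal to it, then `‖S v‖² = ⟪S (S v), v⟫ = 0`, so `v = 0`.
  have h1 : S.range = ⊤ := by
    rw [← Submodule.orthogonal_eq_bot_iff, Submodule.eq_bot_iff]
    intro v hv
    refine h v ?_
    have h2 : inner ℝ (S (S v)) v = 0 := hv _ ⟨S v, rfl⟩
    rw [show inner ℝ (S (S v)) v = inner ℝ (S v) (S v) from hS _ _] at h2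
    exact inner_self_eq_zero.1 h2
  exact LinearMap.range_eq_top.1 h1

namespace SpectralSplit

variable {A : H →L[ℝ] H} {μ : ℝ} (P : SpectralSplit A μ)

/-- If `l` is not an eigenvalue of `A`, then the Morse index of `A' - l` is the same for all `A'`
close to `A`. -/
theorem exists_morseIndex_shift_eq (hA : A.IsSymmetric) {l : ℝ} (hl : l < μ)
    (hν : ∀ i, P.ν i ≠ l) : ∃ η > 0, ∀ A' : H →L[ℝ] H, ‖A' - A‖ < η →
      morseIndex (fun u v ↦ inner ℝ (shift A' l u) v)
        = (Finset.univ.filter (P.ν · < l)).card := by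
  set I := Finset.univ.filter (P.ν · < l) with hI
  -- `η` is a lower bound for the distance from `l` to the eigenvalues `P.ν i` and to `μ`. A
  -- perturbation of norm less than `η` therefore leaves `A' - l` negative on the span of the low
  -- eigenvectors of `A` and nonnegative on its complement.
  obtain ⟨η, hη, hημ, hην⟩ : ∃ η > 0, l + η ≤ μ ∧ ∀ i, η ≤ |P.ν i - l| := by
    have h1 : ∀ᶠ η in 𝓝[>] (0 : ℝ), η ≤ μ - l :=
      (eventually_le_nhds (sub_pos.2 hl)).filter_mono nhdsWithin_le_nhds
    have h2 : ∀ᶠ η in 𝓝[>] (0 : ℝ), ∀ i, η ≤ |P.ν i - l| := eventually_all.2 fun i ↦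
      (eventually_le_nhds (abs_pos.2 (sub_ne_zero.2 (hν i)))).filter_mono nhdsWithin_le_nhds
    obtain ⟨η, h3, h4, h5⟩ := (h1.and (h2.and self_mem_nhdsWithin)).exists
    exact ⟨η, h5, by linarith, h4⟩
  refine ⟨η, hη, fun A' hA' ↦ ?_⟩
  have hdiff : ∀ u, |inner ℝ (A' u) u - inner ℝ (A u) u| ≤ ‖A' - A‖ * ‖u‖ ^ 2 := by
    intro u
    rw [← inner_sub_left, ← sub_apply]
    refine (abs_real_inner_le_norm _ _).trans ?_
    have := (A' - A).le_opNorm u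
    nlinarith [norm_nonneg u]
  rw [morseIndex_eq_finrank (X := P.sub I) (Y := (P.sub I)ᗮ), finrank_sub]
  · intro u hu hu0
    have h1 := P.inner_le_of_mem_sub hA (p := l - η) (fun i hi ↦ by
      have h2 : P.ν i < l := (Finset.mem_filter.1 hi).2
      have := hην i
      rw [abs_of_neg (by linarith)] at this
      linarith) hu
    have h3 := (abs_le.1 (hdiff u)).2
    rw [inner_shift]
    have : 0 < ‖u‖ ^ 2 := by have := norm_pos_iff.2 hu0; positivity
    nlinarith
  · intro u hu
    have h1 := P.le_inner_of_mem_orthogonal hA (q := l + η) (fun i hi ↦ by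
      have h2 : l ≤ P.ν i := by simpa [hI] using hi
      have := hην i
      rw [abs_of_nonneg (by linarith)] at this
      linarith) hημ hu
    have h3 := (abs_le.1 (hdiff u)).1
    rw [inner_shift]
    nlinarith [sq_nonneg ‖u‖]
  · exact Submodule.sup_orthogonal_of_hasOrthogonalProjection

end SpectralSplit

/-- No eigenvalue crosses the level `l`, so the index is locally constant in `s`. -/
theorem morseIndex_shift_eq_of_isPreconnected {A : ℝ → H →L[ℝ] H} {U : Set ℝ}
    (hU : IsPreconnected U) (hc : ContinuousOn A U) (hs : ∀ s ∈ U, (A s).IsSymmetric) {l : ℝ}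
    (hspec : ∀ s ∈ U, l ∉ spectrum ℝ (A s))
    (hF : ∀ s ∈ U, ∀ μ ≤ l, (shift (A s) μ).IsFredholm) {a b : ℝ} (ha : a ∈ U) (hb : b ∈ U) :
    morseIndex (fun u v ↦ inner ℝ (shift (A a) l u) v)
      = morseIndex (fun u v ↦ inner ℝ (shift (A b) l u) v) := by
  let f : U → ℕ∞ := fun s ↦ morseIndex (fun u v ↦ inner ℝ (shift (A s) l u) v)
  have hf : IsLocallyConstant f := by
    rw [IsLocallyConstant.iff_eventually_eq]
    rintro ⟨s, hsU⟩
    obtain ⟨μ, hμ, ⟨P⟩⟩ := exists_spectralSplit (hs s hsU) (hF s hsU)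
    obtain ⟨η, hη, h⟩ := P.exists_morseIndex_shift_eq (hs s hsU) hμ (fun i hi ↦ by
      have := eq_zero_of_notMem_spectrum (hspec s hsU) (hi ▸ P.apply_b i)
      have h1 := P.orthonormal.1 i
      rw [this, norm_zero] at h1
      exact zero_ne_one h1)
    have hcont : Continuous (fun s : U ↦ A s) := continuousOn_iff_continuous_domRestrict.1 hc
    have h1 : ∀ᶠ r : U in 𝓝 ⟨s, hsU⟩, ‖A r - A s‖ < η := by
      have := hcont.continuousAt (x := ⟨s, hsU⟩)
      have := Metric.tendsto_nhds.1 this η hη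
      simpa only [dist_eq_norm] using this
    filter_upwards [h1] with r hr
    change morseIndex _ = morseIndex _
    rw [h (A r) hr, h (A s) (by simpa using hη)]
  have : PreconnectedSpace U := Subtype.preconnectedSpace hU
  exact hf.apply_eq_of_preconnectedSpace ⟨a, ha⟩ ⟨b, hb⟩

theorem shift_zero (A : H →L[ℝ] H) : shift A 0 = A := by simp [shift]

theorem exists_morseIndex_eq {A : H →L[ℝ] H} (hA : A.IsSymmetric)
    (hF : ∀ μ ≤ 0, (shift A μ).IsFredholm) :
    ∃ m : ℕ, morseIndex (fun u v ↦ inner ℝ (A u) v) = m := by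
  obtain ⟨μ, hμ, ⟨P⟩⟩ := exists_spectralSplit hA hF
  have h := P.morseIndex_shift hA hμ.le
  rw [shift_zero] at h
  exact ⟨_, h⟩

/-- The eigenvalues below `ε` are the negative ones and those in `[0, ε]`, as `ε` itself is not an
eigenvalue. The eigenvalue `0` is counted in `dimEigen` and not in the Morse index, which is the
endpoint convention of the spectral flow. -/
theorem exists_morseIndex_add_dimEigen {A : H →L[ℝ] H} (hA : A.IsSymmetric) {ε : ℝ} (hε : 0 < ε)
    (hspec : ε ∉ spectrum ℝ A) (hF : ∀ μ ≤ ε, (shift A μ).IsFredholm) :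
    morseIndex (fun u v ↦ inner ℝ (A u) v) + dimEigen A ε
      = morseIndex (fun u v ↦ inner ℝ (shift A ε u) v) := by
  obtain ⟨μ, hμ, ⟨P⟩⟩ := exists_spectralSplit hA hF
  have h0 := P.morseIndex_shift hA (hε.le.trans hμ.le)
  rw [shift_zero] at h0
  rw [P.morseIndex_shift hA hμ.le, P.dimEigen_eq hA hμ, h0, ← Nat.cast_add,
    ← Finset.card_union_of_disjoint]
  · congr 2
    ext i
    simp only [Finset.mem_union, Finset.mem_filter, Finset.mem_univ, true_and]
    constructor
    · rintro (h | h)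
      · exact h.trans hε
      · refine lt_of_le_of_ne h.2 fun hi ↦ ?_
        have := eq_zero_of_notMem_spectrum hspec (hi ▸ P.apply_b i)
        have h1 := P.orthonormal.1 i
        rw [this, norm_zero] at h1
        exact zero_ne_one h1
    · intro h
      rcases lt_or_ge (P.ν i) 0 with h' | h'
      · exact Or.inl h'
      · exact Or.inr ⟨h', h.le⟩
  · rw [Finset.disjoint_left]
    intro i hi hi'
    simp only [Finset.mem_filter, Finset.mem_univ, true_and] at hi hi'
    linarith

/-- For paths of operators which are positive up to finite dimension, the spectral flow is the
decrease of the Morse index. -/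
theorem HasSpectralFlow.eq_sub {A : ℝ → H →L[ℝ] H} {a b : ℝ} {k : ℤ}
    (h : HasSpectralFlow A a b k)
    (hF : ∀ s ∈ Icc a b, ∀ μ ≤ 0, (shift (A s) μ).IsFredholm) {N : ℝ → ℕ}
    (hN : ∀ s ∈ Icc a b, morseIndex (fun u v ↦ inner ℝ (A s u) v) = N s) :
    k = N a - N b := by
  obtain ⟨hc, hs, m, t, ε, rfl, rfl, hmono, hgap, rfl⟩ := h
  rw [← neg_sub ((N (t m) : ℤ)), ← Finset.sum_range_sub (fun i ↦ (N (t i) : ℤ)),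
    ← Finset.sum_neg_distrib]
  refine Finset.sum_congr rfl fun i hi ↦ ?_
  rw [Finset.mem_range] at hi
  have hsub : Icc (t i) (t (i + 1)) ⊆ Icc (t 0) (t m) :=
    Icc_subset_Icc (hmono (Nat.zero_le _)) (hmono hi)
  have hle : t i ≤ t (i + 1) := hmono (Nat.le_succ i)
  -- Levels below `0` are covered by `hF`, and levels in `[0, ε i]` by the definition of a gap.
  have hF' : ∀ s ∈ Icc (t i) (t (i + 1)), ∀ μ ≤ ε i, (shift (A s) μ).IsFredholm := by
    intro s hs μ hμ
    rcases le_total μ 0 with h0 | h0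
    · exact hF s (hsub hs) μ h0
    · obtain ⟨h1, -, -, h2⟩ := hgap i hi s hs
      exact h2 μ ⟨by linarith, hμ⟩
  have h1 := morseIndex_shift_eq_of_isPreconnected isPreconnected_Icc (hc.mono hsub)
    (fun s h ↦ (hs s (hsub h)).1) (fun s h ↦ (hgap i hi s h).2.1) hF'
    (left_mem_Icc.2 hle) (right_mem_Icc.2 hle)
  have h2 : ∀ s ∈ Icc (t i) (t (i + 1)), morseIndex (fun u v ↦ inner ℝ (shift (A s) (ε i) u) v)
      = ((N s + dimEigen (A s) (ε i) : ℕ) : ℕ∞) := fun s h ↦ by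
    rw [← exists_morseIndex_add_dimEigen (hs s (hsub h)).1 (hgap i hi s h).1 (hgap i hi s h).2.1
      (hF' s h), hN s (hsub h), Nat.cast_add]
  rw [h2 _ (left_mem_Icc.2 hle), h2 _ (right_mem_Icc.2 hle), Nat.cast_inj] at h1
  omega

/-- Up to the level `c / 2` the spectrum consists of finitely many eigenvalues, so almost any small
`ε` avoids them together with their negatives. The level is halved because Fredholmness is only
known strictly below `c`. -/
theorem exists_gap [CompleteSpace H] {A : H →L[ℝ] H} (hA : A.IsSymmetric) {c : ℝ} (hc : 0 < c)
    (hF : ∀ μ < c, (shift A μ).IsFredholm) :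
    ∃ ε, 0 < ε ∧ ε < c ∧ ε ∉ spectrum ℝ A ∧ -ε ∉ spectrum ℝ A := by
  obtain ⟨μ, hμ, ⟨P⟩⟩ := exists_spectralSplit hA (l := c / 2) fun μ hμ ↦ hF μ (by linarith)
  have hfin : (range P.ν ∪ range fun i ↦ -P.ν i).Finite := (finite_range _).union (finite_range _)
  obtain ⟨ε, hε, hε'⟩ := (Ioo_infinite (show (0 : ℝ) < c / 2 by positivity)).exists_notMem_finite hfin
  simp only [mem_union, mem_range, not_or, not_exists] at hε'
  have key : ∀ r, r ≤ c / 2 → (∀ i, P.ν i ≠ r) → r ∉ spectrum ℝ A := by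
    intro r hr hne
    rw [isUnit_shift_iff]
    refine isUnit_of_isFredholm (shift_isSymmetric hA r) (hF r (by linarith)) fun v hv ↦ ?_
    have h1 : A v = r • v := sub_eq_zero.1 hv
    have h2 := P.eigenvector_mem_sub hA (hr.trans_lt hμ) h1 (I := ∅) fun i _ ↦ hne i
    simpa [SpectralSplit.sub] using h2
  exact ⟨ε, hε.1, by linarith [hε.2], key _ hε.2.le hε'.1,
    key _ (by linarith [hε.1]) fun i h ↦ hε'.2 i (by linarith)⟩

/-- Invertibility is an open condition, so a gap at `s` remains one nearby; compactness of `[a, b]`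
yields a subdivision with one gap on each interval. -/
theorem exists_hasSpectralFlow [CompleteSpace H] {A : ℝ → H →L[ℝ] H} (hcont : Continuous A)
    (hs : ∀ s, (A s).IsSymmetric) {c : ℝ} (hc : 0 < c)
    (hF : ∀ s, ∀ μ < c, (shift (A s) μ).IsFredholm) {a b : ℝ} (hab : a ≤ b) :
    ∃ k, HasSpectralFlow A a b k := by
  let U : Ioo 0 c → Set (Icc a b) := fun ε ↦
    {s | (ε : ℝ) ∉ spectrum ℝ (A s) ∧ -(ε : ℝ) ∉ spectrum ℝ (A s)}
  have hopen : ∀ r : ℝ, IsOpen {s : Icc a b | r ∉ spectrum ℝ (A s)} := by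
    intro r
    simp only [isUnit_shift_iff]
    have : Continuous fun s : Icc a b ↦ shift (A s) r :=
      (hcont.comp continuous_subtype_val).sub continuous_const
    exact Units.isOpen.preimage this
  obtain ⟨t, h0, hmono, ⟨m, hm⟩, hU⟩ := exists_monotone_Icc_subset_open_cover_Icc hab (c := U)
    (fun ε ↦ (hopen _).inter (hopen _)) (fun s _ ↦ by
      obtain ⟨ε, h1, h2, h3, h4⟩ := exists_gap (hs s) hc (hF s)
      exact mem_iUnion.2 ⟨⟨ε, h1, h2⟩, h3, h4⟩)
  choose ε hε using hU
  refine ⟨_, hcont.continuousOn, fun s _ ↦ ⟨hs s, ?_⟩, m, fun i ↦ t i, fun i ↦ ε i,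
    h0, by simp [hm m le_rfl], hmono, fun i _ s hsI ↦ ?_, rfl⟩
  · rw [← shift_zero (A s)]
    exact hF s 0 hc
  · have h1 := hε i (a := ⟨s, (t i).2.1.trans hsI.1, hsI.2.trans (t (i + 1)).2.2⟩) hsI
    exact ⟨(ε i).2.1, h1.1, h1.2, fun μ hμ ↦ hF s μ (hμ.2.trans_lt (ε i).2.2)⟩

/-- If `s ↦ A₀ + s K` is a path of symmetric operators with `A₀ ≥ c - C K`, where `K ≥ 0` is
arbitrarily small on subspaces of finite codimension, then the Morse index of `A₀` is the spectral
flow of the path over all large intervals. -/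
theorem morseIndex_eq_spectralFlow [CompleteSpace H] {B α : H → H → ℝ} {A₀ K : H →L[ℝ] H}
    (hB : ∀ u v, inner ℝ (A₀ u) v = B u v) (hα : ∀ u v, inner ℝ (K u) v = α u v)
    (hBs : ∀ u v, B u v = B v u) (hαs : ∀ u v, α u v = α v u)
    (hα0 : ∀ u, 0 ≤ α u u) {c C : ℝ} (hc : 0 < c) (hgard : ∀ u, c * ‖u‖ ^ 2 ≤ B u u + C * α u u)
    (hsmall : ∀ κ > 0, ∃ V : Submodule ℝ H, V.CoFG ∧ ∀ v ∈ V, α v v ≤ κ * ‖v‖ ^ 2) :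
    ∃ m : ℕ, morseIndex B = m ∧ ∀ k : ℤ,
      ((∃ s₀ > 0, ∀ s ≥ s₀, Nondegenerate (fun u v ↦ B u v + s * α u v)) ∧
        ∀ s₀ > 0, (∀ s ≥ s₀, Nondegenerate (fun u v ↦ B u v + s * α u v)) →
          HasFormSpectralFlow (fun s u v ↦ B u v + s * α u v) 0 s₀ k) ↔ k = m := by
  let A : ℝ → H →L[ℝ] H := fun s ↦ A₀ + s • K
  have hA : ∀ s u v, inner ℝ (A s u) v = B u v + s * α u v := fun s u v ↦ by
    simp only [A, add_apply, smul_apply, inner_add_left, inner_smul_left, hB, hα, conj_trivial]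
  have hAc : Continuous A := by fun_prop
  have hAs : ∀ s, (A s).IsSymmetric := fun s u v ↦ by
    simp only [ContinuousLinearMap.coe_coe]
    rw [hA, real_inner_comm, hA, hBs, hαs]
  have hF : ∀ s, ∀ μ < c, (shift (A s) μ).IsFredholm := by
    intro s μ hμ
    -- With this `κ` the term `|C - s| α` is at most `(c - μ) / 2 ‖v‖²` on `V`, which leaves half of
    -- the coercivity constant `c - μ`.
    obtain ⟨V, hV, hVs⟩ := hsmall ((c - μ) / (2 * (|C - s| + 1))) (by
      have := sub_pos.2 hμ; positivity)
    refine isFredholm_of_coercive_on hV (c := (c - μ) / 2) (by linarith) fun v hv ↦ ?_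
    rw [inner_shift, hA]
    have h1 := hgard v
    have h2 : |C - s| * α v v ≤ (c - μ) / 2 * ‖v‖ ^ 2 := by
      have h3 := mul_le_mul_of_nonneg_left (hVs v hv) (show 0 ≤ |C - s| + 1 by positivity)
      have h4 : (|C - s| + 1) * ((c - μ) / (2 * (|C - s| + 1)) * ‖v‖ ^ 2)
          = (c - μ) / 2 * ‖v‖ ^ 2 := by
        have : |C - s| + 1 ≠ 0 := by positivity
        field_simp
      rw [h4] at h3
      linarith [hα0 v]
    have h3 : (C - s) * α v v ≤ |C - s| * α v v :=
      mul_le_mul_of_nonneg_right (le_abs_self _) (hα0 v)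
    linarith
  have hF0 : ∀ s, ∀ μ ≤ 0, (shift (A s) μ).IsFredholm := fun s μ hμ ↦ hF s μ (hμ.trans_lt hc)
  have hmorse : ∀ s, morseIndex (fun u v ↦ inner ℝ (A s u) v)
      = morseIndex (fun u v ↦ B u v + s * α u v) := fun s ↦ by simp only [hA]
  choose N hN using fun s ↦ exists_morseIndex_eq (hAs s) (hF0 s)
  have hpos : ∀ s ≥ C, ∀ u, c * ‖u‖ ^ 2 ≤ B u u + s * α u u := fun s hs u ↦
    (hgard u).trans (by have := mul_le_mul_of_nonneg_right hs (hα0 u); linarith)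
  have hN0 : ∀ s ≥ C, N s = 0 := by
    intro s hs
    have h1 := morseIndex_eq_finrank (B := fun u v ↦ inner ℝ (A s u) v) (X := ⊥) (Y := ⊤)
      (by simp) (fun u _ ↦ by
        rw [hA]; exact (by positivity : 0 ≤ c * ‖u‖ ^ 2).trans (hpos s hs u)) (by simp)
    rw [hN] at h1
    simpa using h1
  have hspec : ∀ s, Nondegenerate (fun u v ↦ B u v + s * α u v) → (0 : ℝ) ∉ spectrum ℝ (A s) := by
    intro s hs
    rw [isUnit_shift_iff, shift_zero]
    refine isUnit_of_isFredholm (hAs s) (shift_zero (A s) ▸ hF s 0 hc) fun v hv ↦ hs v fun w ↦ ?_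
    change B v w + s * α v w = 0
    rw [← hA, hv, inner_zero_left]
  have hend : ∀ s₀, (∀ s ≥ s₀, Nondegenerate (fun u v ↦ B u v + s * α u v)) → N s₀ = 0 := by
    intro s₀ hs₀
    -- Nondegeneracy on the whole ray `[s₀, ∞)` transports the Morse index from `s₀` to a parameter
    -- beyond `C`, where the form is positive definite.
    have h1 := morseIndex_shift_eq_of_isPreconnected (isPreconnected_Ici (a := s₀))
      hAc.continuousOn (fun s _ ↦ hAs s) (l := 0) (fun s hs ↦ hspec s (hs₀ s hs))
      (fun s _ ↦ hF0 s) (mem_Ici.2 le_rfl) (mem_Ici.2 (le_max_left s₀ C))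
    simp only [shift_zero, hN, hN0 _ (le_max_right s₀ C)] at h1
    simpa using h1
  have hex : ∃ s₀ > 0, ∀ s ≥ s₀, Nondegenerate (fun u v ↦ B u v + s * α u v) := by
    refine ⟨max C 1, by positivity, fun s hs u hu ↦ ?_⟩
    have h1 := hpos s ((le_max_left _ _).trans hs) u
    rw [show B u u + s * α u u = 0 from hu u] at h1
    have h2 : ‖u‖ ^ 2 ≤ 0 := by nlinarith
    exact norm_eq_zero.1 (pow_eq_zero_iff two_ne_zero |>.1 (le_antisymm h2 (sq_nonneg _)))
  have hflow : ∀ s₀, 0 < s₀ → (∀ s ≥ s₀, Nondegenerate (fun u v ↦ B u v + s * α u v)) →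
      ∀ k : ℤ, HasFormSpectralFlow (fun s u v ↦ B u v + s * α u v) 0 s₀ k → k = N 0 := by
    rintro s₀ h0 hs₀ k ⟨A', hA', hfl⟩
    -- Any path that represents the forms coincides with `A` on `[0, s₀]`, so the spectral flow does
    -- not depend on the path `A'` chosen.
    have hAA : ∀ s ∈ Icc 0 s₀, A' s = A s := fun s hs ↦ by
      ext u
      exact ext_inner_right ℝ fun v ↦ by rw [hA' s hs, hA]
    have := hfl.eq_sub (N := N) (fun s hs ↦ by rw [hAA s hs]; exact hF0 s)
      (fun s hs ↦ by rw [hAA s hs, hN])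
    rw [this, hend s₀ hs₀]
    simp
  refine ⟨N 0, ?_, fun k ↦ ⟨fun ⟨⟨s₀, h0, hs₀⟩, h⟩ ↦ hflow s₀ h0 hs₀ k (h s₀ h0 hs₀), ?_⟩⟩
  · rw [← hN 0, hmorse]
    simp
  · rintro rfl
    refine ⟨hex, fun s₀ h0 hs₀ ↦ ?_⟩
    obtain ⟨k, hk⟩ := exists_hasSpectralFlow hAc hAs hc hF h0.le
    have h1 : HasFormSpectralFlow (fun s u v ↦ B u v + s * α u v) 0 s₀ k :=
      ⟨A, fun s _ ↦ hA s, hk⟩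
    rw [← hflow s₀ h0 hs₀ k h1]
    exact h1

end Path

/-! ### Smoothness of the metric, the Christoffel symbols and the Lagrangian in charts. -/

section ChartCoefficients

variable {n : ℕ} {M : Type*} [TopologicalSpace M] [ChartedSpace (Model n) M]
  [IsManifold (𝓡 n) ∞ M]

/-- The points and vectors with given coordinates in a chart depend smoothly on the coordinates. -/
theorem contMDiffOn_mk_ofCoords (c : M) :
    ContMDiffOn 𝓘(ℝ, Model n × Model n) (𝓡 n).tangent ∞
      (fun p : Model n × Model n ↦
        (⟨(extChartAt (𝓡 n) c).symm p.1, ofCoords c _ p.2⟩ : TangentBundle (𝓡 n) M))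
      ((extChartAt (𝓡 n) c).target ×ˢ univ) := by
  let e := trivializationAt (Model n) (TangentSpace (𝓡 n) : M → Type _) c
  have h1 : ContMDiffOn 𝓘(ℝ, Model n × Model n) (𝓡 n) ∞
      (fun p : Model n × Model n ↦ (extChartAt (𝓡 n) c).symm p.1)
      ((extChartAt (𝓡 n) c).target ×ˢ univ) :=
    (contMDiffOn_extChartAt_symm (n := ∞) c).comp
      (contDiff_fst.contMDiff.contMDiffOn (s := (extChartAt (𝓡 n) c).target ×ˢ univ))
      (fun p hp ↦ hp.1)
  have h2 : ContMDiffOn 𝓘(ℝ, Model n × Model n) 𝓘(ℝ, Model n) ∞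
      (fun p : Model n × Model n ↦ p.2) ((extChartAt (𝓡 n) c).target ×ˢ univ) :=
    contDiff_snd.contMDiff.contMDiffOn
  have hbase : ∀ p ∈ (extChartAt (𝓡 n) c).target ×ˢ (univ : Set (Model n)),
      (extChartAt (𝓡 n) c).symm p.1 ∈ e.baseSet := fun p hp ↦ by
    rw [TangentBundle.trivializationAt_baseSet, ← extChartAt_source (𝓡 n)]
    exact (extChartAt (𝓡 n) c).map_target hp.1
  refine ((e.contMDiffOn_symm (n := ∞) (IB := 𝓡 n)).comp (h1.prodMk h2) fun p hp ↦ ?_).congr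
    fun p hp ↦ ?_
  · exact e.mem_target.2 (hbase p hp)
  · rw [ofCoords, Trivialization.symmL_apply _ (hbase p hp)]
    exact e.mk_symm (hbase p hp) _

theorem contDiffOn_chartMetric_apply (g : Metric n M) (c : M) (v w : Model n) :
    ContDiffOn ℝ ∞ (fun y ↦ chartMetric g c y v w) (extChartAt (𝓡 n) c).target := by
  rw [← contMDiffOn_iff_contDiffOn]
  have h1 : ∀ v : Model n, ContMDiffOn 𝓘(ℝ, Model n) (𝓡 n).tangent ∞
      (fun y : Model n ↦ (⟨(extChartAt (𝓡 n) c).symm y, ofCoords c _ v⟩ : TangentBundle (𝓡 n) M))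
      (extChartAt (𝓡 n) c).target := fun v ↦
    (contMDiffOn_mk_ofCoords c).comp
      ((contDiff_id.prodMk contDiff_const).contMDiff.contMDiffOn
        (s := (extChartAt (𝓡 n) c).target)) (fun y hy ↦ ⟨hy, mem_univ _⟩)
  let _ : RiemannianBundle (fun q : M ↦ TangentSpace (𝓡 n) q) := ⟨g.toRiemannianMetric⟩
  exact ContMDiffOn.inner_bundle (F := Model n) (E := fun q : M ↦ TangentSpace (𝓡 n) q)
    (h1 v) (h1 w)

theorem contDiffOn_chartMetric (g : Metric n M) (c : M) :
    ContDiffOn ℝ ∞ (chartMetric g c) (extChartAt (𝓡 n) c).target :=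
  contDiffOn_clm_apply.2 fun v ↦ contDiffOn_clm_apply.2 fun w ↦
    contDiffOn_chartMetric_apply g c v w

theorem chartMetric_symm (g : Metric n M) (c : M) (y v w : Model n) :
    chartMetric g c y v w = chartMetric g c y w v :=
  g.symm _ _ _

theorem coords_ofCoords {c q : M} (hq : q ∈ (chartAt (Model n) c).source) (v : Model n) :
    coords c q (ofCoords c q v) = v :=
  (trivializationAt (Model n) (TangentSpace (𝓡 n) : M → Type _) c).continuousLinearMapAt_symmL
    (by rwa [TangentBundle.trivializationAt_baseSet]) v

theorem symm_mem_source {c : M} {y : Model n} (hy : y ∈ (extChartAt (𝓡 n) c).target) :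
    (extChartAt (𝓡 n) c).symm y ∈ (chartAt (Model n) c).source := by
  rw [← extChartAt_source (𝓡 n)]
  exact (extChartAt (𝓡 n) c).map_target hy

theorem chartMetric_pos (g : Metric n M) {c : M} {y : Model n}
    (hy : y ∈ (extChartAt (𝓡 n) c).target) {v : Model n} (hv : v ≠ 0) :
    0 < chartMetric g c y v v := by
  refine g.pos _ _ fun h ↦ hv ?_
  rw [← coords_ofCoords (symm_mem_source hy) v]
  exact (congrArg (coords c _) h).trans (map_zero _)

/-- Positivity gives injectivity, and the model space and its dual have the same dimension.
Invertibility is what makes the `inverse` in `christoffel` smooth. -/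
theorem isInvertible_chartMetric (g : Metric n M) {c : M} {y : Model n}
    (hy : y ∈ (extChartAt (𝓡 n) c).target) : (chartMetric g c y).IsInvertible := by
  have hinj : Function.Injective (chartMetric g c y : Model n →ₗ[ℝ] (Model n →L[ℝ] ℝ)) := by
    rw [injective_iff_map_eq_zero]
    intro v hv
    by_contra hne
    have h1 := chartMetric_pos g hy hne
    have h2 : chartMetric g c y v = 0 := hv
    rw [h2] at h1
    simp at h1
  have hrank : Module.finrank ℝ (Model n) = Module.finrank ℝ (Model n →L[ℝ] ℝ) := by
    rw [← (InnerProductSpace.toDual ℝ (Model n)).toLinearEquiv.finrank_eq]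
  refine ⟨(LinearEquiv.ofInjectiveOfFinrankEq _ hinj hrank).toContinuousLinearEquiv, ?_⟩
  ext v w
  rfl

theorem fderiv_chartMetric_apply (g : Metric n M) {c : M} {y : Model n}
    (hy : y ∈ (extChartAt (𝓡 n) c).target) (z v w : Model n) :
    fderiv ℝ (chartMetric g c) y z v w = fderiv ℝ (fun y ↦ chartMetric g c y v w) y z := by
  have hd : DifferentiableAt ℝ (chartMetric g c) y :=
    ((contDiffOn_chartMetric g c).differentiableOn (by simp)).differentiableAt
      ((isOpen_extChartAt_target c).mem_nhds hy)
  have h2 := ((hd.hasFDerivAt.clm_apply (hasFDerivAt_const v y)).clm_apply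
    (hasFDerivAt_const w y)).fderiv
  rw [h2]
  simp

theorem contDiffOn_fderiv_chartMetric (g : Metric n M) (c : M) (z v w : Model n) :
    ContDiffOn ℝ ∞ (fun y ↦ fderiv ℝ (chartMetric g c) y z v w) (extChartAt (𝓡 n) c).target := by
  refine ContDiffOn.congr ?_ fun y hy ↦ fderiv_chartMetric_apply g hy z v w
  exact ((contDiffOn_chartMetric_apply g c v w).fderiv_of_isOpen (m := ∞)
    (isOpen_extChartAt_target c) (by simp)).clm_apply contDiffOn_const

theorem contDiffOn_christoffel (g : Metric n M) (c : M) (v w : Model n) :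
    ContDiffOn ℝ ∞ (fun y ↦ christoffel g c y v w) (extChartAt (𝓡 n) c).target := by
  have hD := contDiffOn_fderiv_chartMetric g c
  have hD' : ∀ u v : Model n, ContDiffOn ℝ ∞ (fun y ↦ fderiv ℝ (chartMetric g c) y u v)
      (extChartAt (𝓡 n) c).target := fun u v ↦ contDiffOn_clm_apply.2 fun w ↦ hD u v w
  refine ContDiffOn.clm_apply (fun y hy ↦ ?_) ?_
  · exact ((isInvertible_chartMetric g hy).contDiffAt_map_inverse).comp_contDiffWithinAt y
      (contDiffOn_chartMetric g c y hy)
  · refine ContDiffOn.const_smul _ (((hD' v w).add (hD' w v)).sub ?_)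
    exact contDiffOn_clm_apply.2 fun z ↦ hD z v w

theorem christoffel_symm (g : Metric n M) {c : M} {y : Model n}
    (hy : y ∈ (extChartAt (𝓡 n) c).target) (v w : Model n) :
    christoffel g c y v w = christoffel g c y w v := by
  have key : ∀ z : Model n, fderiv ℝ (chartMetric g c) y z v w
      = fderiv ℝ (chartMetric g c) y z w v := by
    intro z
    rw [fderiv_chartMetric_apply g hy, fderiv_chartMetric_apply g hy]
    simp only [chartMetric_symm g c _ v w]
  unfold christoffel
  congr 2
  ext z
  simp only [sub_apply, add_apply, ContinuousLinearMap.flip_apply, key]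
  ring

theorem contDiffOn_chartLagrangian {T : ℝ} {L : Lagrangian n M} (hL : IsSmoothPeriodic T L)
    (c : M) : ContDiffOn ℝ ∞ (fun p : ℝ × (Model n × Model n) ↦ chartLagrangian L c p.1 p.2)
      (univ ×ˢ ((extChartAt (𝓡 n) c).target ×ˢ univ)) := by
  rw [← contMDiffOn_iff_contDiffOn]
  have h1 : ContMDiffOn 𝓘(ℝ, ℝ × (Model n × Model n)) 𝓘(ℝ, ℝ) ∞
      (fun p : ℝ × (Model n × Model n) ↦ p.1)
      (univ ×ˢ ((extChartAt (𝓡 n) c).target ×ˢ univ)) := contDiff_fst.contMDiff.contMDiffOn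
  have h2 := (contMDiffOn_mk_ofCoords c).comp
    (contDiff_snd.contMDiff.contMDiffOn (s := (univ : Set ℝ) ×ˢ
      ((extChartAt (𝓡 n) c).target ×ˢ (univ : Set (Model n))))) (fun p hp ↦ hp.2)
  exact hL.smooth.comp_contMDiffOn (h1.prodMk h2)

end ChartCoefficients

/-! ### Symmetric bilinear forms and their continuous families over an interval. -/

section SymmBilin

/-- Symmetric bilinear forms. -/
structure IsSymmBilin {V : Type*} [AddCommGroup V] [Module ℝ V] (f : V → V → ℝ) : Prop where
  add_left : ∀ u u' v, f (u + u') v = f u v + f u' v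
  smul_left : ∀ (r : ℝ) u v, f (r • u) v = r * f u v
  symm : ∀ u v, f u v = f v u

namespace IsSymmBilin

variable {V : Type*} [AddCommGroup V] [Module ℝ V] {f : V → V → ℝ}

theorem add_right (hf : IsSymmBilin f) (u v v' : V) : f u (v + v') = f u v + f u v' := by
  rw [hf.symm, hf.add_left, hf.symm v, hf.symm v']

theorem smul_right (hf : IsSymmBilin f) (r : ℝ) (u v : V) : f u (r • v) = r * f u v := by
  rw [hf.symm, hf.smul_left, hf.symm]

theorem zero_left (hf : IsSymmBilin f) (v : V) : f 0 v = 0 := by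
  simpa using hf.smul_left 0 0 v

/-- The bilinear map. -/
def toLinearMap (hf : IsSymmBilin f) : V →ₗ[ℝ] V →ₗ[ℝ] ℝ :=
  LinearMap.mk₂ ℝ f hf.add_left hf.smul_left hf.add_right hf.smul_right

theorem comp {W : Type*} [AddCommGroup W] [Module ℝ W] (hf : IsSymmBilin f) (l : W →ₗ[ℝ] V) :
    IsSymmBilin fun u v ↦ f (l u) (l v) :=
  ⟨fun u u' v ↦ by rw [map_add, hf.add_left], fun r u v ↦ by rw [map_smul, hf.smul_left],
    fun u v ↦ hf.symm _ _⟩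

/-- A symmetric bilinear form with a bounded quadratic form is represented by a bounded operator. -/
theorem exists_operator {H : Type*} [NormedAddCommGroup H] [InnerProductSpace ℝ H]
    [CompleteSpace H] {B : H → H → ℝ} (hB : IsSymmBilin B) {C : ℝ}
    (hC : ∀ u, |B u u| ≤ C * ‖u‖ ^ 2) : ∃ A : H →L[ℝ] H, ∀ u v, inner ℝ (A u) v = B u v := by
  -- Polarization and the parallelogram law; applied to normalized vectors this becomes boundedness
  -- of the bilinear form.
  have h1 : ∀ u v, |B u v| ≤ C / 2 * (‖u‖ ^ 2 + ‖v‖ ^ 2) := by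
    intro u v
    have e : 4 * B u v = B (u + v) (u + v) - B (u + (-1 : ℝ) • v) (u + (-1 : ℝ) • v) := by
      simp only [hB.add_left, hB.add_right, hB.smul_left, hB.smul_right, hB.symm v u]
      ring
    have h2 := hC (u + v)
    have h3 := hC (u + (-1 : ℝ) • v)
    rw [neg_one_smul, ← sub_eq_add_neg] at h3 e
    have h4 := parallelogram_law_with_norm ℝ u v
    have h5 : C * ‖u + v‖ ^ 2 + C * ‖u - v‖ ^ 2 = 2 * (C * (‖u‖ ^ 2 + ‖v‖ ^ 2)) := by
      rw [← mul_add, h4]; ring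
    rw [abs_le] at h2 h3 ⊢
    constructor <;> linarith [h2.1, h2.2, h3.1, h3.2]
  have h2 : ∀ u v, ‖hB.toLinearMap u v‖ ≤ |C| * ‖u‖ * ‖v‖ := by
    intro u v
    change |B u v| ≤ _
    rcases eq_or_ne u 0 with rfl | hu
    · simp [hB.zero_left]
    rcases eq_or_ne v 0 with rfl | hv
    · simp [hB.symm u, hB.zero_left]
    have hu' : 0 < ‖u‖ := norm_pos_iff.2 hu
    have hv' : 0 < ‖v‖ := norm_pos_iff.2 hv
    have h3 := h1 (‖u‖⁻¹ • u) (‖v‖⁻¹ • v)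
    rw [hB.smul_left, hB.smul_right, norm_smul, norm_smul, norm_inv, norm_inv, norm_norm, norm_norm,
      inv_mul_cancel₀ hu'.ne', inv_mul_cancel₀ hv'.ne', abs_mul, abs_mul, abs_inv, abs_inv,
      abs_norm, abs_norm, inv_mul_le_iff₀ hu', inv_mul_le_iff₀ hv'] at h3
    have h4 := le_abs_self C
    nlinarith [mul_pos hu' hv']
  let F := hB.toLinearMap.mkContinuous₂ |C| h2
  exact ⟨InnerProductSpace.continuousLinearMapOfBilin (𝕜 := ℝ) F, fun u v ↦
    InnerProductSpace.continuousLinearMapOfBilin_apply F u v⟩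

end IsSymmBilin

/-- A continuous family, over a compact interval, of symmetric bilinear forms. -/
structure IsSymmFamily {F : Type*} [AddCommGroup F] [Module ℝ F] (q : ℝ → F → F → ℝ)
    (a b : ℝ) : Prop where
  bilin : ∀ t ∈ Icc a b, IsSymmBilin (q t)
  cont : ∀ u v, ContinuousOn (fun t ↦ q t u v) (Icc a b)

namespace IsSymmFamily

variable {F : Type*} [NormedAddCommGroup F] [NormedSpace ℝ F] [FiniteDimensional ℝ F]
  {q : ℝ → F → F → ℝ} {a b : ℝ}

/-- In finite dimension, continuity of the values on fixed vectors implies continuity in norm.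
Outside the interval `Q` is set to `0`, as nothing is known about `q t` there. -/
theorem exists_clm (hq : IsSymmFamily q a b) : ∃ Q : ℝ → F →L[ℝ] F →L[ℝ] ℝ,
    ContinuousOn Q (Icc a b) ∧ ∀ t ∈ Icc a b, ∀ u v, Q t u v = q t u v := by
  classical
  let Q : ℝ → F →L[ℝ] F →L[ℝ] ℝ := fun t ↦ if h : t ∈ Icc a b then
    LinearMap.toContinuousLinearMap
      ((LinearMap.toContinuousLinearMap (𝕜 := ℝ) (E := F) (F' := ℝ)).toLinearMap ∘ₗ
        (hq.bilin t h).toLinearMap) else 0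
  have hQ : ∀ t ∈ Icc a b, ∀ u v, Q t u v = q t u v := by
    intro t ht u v
    simp only [Q, dif_pos ht]
    rfl
  exact ⟨Q, continuousOn_clm_apply.2 fun u ↦ continuousOn_clm_apply.2 fun v ↦
    (hq.cont u v).congr fun t ht ↦ hQ t ht u v, hQ⟩

theorem exists_bound (hq : IsSymmFamily q a b) :
    ∃ C, 0 ≤ C ∧ ∀ t ∈ Icc a b, ∀ u v, |q t u v| ≤ C * ‖u‖ * ‖v‖ := by
  obtain ⟨Q, hQc, hQ⟩ := hq.exists_clm
  have hcont : ContinuousOn (fun p : ℝ × F × F ↦ Q p.1 p.2.1 p.2.2)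
      (Icc a b ×ˢ Metric.sphere 0 1 ×ˢ Metric.sphere 0 1) :=
    ((hQc.comp continuousOn_fst (fun p hp ↦ hp.1)).clm_apply
      (continuous_fst.comp continuous_snd).continuousOn).clm_apply
        (continuous_snd.comp continuous_snd).continuousOn
  obtain ⟨C, hC⟩ := (isCompact_Icc.prod ((isCompact_sphere (0 : F) 1).prod
    (isCompact_sphere (0 : F) 1))).exists_bound_of_continuousOn hcont
  refine ⟨max C 0, le_max_right _ _, fun t ht u v ↦ ?_⟩
  have h := hq.bilin t ht
  rcases eq_or_ne u 0 with rfl | hu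
  · simp [h.zero_left]
  rcases eq_or_ne v 0 with rfl | hv
  · simp [h.symm u, h.zero_left]
  have hu' : 0 < ‖u‖ := norm_pos_iff.2 hu
  have hv' : 0 < ‖v‖ := norm_pos_iff.2 hv
  have h1 := hC (t, ‖u‖⁻¹ • u, ‖v‖⁻¹ • v) ⟨ht, by
    rw [mem_sphere_zero_iff_norm, norm_smul, norm_inv, norm_norm, inv_mul_cancel₀ hu'.ne'], by
    rw [mem_sphere_zero_iff_norm, norm_smul, norm_inv, norm_norm, inv_mul_cancel₀ hv'.ne']⟩
  rw [hQ t ht, h.smul_left, h.smul_right, norm_mul, norm_mul, norm_inv, norm_inv, norm_norm,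
    norm_norm, Real.norm_eq_abs, inv_mul_le_iff₀ hu', inv_mul_le_iff₀ hv'] at h1
  calc |q t u v| ≤ ‖v‖ * (‖u‖ * C) := h1
    _ = C * ‖u‖ * ‖v‖ := by ring
    _ ≤ max C 0 * ‖u‖ * ‖v‖ := by gcongr; exact le_max_left _ _

/-- The form attains a positive minimum on the compact product of the interval and the unit sphere.
If that product is empty, any constant works. -/
theorem exists_pos (hq : IsSymmFamily q a b) (hpos : ∀ t ∈ Icc a b, ∀ u ≠ 0, 0 < q t u u) :
    ∃ c, 0 < c ∧ ∀ t ∈ Icc a b, ∀ u, c * ‖u‖ ^ 2 ≤ q t u u := by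
  obtain ⟨Q, hQc, hQ⟩ := hq.exists_clm
  have hcomp : IsCompact (Icc a b ×ˢ Metric.sphere (0 : F) 1) :=
    isCompact_Icc.prod (isCompact_sphere 0 1)
  have hcont : ContinuousOn (fun p : ℝ × F ↦ Q p.1 p.2 p.2) (Icc a b ×ˢ Metric.sphere 0 1) :=
    ((hQc.comp continuousOn_fst (fun p hp ↦ hp.1)).clm_apply continuousOn_snd).clm_apply
      continuousOn_snd
  obtain ⟨c, hc, hmin⟩ : ∃ c, 0 < c ∧ ∀ p ∈ Icc a b ×ˢ Metric.sphere (0 : F) 1,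
      c ≤ Q p.1 p.2 p.2 := by
    rcases (Icc a b ×ˢ Metric.sphere (0 : F) 1).eq_empty_or_nonempty with h | h
    · exact ⟨1, one_pos, by simp [h]⟩
    · obtain ⟨p, hp, hmin⟩ := hcomp.exists_isMinOn h hcont
      refine ⟨Q p.1 p.2 p.2, ?_, hmin⟩
      rw [hQ p.1 hp.1]
      refine hpos _ hp.1 _ fun h0 ↦ ?_
      have := hp.2
      rw [mem_sphere_zero_iff_norm, h0, norm_zero] at this
      exact zero_ne_one this
  refine ⟨c, hc, fun t ht u ↦ ?_⟩
  rcases eq_or_ne u 0 with rfl | hu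
  · simp [(hq.bilin t ht).zero_left]
  have hu' : 0 < ‖u‖ := norm_pos_iff.2 hu
  have h1 := hmin (t, ‖u‖⁻¹ • u) ⟨ht, by
    rw [mem_sphere_zero_iff_norm, norm_smul, norm_inv, norm_norm, inv_mul_cancel₀ hu'.ne']⟩
  simp only [map_smul, smul_apply, smul_eq_mul, hQ t ht] at h1
  have h2 : ‖u‖⁻¹ * (‖u‖⁻¹ * q t u u) = q t u u / ‖u‖ ^ 2 := by field_simp
  rwa [h2, le_div_iff₀ (by positivity)] at h1

theorem integrableOn (hq : IsSymmFamily q a b) {f f' : ℝ → F}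
    (hf : MemLp f 2 (volume.restrict (Icc a b))) (hf' : MemLp f' 2 (volume.restrict (Icc a b))) :
    IntegrableOn (fun t ↦ q t (f t) (f' t)) (Icc a b) := by
  obtain ⟨Q, hQc, hQ⟩ := hq.exists_clm
  obtain ⟨C, hC, hb⟩ := hq.exists_bound
  have h1 : Integrable (fun t ↦ C * (‖f t‖ * ‖f' t‖)) (volume.restrict (Icc a b)) :=
    (hf.norm.integrable_mul hf'.norm).const_mul C
  refine h1.mono' ?_ ?_
  · have h2 := hQc.aestronglyMeasurable (μ := volume) measurableSet_Icc
    have h3 : AEStronglyMeasurable (fun t ↦ Q t (f t)) (volume.restrict (Icc a b)) :=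
      (isBoundedBilinearMap_apply (𝕜 := ℝ)).continuous.comp_aestronglyMeasurable (h2.prodMk hf.1)
    have h4 : AEStronglyMeasurable (fun t ↦ Q t (f t) (f' t)) (volume.restrict (Icc a b)) :=
      (isBoundedBilinearMap_apply (𝕜 := ℝ)).continuous.comp_aestronglyMeasurable (h3.prodMk hf'.1)
    exact h4.congr ((ae_restrict_iff' measurableSet_Icc).2 (ae_of_all _ fun t ht ↦ hQ t ht _ _))
  · refine (ae_restrict_iff' measurableSet_Icc).2 (ae_of_all _ fun t ht ↦ ?_)
    rw [Real.norm_eq_abs, ← mul_assoc]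
    exact hb t ht _ _

/-- A Gårding inequality: a symmetric form which is positive on the second factor is positive up
to a multiple of the square of the first component. -/
theorem garding {E : Type*} [NormedAddCommGroup E] [NormedSpace ℝ E] [FiniteDimensional ℝ E]
    {q : ℝ → E × E → E × E → ℝ} (hq : IsSymmFamily q a b)
    (hpos : ∀ t ∈ Icc a b, ∀ u ≠ 0, 0 < q t (0, u) (0, u)) :
    ∃ c R, 0 < c ∧ 0 ≤ R ∧ ∀ t ∈ Icc a b, ∀ p : E × E,
      c * ‖p‖ ^ 2 ≤ q t p p + R * ‖p.1‖ ^ 2 := by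
  have hq2 : IsSymmFamily (fun t u v ↦ q t (0, u) (0, v)) a b :=
    ⟨fun t ht ↦ (hq.bilin t ht).comp (LinearMap.inr ℝ E E), fun u v ↦ hq.cont _ _⟩
  obtain ⟨l, hl, hlow⟩ := hq2.exists_pos hpos
  obtain ⟨C, hC, hb⟩ := hq.exists_bound
  -- Half of the positivity `l` on the second factor absorbs the mixed term. The summands of `R` pay
  -- for the form on the first factor, for the mixed term (Young's inequality, `h7`), and for
  -- `‖p.1‖²` within `‖p‖²`.
  refine ⟨l / 2, C + 2 * C ^ 2 / l + l / 2, by positivity, by positivity, fun t ht p ↦ ?_⟩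
  have e : q t p p = q t (0, p.2) (0, p.2) + q t (p.1, 0) (p.1, 0)
      + 2 * q t (p.1, 0) (0, p.2) := by
    have : p = (p.1, 0) + (0, p.2) := by simp
    conv_lhs => rw [this]
    have h := hq.bilin t ht
    rw [h.add_left, h.add_right, h.add_right, h.symm (0, p.2) (p.1, 0)]
    ring
  have h1 := hlow t ht p.2
  have n1 : ‖((p.1, 0) : E × E)‖ = ‖p.1‖ := by simp [Prod.norm_def]
  have n2 : ‖((0, p.2) : E × E)‖ = ‖p.2‖ := by simp [Prod.norm_def]
  have h2 := hb t ht (p.1, 0) (p.1, 0)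
  have h3 := hb t ht (p.1, 0) (0, p.2)
  rw [n1] at h2 h3
  rw [n2] at h3
  have h4 := (abs_le.1 h2).1
  have h5 := (abs_le.1 h3).1
  have h6 : ‖p‖ ^ 2 ≤ ‖p.1‖ ^ 2 + ‖p.2‖ ^ 2 := by
    rw [Prod.norm_def]
    rcases max_choice ‖p.1‖ ‖p.2‖ with h | h <;> rw [h] <;>
      nlinarith [sq_nonneg ‖p.1‖, sq_nonneg ‖p.2‖]
  have h7 : 2 * C * ‖p.1‖ * ‖p.2‖ ≤ l / 2 * ‖p.2‖ ^ 2 + 2 * C ^ 2 / l * ‖p.1‖ ^ 2 := by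
    have : l / 2 * ‖p.2‖ ^ 2 + 2 * C ^ 2 / l * ‖p.1‖ ^ 2 - 2 * C * ‖p.1‖ * ‖p.2‖
        = (l * ‖p.2‖ - 2 * C * ‖p.1‖) ^ 2 / (2 * l) := by field_simp; ring
    have h8 : 0 ≤ (l * ‖p.2‖ - 2 * C * ‖p.1‖) ^ 2 / (2 * l) := by positivity
    linarith
  rw [e]
  nlinarith

end IsSymmFamily

end SymmBilin

/-! ### Derivatives with respect to one of two variables. -/

section PartialDerivative

variable {E F G : Type*} [NormedAddCommGroup E] [NormedSpace ℝ E] [NormedAddCommGroup F]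
  [NormedSpace ℝ F] [NormedAddCommGroup G] [NormedSpace ℝ G]

/-- Its purpose is the dependence on time of the first and, by iteration, second derivatives of the
Lagrangian in position and velocity. -/
theorem contDiffOn_partial_fderiv {Φ : E × F → G} {Ω : Set (E × F)} (hΩ : IsOpen Ω)
    (hΦ : ContDiffOn ℝ ∞ Φ Ω) (u : F) :
    ContDiffOn ℝ ∞ (fun z ↦ fderiv ℝ (fun p ↦ Φ (z.1, p)) z.2 u) Ω := by
  refine ContDiffOn.congr (f := fun z ↦ fderiv ℝ Φ z (0, u)) ?_ fun z hz ↦ ?_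
  · exact (hΦ.fderiv_of_isOpen (m := ∞) hΩ (by simp)).clm_apply contDiffOn_const
  · have h1 : HasFDerivAt Φ (fderiv ℝ Φ z) (z.1, z.2) :=
      ((hΦ.differentiableOn (by simp)).differentiableAt (hΩ.mem_nhds hz)).hasFDerivAt
    have h2 := h1.comp z.2 (hasFDerivAt_prodMk_right z.1 z.2)
    rw [show (fun p ↦ Φ (z.1, p)) = Φ ∘ (fun p ↦ (z.1, p)) from rfl, h2.fderiv]
    simp

/-- The second derivative of a polynomial of degree at most two. -/
theorem fderiv_fderiv_quadratic (a : E →L[ℝ] E →L[ℝ] ℝ) (b : E →L[ℝ] ℝ) (e : ℝ) (v u w : E) :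
    fderiv ℝ (fderiv ℝ (fun z ↦ a z z + b z + e)) v u w = a u w + a w u := by
  have h1 : ∀ z, HasFDerivAt (fun z ↦ a z z + b z + e) (a z + a.flip z + b) z := fun z ↦ by
    have h2 := (((a.hasFDerivAt (x := z)).clm_apply (hasFDerivAt_id z)).add
      (b.hasFDerivAt (x := z))).add_const e
    refine h2.congr_fderiv ?_
    ext w
    simp
  have h3 : fderiv ℝ (fun z ↦ a z z + b z + e) = fun z ↦ (a + a.flip) z + b := by
    ext z w
    rw [(h1 z).fderiv]
    simp
  rw [h3, ((a + a.flip).hasFDerivAt.add_const b).fderiv]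
  simp

theorem fderiv_fderiv_apply {f : E → G} {p : E} (hf : ContDiffAt ℝ ∞ f p) (u w : E) :
    fderiv ℝ (fderiv ℝ f) p u w = fderiv ℝ (fun z ↦ fderiv ℝ f z w) p u := by
  have h1 : DifferentiableAt ℝ (fderiv ℝ f) p :=
    (hf.fderiv_right (m := 1) (WithTop.coe_le_coe.2 le_top)).differentiableAt one_ne_zero
  rw [(h1.hasFDerivAt.clm_apply (hasFDerivAt_const w p)).fderiv]
  simp

end PartialDerivative

/-! ### The integrands as continuous families of forms in a chart. -/

section Coefficients

variable {n : ℕ} {M : Type*} [TopologicalSpace M] [ChartedSpace (Model n) M]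
  [IsManifold (𝓡 n) ∞ M] {T : ℝ}

theorem christoffel_add_left (g : Metric n M) {c : M} {y : Model n}
    (hy : y ∈ (extChartAt (𝓡 n) c).target) (v v' w : Model n) :
    christoffel g c y (v + v') w = christoffel g c y v w + christoffel g c y v' w := by
  rw [christoffel_symm g hy, christoffel_add, christoffel_symm g hy w, christoffel_symm g hy w]

theorem christoffel_smul_left (g : Metric n M) {c : M} {y : Model n}
    (hy : y ∈ (extChartAt (𝓡 n) c).target) (r : ℝ) (v w : Model n) :
    christoffel g c y (r • v) w = r • christoffel g c y v w := by
  rw [christoffel_symm g hy, christoffel_smul, christoffel_symm g hy w]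

theorem christoffel_sum (g : Metric n M) (c : M) (y v : Model n) {ι : Type*} (s : Finset ι)
    (w : ι → Model n) : christoffel g c y v (∑ i ∈ s, w i) = ∑ i ∈ s, christoffel g c y v (w i) :=
  map_sum ({ toFun := christoffel g c y v
             map_add' := christoffel_add g c y v
             map_smul' := fun r w ↦ christoffel_smul g c y v w r } : Model n →ₗ[ℝ] Model n) w s

/-- Expanding in a basis reduces continuity for varying vectors to smoothness for fixed ones. -/
theorem christoffel_eq_sum (g : Metric n M) {c : M} {y : Model n}
    (hy : y ∈ (extChartAt (𝓡 n) c).target) (v w : Model n) :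
    christoffel g c y v w = ∑ i, ∑ j, (v i * w j) • christoffel g c y
      (EuclideanSpace.basisFun (Fin n) ℝ i) (EuclideanSpace.basisFun (Fin n) ℝ j) := by
  let e := EuclideanSpace.basisFun (Fin n) ℝ
  have hs : ∀ v : Model n, v = ∑ i, v i • e i := fun v ↦ by
    conv_lhs => rw [← e.sum_repr v]
    simp [e]
  conv_lhs => rw [christoffel_symm g hy, hs v, christoffel_sum]
  refine Finset.sum_congr rfl fun i _ ↦ ?_
  conv_lhs => rw [christoffel_smul, christoffel_symm g hy, hs w, christoffel_sum, Finset.smul_sum]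
  refine Finset.sum_congr rfl fun j _ ↦ ?_
  rw [christoffel_smul, smul_smul]

theorem continuousOn_christoffel (g : Metric n M) (c : M) {s : Set ℝ} {y v w : ℝ → Model n}
    (hy : ContinuousOn y s) (hv : ContinuousOn v s) (hw : ContinuousOn w s)
    (hys : ∀ t ∈ s, y t ∈ (extChartAt (𝓡 n) c).target) :
    ContinuousOn (fun t ↦ christoffel g c (y t) (v t) (w t)) s := by
  refine ContinuousOn.congr ?_ fun t ht ↦ christoffel_eq_sum g (hys t ht) (v t) (w t)
  refine continuousOn_finsetSum _ fun i _ ↦ continuousOn_finsetSum _ fun j _ ↦ ?_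
  have hc : ∀ (i : Fin n) {v : ℝ → Model n}, ContinuousOn v s → ContinuousOn (fun t ↦ v t i) s :=
    fun i v hv ↦ (EuclideanSpace.proj (𝕜 := ℝ) i : Model n →L[ℝ] ℝ).continuous.comp_continuousOn hv
  exact ((hc i hv).mul (hc j hw)).smul ((contDiffOn_christoffel g c _ _).continuousOn.comp hy hys)

namespace Loop

variable (x : Loop T n M) {c : M} {a b : ℝ}

theorem contDiffOn_pos (c : M) :
    ContDiffOn ℝ 2 (x.pos c) (x ⁻¹' (chartAt (Model n) c).source) := by
  rw [← contMDiffOn_iff_contDiffOn]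
  have h1 : ContMDiffOn (𝓡 n) 𝓘(ℝ, Model n) 2 (extChartAt (𝓡 n) c) (chartAt (Model n) c).source :=
    (contMDiffOn_extChartAt (n := ∞)).of_le (WithTop.coe_le_coe.2 le_top)
  exact h1.comp (x.contMDiff.contMDiffOn (s := x ⁻¹' (chartAt (Model n) c).source))
    (fun t ht ↦ ht)

theorem isOpen_preimage (c : M) : IsOpen (x ⁻¹' (chartAt (Model n) c).source) :=
  (chartAt (Model n) c).open_source.preimage x.contMDiff.continuous

theorem continuousOn_pos (hc : x.InChart c a b) : ContinuousOn (x.pos c) (Icc a b) :=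
  (x.contDiffOn_pos c).continuousOn.mono hc.2

theorem continuousOn_vel (hc : x.InChart c a b) : ContinuousOn (x.vel c) (Icc a b) :=
  ((x.contDiffOn_pos c).continuousOn_deriv_of_isOpen (x.isOpen_preimage c) (by norm_num)).mono hc.2

theorem pos_mem (c : M) {t : ℝ} (ht : x t ∈ (chartAt (Model n) c).source) :
    x.pos c t ∈ (extChartAt (𝓡 n) c).target :=
  (extChartAt (𝓡 n) c).map_source (by rwa [extChartAt_source])

theorem symm_pos (c : M) {t : ℝ} (ht : x t ∈ (chartAt (Model n) c).source) :
    (extChartAt (𝓡 n) c).symm (x.pos c t) = x t :=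
  (extChartAt (𝓡 n) c).left_inv (by rwa [extChartAt_source])

end Loop

/-- The metric of `H¹`, in terms of the components of fields and of their derivatives. -/
def metricForm (g : Metric n M) (x : Loop T n M) (c : M) (t : ℝ) (p q : Model n × Model n) : ℝ :=
  chartMetric g c (x.pos c t) (p.2 + christoffel g c (x.pos c t) (x.vel c t) p.1)
      (q.2 + christoffel g c (x.pos c t) (x.vel c t) q.1)
    + chartMetric g c (x.pos c t) p.1 q.1

/-- The second variation, in terms of the components of fields and of their derivatives. -/
def hessForm (g : Metric n M) (L : Lagrangian n M) (x : Loop T n M) (c : M) (t : ℝ)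
    (p q : Model n × Model n) : ℝ :=
  fderiv ℝ (fderiv ℝ (chartLagrangian L c t)) (x.pos c t, x.vel c t) p q
    - fderiv ℝ (chartLagrangian L c t) (x.pos c t, x.vel c t)
      (christoffel g c (x.pos c t) p.1 q.1,
        fderiv ℝ (fun z ↦ christoffel g c z p.1 q.1) (x.pos c t) (x.vel c t)
          + christoffel g c (x.pos c t) p.2 q.1 + christoffel g c (x.pos c t) p.1 q.2)

/-- The fibre Hessian in terms of components. -/
def fiberForm (L : Lagrangian n M) (x : Loop T n M) (c : M) (t : ℝ) (u w : Model n) : ℝ :=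
  fderiv ℝ (fderiv ℝ (chartLagrangian L c t)) (x.pos c t, x.vel c t) (0, u) (0, w)

variable (g : Metric n M) {L : Lagrangian n M} (x : Loop T n M) {c : M} {a b : ℝ}

theorem isSymmFamily_metricForm (hc : x.InChart c a b) :
    IsSymmFamily (metricForm g x c) a b where
  bilin t ht := by
    refine ⟨fun u u' v ↦ ?_, fun r u v ↦ ?_, fun u v ↦ ?_⟩
    · simp only [metricForm, Prod.fst_add, Prod.snd_add, christoffel_add, map_add, add_apply]
      ring
    · simp only [metricForm, Prod.smul_fst, Prod.smul_snd, christoffel_smul, map_add, map_smul,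
        add_apply, smul_apply, smul_eq_mul]
      ring
    · rw [metricForm, metricForm, chartMetric_symm, chartMetric_symm g c _ u.1]
  cont u v := by
    have hG : ContinuousOn (fun t ↦ chartMetric g c (x.pos c t)) (Icc a b) :=
      (contDiffOn_chartMetric g c).continuousOn.comp (x.continuousOn_pos hc)
        fun t ht ↦ x.pos_mem c (hc.2 t ht)
    have hΓ : ∀ w : Model n, ContinuousOn
        (fun t ↦ christoffel g c (x.pos c t) (x.vel c t) w) (Icc a b) := fun w ↦
      continuousOn_christoffel g c (x.continuousOn_pos hc) (x.continuousOn_vel hc)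
        continuousOn_const fun t ht ↦ x.pos_mem c (hc.2 t ht)
    exact ((hG.clm_apply (continuousOn_const.add (hΓ _))).clm_apply
      (continuousOn_const.add (hΓ _))).add ((hG.clm_apply continuousOn_const).clm_apply
        continuousOn_const)

/-- If `p.1 = 0` the Christoffel terms vanish and `p.2` is measured by the metric; otherwise the
zero order term is already positive. -/
theorem metricForm_pos (hc : x.InChart c a b) : ∀ t ∈ Icc a b, ∀ p ≠ 0,
    0 < metricForm g x c t p p := by
  intro t ht p hp
  have hy := x.pos_mem c (hc.2 t ht)
  have hnn : ∀ v, 0 ≤ chartMetric g c (x.pos c t) v v := fun v ↦ by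
    rcases eq_or_ne v 0 with rfl | hv
    · simp
    · exact (chartMetric_pos g hy hv).le
  rw [metricForm]
  rcases eq_or_ne p.1 0 with h1 | h1
  · have h0 : christoffel g c (x.pos c t) (x.vel c t) 0 = 0 := by
      simpa using christoffel_smul g c (x.pos c t) (x.vel c t) 0 0
    have h2 : p.2 ≠ 0 := fun h2 ↦ hp (Prod.ext h1 h2)
    rw [h1, h0, add_zero]
    have := chartMetric_pos g hy h2
    simpa using this
  · exact add_pos_of_nonneg_of_pos (hnn _) (chartMetric_pos g hy h1)

theorem isOpen_jetDomain (c : M) :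
    IsOpen ((univ : Set ℝ) ×ˢ ((extChartAt (𝓡 n) c).target ×ˢ (univ : Set (Model n)))) :=
  isOpen_univ.prod ((isOpen_extChartAt_target c).prod isOpen_univ)

theorem contDiffAt_chartLagrangian (hL : IsSmoothPeriodic T L) {c : M} (t : ℝ)
    {p : Model n × Model n} (hp : p.1 ∈ (extChartAt (𝓡 n) c).target) :
    ContDiffAt ℝ ∞ (chartLagrangian L c t) p := by
  have h1 : ContDiffAt ℝ ∞ (fun p : ℝ × (Model n × Model n) ↦ chartLagrangian L c p.1 p.2) (t, p) :=
    (contDiffOn_chartLagrangian hL c).contDiffAt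
      ((isOpen_jetDomain c).mem_nhds ⟨mem_univ _, hp, mem_univ _⟩)
  exact h1.comp p (contDiffAt_const.prodMk contDiffAt_id)

theorem continuousOn_fderiv_chartLagrangian (hL : IsSmoothPeriodic T L) (hc : x.InChart c a b) :
    ContinuousOn (fun t ↦ fderiv ℝ (chartLagrangian L c t) (x.pos c t, x.vel c t)) (Icc a b) :=
  continuousOn_clm_apply.2 fun u ↦
    (contDiffOn_partial_fderiv (isOpen_jetDomain c) (contDiffOn_chartLagrangian hL c)
      u).continuousOn.comp (continuousOn_id.prodMk ((x.continuousOn_pos hc).prodMk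
        (x.continuousOn_vel hc))) fun t ht ↦ ⟨mem_univ _, x.pos_mem c (hc.2 t ht), mem_univ _⟩

theorem continuousOn_hessian_chartLagrangian (hL : IsSmoothPeriodic T L) (hc : x.InChart c a b)
    (u w : Model n × Model n) :
    ContinuousOn (fun t ↦ fderiv ℝ (fderiv ℝ (chartLagrangian L c t)) (x.pos c t, x.vel c t) u w)
      (Icc a b) := by
  refine ((contDiffOn_partial_fderiv (isOpen_jetDomain c) (contDiffOn_partial_fderiv
    (isOpen_jetDomain c) (contDiffOn_chartLagrangian hL c) w) u).continuousOn.comp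
      (continuousOn_id.prodMk ((x.continuousOn_pos hc).prodMk
        (x.continuousOn_vel hc))) fun t ht ↦
          ⟨mem_univ _, x.pos_mem c (hc.2 t ht), mem_univ _⟩).congr fun t ht ↦ ?_
  exact fderiv_fderiv_apply (contDiffAt_chartLagrangian hL t (p := (x.pos c t, x.vel c t))
    (x.pos_mem c (hc.2 t ht))) u w

theorem hessian_symm (hL : IsSmoothPeriodic T L) {c : M} (t : ℝ)
    {p : Model n × Model n} (hp : p.1 ∈ (extChartAt (𝓡 n) c).target) (u w : Model n × Model n) :
    fderiv ℝ (fderiv ℝ (chartLagrangian L c t)) p u w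
      = fderiv ℝ (fderiv ℝ (chartLagrangian L c t)) p w u :=
  ((contDiffAt_chartLagrangian hL t hp).isSymmSndFDerivAt (by
    rw [minSmoothness_of_isRCLikeNormedField]; exact WithTop.coe_le_coe.2 le_top)).eq u w

theorem fderiv_christoffel_add_left {y : Model n} (hy : y ∈ (extChartAt (𝓡 n) c).target)
    (u u' w : Model n) : fderiv ℝ (fun z ↦ christoffel g c z (u + u') w) y
      = fderiv ℝ (fun z ↦ christoffel g c z u w) y + fderiv ℝ (fun z ↦ christoffel g c z u' w) y := by
  have hn := (isOpen_extChartAt_target (I := 𝓡 n) c).mem_nhds hy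
  have hd : ∀ u, DifferentiableAt ℝ (fun z ↦ christoffel g c z u w) y := fun u ↦
    ((contDiffOn_christoffel g c u w).differentiableOn (by simp)).differentiableAt hn
  rw [← fderiv_add (hd u) (hd u')]
  refine Filter.EventuallyEq.fderiv_eq ?_
  filter_upwards [hn] with z hz using christoffel_add_left g hz u u' w

theorem fderiv_christoffel_smul_left {y : Model n} (hy : y ∈ (extChartAt (𝓡 n) c).target)
    (r : ℝ) (u w : Model n) : fderiv ℝ (fun z ↦ christoffel g c z (r • u) w) y
      = r • fderiv ℝ (fun z ↦ christoffel g c z u w) y := by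
  have hn := (isOpen_extChartAt_target (I := 𝓡 n) c).mem_nhds hy
  have hd : ∀ u, DifferentiableAt ℝ (fun z ↦ christoffel g c z u w) y := fun u ↦
    ((contDiffOn_christoffel g c u w).differentiableOn (by simp)).differentiableAt hn
  rw [← fderiv_const_smul (hd u)]
  refine Filter.EventuallyEq.fderiv_eq ?_
  filter_upwards [hn] with z hz using christoffel_smul_left g hz r u w

theorem fderiv_christoffel_symm {y : Model n} (hy : y ∈ (extChartAt (𝓡 n) c).target)
    (u w : Model n) : fderiv ℝ (fun z ↦ christoffel g c z u w) y
      = fderiv ℝ (fun z ↦ christoffel g c z w u) y := by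
  refine Filter.EventuallyEq.fderiv_eq ?_
  filter_upwards [(isOpen_extChartAt_target (I := 𝓡 n) c).mem_nhds hy] with z hz
    using christoffel_symm g hz u w

theorem isSymmFamily_hessForm (hL : IsSmoothPeriodic T L) (hc : x.InChart c a b) :
    IsSymmFamily (hessForm g L x c) a b where
  bilin t ht := by
    have hy := x.pos_mem c (hc.2 t ht)
    refine ⟨fun u u' v ↦ ?_, fun r u v ↦ ?_, fun u v ↦ ?_⟩
    · simp only [hessForm, Prod.fst_add, Prod.snd_add, christoffel_add_left g hy,
        fderiv_christoffel_add_left g hy, map_add, add_apply]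
      rw [sub_add_sub_comm, ← map_add]
      refine congrArg₂ _ rfl (congrArg _ (Prod.ext rfl ?_))
      simp only [Prod.snd_add]
      abel
    · simp only [hessForm, Prod.smul_fst, Prod.smul_snd, christoffel_smul_left g hy,
        fderiv_christoffel_smul_left g hy]
      set Λ := fderiv ℝ (chartLagrangian L c t) (x.pos c t, x.vel c t)
      rw [map_smul, smul_apply, smul_apply, smul_eq_mul, mul_sub, ← smul_eq_mul r (Λ _),
        ← Λ.map_smul]
      refine congrArg₂ _ rfl (congrArg _ (Prod.ext rfl ?_))
      simp only [Prod.smul_snd, smul_add]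
    · rw [hessForm, hessForm, hessian_symm hL t (p := (x.pos c t, x.vel c t)) hy,
        christoffel_symm g hy u.1 v.1, fderiv_christoffel_symm g hy u.1 v.1,
        christoffel_symm g hy u.2, christoffel_symm g hy u.1]
      congr 3
      abel
  cont u v := by
    have hpos := x.continuousOn_pos hc
    have hmem : ∀ t ∈ Icc a b, x.pos c t ∈ (extChartAt (𝓡 n) c).target :=
      fun t ht ↦ x.pos_mem c (hc.2 t ht)
    have hΓ : ∀ v w : Model n, ContinuousOn
        (fun t ↦ christoffel g c (x.pos c t) v w) (Icc a b) := fun v w ↦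
      (contDiffOn_christoffel g c v w).continuousOn.comp hpos hmem
    have hDΓ : ContinuousOn (fun t ↦ fderiv ℝ (fun z ↦ christoffel g c z u.1 v.1) (x.pos c t)
        (x.vel c t)) (Icc a b) :=
      (((contDiffOn_christoffel g c u.1 v.1).continuousOn_fderiv_of_isOpen
        (isOpen_extChartAt_target c) (by simp)).comp hpos hmem).clm_apply (x.continuousOn_vel hc)
    exact (continuousOn_hessian_chartLagrangian x hL hc u v).sub
      ((continuousOn_fderiv_chartLagrangian x hL hc).clm_apply
        ((hΓ _ _).prodMk ((hDΓ.add (hΓ _ _)).add (hΓ _ _))))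

theorem isSymmFamily_fiberForm (hL : IsSmoothPeriodic T L) (hc : x.InChart c a b) :
    IsSymmFamily (fiberForm L x c) a b where
  bilin t ht := by
    have hy := x.pos_mem c (hc.2 t ht)
    refine ⟨fun u u' v ↦ ?_, fun r u v ↦ ?_, fun u v ↦ ?_⟩
    · simp only [fiberForm, ← add_apply, ← map_add, Prod.mk_add_mk, add_zero]
    · rw [fiberForm, fiberForm, ← smul_eq_mul, ← smul_apply, ← map_smul, Prod.smul_mk, smul_zero]
    · exact hessian_symm hL t hy _ _
  cont u v := continuousOn_hessian_chartLagrangian x hL hc _ _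

/-- All terms with Christoffel symbols involve the first component, so the fibre Hessian alone is
the principal part of the second variation. This links convexity to the Gårding inequality. -/
theorem hessForm_snd {t : ℝ} (ht : x t ∈ (chartAt (Model n) c).source) (u w : Model n) :
    hessForm g L x c t (0, u) (0, w) = fiberForm L x c t u w := by
  have h1 : ∀ y v, christoffel g c y v 0 = 0 := fun y v ↦ by
    simpa using christoffel_smul g c y v 0 0
  have h2 : christoffel g c (x.pos c t) 0 w = 0 := by
    rw [christoffel_symm g (x.pos_mem c ht), h1]
  simp only [hessForm, fiberForm, h1, h2, fderiv_fun_const, Pi.zero_apply, zero_apply, add_zero]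
  exact (congrArg _ (map_zero _)).trans (sub_zero _)

/-- As `L` is quadratic in the velocity, its fibre Hessian is the same at all velocities. Hence `v`
may be arbitrary, and `x.velocity` need not be compared with `x.vel`. -/
theorem fiberHessian_eq (hL : IsSmoothPeriodic T L) (hquad : IsQuadraticInVelocity L) {t : ℝ}
    (ht : x t ∈ (chartAt (Model n) c).source) (v : TangentSpace (𝓡 n) (x t)) (u w : Model n) :
    fiberHessian L t (x t) v (ofCoords c (x t) u) (ofCoords c (x t) w)
      = fiberForm L x c t u w := by
  obtain ⟨a, b, e, h⟩ := hquad t (x t)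
  let a' : Model n →L[ℝ] Model n →L[ℝ] ℝ := a
  let b' : Model n →L[ℝ] ℝ := b
  let O : Model n →L[ℝ] Model n := ofCoords c (x t)
  have h1 : (fun z : Model n ↦ L t (⟨x t, z⟩ : TangentBundle (𝓡 n) M))
      = fun z ↦ a' z z + b' z + e := funext h
  have h2 : fiberHessian L t (x t) v (ofCoords c (x t) u) (ofCoords c (x t) w)
      = a' (O u) (O w) + a' (O w) (O u) := by
    rw [fiberHessian, h1]
    exact fderiv_fderiv_quadratic a' b' e v (O u) (O w)
  have h3 : (fun z : Model n ↦ chartLagrangian L c t (x.pos c t, z))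
      = fun z ↦ (a'.bilinearComp O O) z z + (b'.comp O) z + e := by
    funext z
    -- The base point is only propositionally equal to `x t`, so the identity is stated for a
    -- variable point before substituting.
    have h4 : ∀ q, q = x t → L t ⟨q, ofCoords c q z⟩ = a' (O z) (O z) + b' (O z) + e := by
      rintro _ rfl
      exact h _
    exact h4 _ (x.symm_pos c ht)
  have hmem := x.pos_mem c ht
  have hf := contDiffAt_chartLagrangian hL t (p := (x.pos c t, x.vel c t)) hmem
  have h4 : ∀ (f : Model n × Model n → ℝ) (v w : Model n),
      DifferentiableAt ℝ f (x.pos c t, v) →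
      fderiv ℝ f (x.pos c t, v) (0, w) = fderiv ℝ (fun z ↦ f (x.pos c t, z)) v w := by
    intro f v w hf
    have := hf.hasFDerivAt.comp v (hasFDerivAt_prodMk_right (x.pos c t) v)
    rw [show (fun z ↦ f (x.pos c t, z)) = f ∘ (fun z ↦ (x.pos c t, z)) from rfl, this.fderiv]
    simp
  have h5 : ∀ z, fderiv ℝ (chartLagrangian L c t) (x.pos c t, z) (0, w)
      = fderiv ℝ (fun z ↦ chartLagrangian L c t (x.pos c t, z)) z w := fun z ↦
    h4 _ z w ((contDiffAt_chartLagrangian hL t (p := (x.pos c t, z)) hmem).differentiableAt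
      (by simp))
  have hd : DifferentiableAt ℝ (fun p ↦ fderiv ℝ (chartLagrangian L c t) p (0, w))
      (x.pos c t, x.vel c t) :=
    ((hf.fderiv_right (m := 1) (WithTop.coe_le_coe.2 le_top)).differentiableAt
      one_ne_zero).clm_apply (differentiableAt_const _)
  have h6 : ContDiffAt ℝ ∞ (fun z ↦ chartLagrangian L c t (x.pos c t, z)) (x.vel c t) :=
    hf.comp _ (contDiffAt_const.prodMk contDiffAt_id)
  rw [h2, fiberForm, fderiv_fderiv_apply hf, h4 _ _ _ hd]
  simp only [h5]
  rw [← fderiv_fderiv_apply h6, h3, fderiv_fderiv_quadratic]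
  rfl

end Coefficients

/-! ### Forms on `H(x)` assembled from chart intervals. -/

section PieceForm

variable {n : ℕ} {M : Type*} [TopologicalSpace M] [ChartedSpace (Model n) M]
  [IsManifold (𝓡 n) ∞ M] {T : ℝ} {g : Metric n M} {x : Loop T n M}

/-- The components of a field and of the derivative in a chart. -/
def jet (ξ : H1 g x) (c : M) (t : ℝ) : Model n × Model n :=
  (coords c (x t) (ξ.field t), coordDeriv g x ξ.field ξ.covDeriv c t)

theorem memLp_jet (ξ : H1 g x) {c : M} {a b : ℝ} (hc : x.InChart c a b) :
    MemLp (jet ξ c) 2 (volume.restrict (Icc a b)) := by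
  have h1 := ξ.isCovDeriv.memLp_field c a b hc
  have h2 := ξ.isCovDeriv.memLp_coordDeriv c a b hc
  refine (h1.norm.add h2.norm).of_le (h1.1.prodMk h2.1) (ae_of_all _ fun t ↦ ?_)
  rw [jet, Prod.norm_def, Pi.add_apply, Real.norm_eq_abs]
  refine (max_le ?_ ?_).trans (le_abs_self _)
  · exact le_add_of_nonneg_right (norm_nonneg _)
  · exact le_add_of_nonneg_left (norm_nonneg _)

theorem coords_covDeriv_eq (ξ : H1 g x) (c : M) (t : ℝ) : coords c (x t) (ξ.covDeriv t)
    = (jet ξ c t).2 + christoffel g c (x.pos c t) (x.vel c t) (jet ξ c t).1 := by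
  simp [jet, coordDeriv]

variable [Fact (0 < T)]

theorem jet_add (ξ ξ' : H1 g x) : ∀ᵐ t ∂volume.restrict (Ioc 0 T), ∀ c,
    jet (ξ + ξ') c t = jet ξ c t + jet ξ' c t := by
  filter_upwards [H1.covDeriv_add ξ ξ'] with t ht c
  refine Prod.ext (map_add _ _ _) ?_
  have h := congrFun (coordDeriv_add g x ξ.field ξ.covDeriv ξ'.field ξ'.covDeriv c) t
  refine Eq.trans ?_ h
  simp only [jet, coordDeriv, Pi.add_apply, ht]
  rfl

theorem jet_smul (r : ℝ) (ξ : H1 g x) : ∀ᵐ t ∂volume.restrict (Ioc 0 T), ∀ c,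
    jet (r • ξ) c t = r • jet ξ c t := by
  filter_upwards [H1.covDeriv_smul r ξ] with t ht c
  refine Prod.ext ((coords c (x t)).map_smul r (ξ.field t)) ?_
  have h := congrFun (coordDeriv_smul g x ξ.field ξ.covDeriv c r) t
  refine Eq.trans ?_ h
  simp only [jet, coordDeriv, Pi.smul_apply, ht]
  rfl

variable (x) in
/-- The number of chart intervals of the chosen subdivision of `[0, T]`. -/
def pieces : ℕ := (Classical.choose (exists_subdivision x)).1

variable (x) in
/-- The points of the chosen subdivision of `[0, T]`. -/
def node (i : ℕ) : ℝ := (Classical.choose (exists_subdivision x)).2.1 i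

variable (x) in
/-- The centers of the charts of the chosen subdivision of `[0, T]`. -/
def center (i : ℕ) : M := (Classical.choose (exists_subdivision x)).2.2 i

variable (x) in
theorem node_zero : node x 0 = 0 := (Classical.choose_spec (exists_subdivision x)).1

variable (x) in
theorem node_pieces : node x (pieces x) = T := (Classical.choose_spec (exists_subdivision x)).2.1

variable (x) in
theorem inChart_node (i : ℕ) : x.InChart (center x i) (node x i) (node x (i + 1)) :=
  (Classical.choose_spec (exists_subdivision x)).2.2 i

variable (x) in
theorem monotone_node : Monotone (node x) := monotone_nat_of_le_succ fun i ↦ (inChart_node x i).1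

theorem node_nonneg (i : ℕ) : 0 ≤ node x i := by
  rw [← node_zero x]; exact monotone_node x (Nat.zero_le i)

theorem node_le {i : ℕ} (hi : i ≤ pieces x) : node x i ≤ T :=
  (monotone_node x hi).trans_eq (node_pieces x)

theorem Ioc_node_subset {i : ℕ} (hi : i < pieces x) :
    Ioc (node x i) (node x (i + 1)) ⊆ Ioc 0 T :=
  Ioc_subset_Ioc (node_nonneg i) (node_le hi)

/-- Families of continuous families of symmetric forms over the chart intervals. -/
abbrev PieceFamily (n : ℕ) : Type := ℕ → ℝ → Model n × Model n → Model n × Model n → ℝ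

/-- The form on `H(x)` given by families of forms in components. -/
def pieceForm (q : PieceFamily n) (ξ η : H1 g x) : ℝ :=
  ∑ i ∈ Finset.range (pieces x), ∫ t in (node x i)..(node x (i + 1)),
    q i t (jet ξ (center x i) t) (jet η (center x i) t)

variable (x) in
/-- The family consists of continuous families of symmetric forms. -/
def IsPieceFamily (q : PieceFamily n) : Prop :=
  ∀ i, IsSymmFamily (q i) (node x i) (node x (i + 1))

theorem IsPieceFamily.intervalIntegrable {q : PieceFamily n} (hq : IsPieceFamily x q) (ξ η : H1 g x)
    (i : ℕ) : IntervalIntegrable (fun t ↦ q i t (jet ξ (center x i) t) (jet η (center x i) t))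
      volume (node x i) (node x (i + 1)) := by
  rw [intervalIntegrable_iff_integrableOn_Icc_of_le (inChart_node x i).1]
  exact (hq i).integrableOn (memLp_jet ξ (inChart_node x i)) (memLp_jet η (inChart_node x i))

theorem integral_piece_congr {f f' : ℝ → ℝ} {i : ℕ} (hi : i < pieces x)
    (h : ∀ᵐ t ∂volume.restrict (Ioc 0 T), t ∈ Icc (node x i) (node x (i + 1)) → f t = f' t) :
    ∫ t in (node x i)..(node x (i + 1)), f t = ∫ t in (node x i)..(node x (i + 1)), f' t := by
  refine intervalIntegral.integral_congr_ae_restrict ?_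
  rw [uIoc_of_le (inChart_node x i).1]
  have h1 := ae_restrict_of_ae_restrict_of_subset (Ioc_node_subset hi) h
  filter_upwards [h1, ae_restrict_mem measurableSet_Ioc] with t ht ht'
  exact ht (Ioc_subset_Icc_self ht')

theorem IsPieceFamily.isSymmBilin {q : PieceFamily n} (hq : IsPieceFamily x q) :
    IsSymmBilin (pieceForm (g := g) (x := x) q) where
  add_left ξ ξ' η := by
    simp only [pieceForm, ← Finset.sum_add_distrib]
    refine Finset.sum_congr rfl fun i hi ↦ ?_
    rw [← intervalIntegral.integral_add (hq.intervalIntegrable ξ η i)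
      (hq.intervalIntegrable ξ' η i)]
    refine integral_piece_congr (Finset.mem_range.1 hi) ?_
    filter_upwards [jet_add ξ ξ'] with t ht hti
    rw [ht, ((hq i).bilin t hti).add_left]
  smul_left r ξ η := by
    simp only [pieceForm, Finset.mul_sum]
    refine Finset.sum_congr rfl fun i hi ↦ ?_
    rw [← intervalIntegral.integral_const_mul]
    refine integral_piece_congr (Finset.mem_range.1 hi) ?_
    filter_upwards [jet_smul r ξ] with t ht hti
    rw [ht, ((hq i).bilin t hti).smul_left]
  symm ξ η := by
    refine Finset.sum_congr rfl fun i hi ↦ ?_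
    refine integral_piece_congr (Finset.mem_range.1 hi) (ae_of_all _ fun t hti ↦ ?_)
    rw [((hq i).bilin t hti).symm]

/-- Pointwise inequalities on the chart intervals integrate. Simpler comparisons are obtained by
giving the third form the coefficient `0`. -/
theorem pieceForm_le {q₁ q₂ q₃ : PieceFamily n} (h₁ : IsPieceFamily x q₁)
    (h₂ : IsPieceFamily x q₂) (h₃ : IsPieceFamily x q₃) {r₁ r₂ r₃ : ℝ}
    (h : ∀ i < pieces x, ∀ t ∈ Icc (node x i) (node x (i + 1)), ∀ p,
      r₁ * q₁ i t p p ≤ r₂ * q₂ i t p p + r₃ * q₃ i t p p) (ξ : H1 g x) :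
    r₁ * pieceForm q₁ ξ ξ ≤ r₂ * pieceForm q₂ ξ ξ + r₃ * pieceForm q₃ ξ ξ := by
  simp only [pieceForm, Finset.mul_sum, ← Finset.sum_add_distrib,
    ← intervalIntegral.integral_const_mul]
  refine Finset.sum_le_sum fun i hi ↦ ?_
  rw [← intervalIntegral.integral_add ((h₂.intervalIntegrable ξ ξ i).const_mul r₂)
    ((h₃.intervalIntegrable ξ ξ i).const_mul r₃)]
  refine intervalIntegral.integral_mono_on (inChart_node x i).1
    ((h₁.intervalIntegrable ξ ξ i).const_mul r₁)
    (((h₂.intervalIntegrable ξ ξ i).const_mul r₂).add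
      ((h₃.intervalIntegrable ξ ξ i).const_mul r₃)) fun t ht ↦ ?_
  exact h i (Finset.mem_range.1 hi) t ht _

/-! ### The forms of the theorem -/

variable (n) in
/-- The Euclidean scalar product of the components of fields. -/
def fieldFamily : PieceFamily n := fun _ _ p q ↦ inner ℝ p.1 q.1

variable (n) in
/-- The Euclidean scalar product of the components of fields and of their derivatives. -/
def jetFamily : PieceFamily n := fun _ _ p q ↦ inner ℝ p.1 q.1 + inner ℝ p.2 q.2

variable (g x) in
/-- The family that represents the scalar product of `H(x)`. -/
def metricFamily : PieceFamily n := fun i ↦ metricForm g x (center x i)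

variable (g x) in
/-- The family that represents the second variation. -/
def hessFamily (L : Lagrangian n M) : PieceFamily n := fun i ↦ hessForm g L x (center x i)

variable (x) in
/-- The family that represents the form `α`. -/
def fiberFamily (L : Lagrangian n M) : PieceFamily n :=
  fun i t p q ↦ fiberForm L x (center x i) t p.1 q.1

variable (x) in
theorem isPieceFamily_field : IsPieceFamily x (fieldFamily n) := fun i ↦
  ⟨fun t _ ↦ ⟨fun u u' v ↦ by simp [fieldFamily, inner_add_left],
    fun r u v ↦ by simp [fieldFamily, inner_smul_left],
    fun u v ↦ by simp [fieldFamily, real_inner_comm]⟩, fun _ _ ↦ continuousOn_const⟩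

variable (x) in
theorem isPieceFamily_jet : IsPieceFamily x (jetFamily n) := fun i ↦
  ⟨fun t _ ↦ ⟨fun u u' v ↦ by simp only [jetFamily, Prod.fst_add, Prod.snd_add, inner_add_left]; ring,
    fun r u v ↦ by simp [jetFamily, inner_smul_left, mul_add],
    fun u v ↦ by simp [jetFamily, real_inner_comm]⟩, fun _ _ ↦ continuousOn_const⟩

variable (g x) in
theorem isPieceFamily_metric : IsPieceFamily x (metricFamily g x) := fun i ↦
  isSymmFamily_metricForm g x (inChart_node x i)

variable (g x) in
theorem isPieceFamily_hess {L : Lagrangian n M} (hL : IsSmoothPeriodic T L) :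
    IsPieceFamily x (hessFamily g x L) := fun i ↦
  isSymmFamily_hessForm g x hL (inChart_node x i)

variable (x) in
theorem isPieceFamily_fiber {L : Lagrangian n M} (hL : IsSmoothPeriodic T L) :
    IsPieceFamily x (fiberFamily x L) := fun i ↦
  ⟨fun t ht ↦ ((isSymmFamily_fiberForm x hL (inChart_node x i)).bilin t ht).comp
    (LinearMap.fst ℝ (Model n) (Model n)),
    fun _ _ ↦ (isSymmFamily_fiberForm x hL (inChart_node x i)).cont _ _⟩

/-- The integral over `[0, T]` of a function that is given in components on chart intervals. -/
theorem integral_eq_pieceForm {q : PieceFamily n} (hq : IsPieceFamily x q) {ξ η : H1 g x}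
    {f : ℝ → ℝ} (h : ∀ i, ∀ t ∈ Icc (node x i) (node x (i + 1)),
      f t = q i t (jet ξ (center x i) t) (jet η (center x i) t)) :
    ∫ t in 0..T, f t = pieceForm q ξ η := by
  have h1 := intervalIntegral.sum_integral_adjacent_intervals (μ := volume) (f := f) (a := node x)
    (n := pieces x) fun i _ ↦ (hq.intervalIntegrable ξ η i).congr_ae (by
      rw [uIoc_of_le (inChart_node x i).1]
      filter_upwards [ae_restrict_mem measurableSet_Ioc] with t ht
      exact (h i t (Ioc_subset_Icc_self ht)).symm)
  rw [node_zero, node_pieces] at h1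
  rw [← h1]
  exact Finset.sum_congr rfl fun i hi ↦
    integral_piece_congr (Finset.mem_range.1 hi) (ae_of_all _ fun t ht ↦ h i t ht)

theorem chartMetric_coords {c : M} {t : ℝ} (ht : x t ∈ (chartAt (Model n) c).source)
    (v w : TangentSpace (𝓡 n) (x t)) :
    chartMetric g c (x.pos c t) (coords c (x t) v) (coords c (x t) w) = g.inner (x t) v w := by
  have h : ∀ q, q = x t → g.inner q (ofCoords c q (coords c (x t) v))
      (ofCoords c q (coords c (x t) w)) = g.inner (x t) v w := by
    rintro _ rfl
    rw [ofCoords_coords ht, ofCoords_coords ht]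
  exact h _ (x.symm_pos c ht)

theorem h1Inner_eq_pieceForm (ξ η : H1 g x) :
    inner ℝ ξ η = pieceForm (metricFamily g x) ξ η := by
  refine integral_eq_pieceForm (isPieceFamily_metric g x) fun i t ht ↦ ?_
  have hs := (inChart_node x i).2 t ht
  rw [metricFamily, metricForm, ← coords_covDeriv_eq, ← coords_covDeriv_eq, chartMetric_coords hs]
  simp only [jet, chartMetric_coords hs]

theorem norm_sq_eq_pieceForm (ξ : H1 g x) : ‖ξ‖ ^ 2 = pieceForm (metricFamily g x) ξ ξ := by
  rw [← h1Inner_eq_pieceForm, real_inner_self_eq_norm_sq]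

/-- `pieces`, `node` and `center` unfold to the choice made in `secondVariation`, so both sides
agree definitionally. -/
theorem secondVariation_eq_pieceForm (L : Lagrangian n M) :
    secondVariation g L x = pieceForm (hessFamily g x L) := rfl

theorem alpha_eq_pieceForm {L : Lagrangian n M} (hL : IsSmoothPeriodic T L)
    (hquad : IsQuadraticInVelocity L) : alpha g L x = pieceForm (fiberFamily x L) := by
  funext ξ η
  refine integral_eq_pieceForm (isPieceFamily_fiber x hL) fun i t ht ↦ ?_
  have hs := (inChart_node x i).2 t ht
  rw [fiberFamily, ← fiberHessian_eq x hL hquad hs (x.velocity t)]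
  simp only [jet, ofCoords_coords hs]

/-! ### Comparison of the forms -/

-- Only finitely many chart intervals matter, so constants found on each interval can be replaced by
-- a common smaller one. Therefore the estimates below are phrased so that they survive shrinking
-- `r`.
variable (x) in
theorem exists_uniform_pos {P : ℕ → ℝ → Prop} (hP : ∀ i r r', 0 < r' → r' ≤ r → P i r → P i r')
    (h : ∀ i, ∃ r > 0, P i r) : ∃ r > 0, ∀ i < pieces x, P i r := by
  choose r hr hPr using h
  have h1 : ∀ᶠ s in 𝓝[>] (0 : ℝ), ∀ i ∈ Finset.range (pieces x), s ≤ r i :=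
    (Filter.eventually_all_finset _).2 fun i _ ↦
      (eventually_le_nhds (hr i)).filter_mono nhdsWithin_le_nhds
  obtain ⟨s, h2, h3⟩ := (h1.and self_mem_nhdsWithin).exists
  exact ⟨s, h3, fun i hi ↦ hP i _ _ h3 (h2 i (Finset.mem_range.2 hi)) (hPr i)⟩

theorem jetFamily_self (i : ℕ) (t : ℝ) (p : Model n × Model n) :
    jetFamily n i t p p = ‖p.1‖ ^ 2 + ‖p.2‖ ^ 2 := by
  simp [jetFamily]

theorem jetFamily_le (i : ℕ) (t : ℝ) (p : Model n × Model n) :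
    jetFamily n i t p p ≤ 2 * ‖p‖ ^ 2 := by
  rw [jetFamily_self]
  have h1 := pow_le_pow_left₀ (norm_nonneg _) (norm_fst_le p) 2
  have h2 := pow_le_pow_left₀ (norm_nonneg _) (norm_snd_le p) 2
  linarith

theorem le_jetFamily (i : ℕ) (t : ℝ) (p : Model n × Model n) :
    ‖p‖ ^ 2 ≤ jetFamily n i t p p := by
  rw [jetFamily_self, Prod.norm_def]
  rcases max_choice ‖p.1‖ ‖p.2‖ with h | h <;> rw [h] <;>
    nlinarith [sq_nonneg ‖p.1‖, sq_nonneg ‖p.2‖]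

theorem pieceForm_self_nonneg {q : PieceFamily n} (hq : IsPieceFamily x q)
    (h : ∀ i < pieces x, ∀ t ∈ Icc (node x i) (node x (i + 1)), ∀ p, 0 ≤ q i t p p) (ξ : H1 g x) :
    0 ≤ pieceForm q ξ ξ := by
  have := pieceForm_le hq hq hq (r₁ := 0) (r₂ := 1) (r₃ := 0)
    (fun i hi t ht p ↦ by simpa using h i hi t ht p) ξ
  simpa using this

variable (g x) in
/-- Every form given by components is bounded by the square of the Euclidean `H¹` norm. -/
theorem IsPieceFamily.exists_le {q : PieceFamily n} (hq : IsPieceFamily x q) :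
    ∃ C > 0, ∀ ξ : H1 g x, |pieceForm q ξ ξ| ≤ C * pieceForm (jetFamily n) ξ ξ := by
  obtain ⟨r, hr, h⟩ := exists_uniform_pos x (P := fun i r ↦
    ∀ t ∈ Icc (node x i) (node x (i + 1)), ∀ p, r * |q i t p p| ≤ jetFamily n i t p p)
    (fun i r r' _ hr' hP t ht p ↦
      (mul_le_mul_of_nonneg_right hr' (abs_nonneg _)).trans (hP t ht p))
    (fun i ↦ by
      obtain ⟨C, hC, hb⟩ := (hq i).exists_bound
      refine ⟨(C + 1)⁻¹, by positivity, fun t ht p ↦ ?_⟩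
      rw [inv_mul_le_iff₀ (by positivity)]
      have h1 := hb t ht p p
      have h2 := le_jetFamily i t p
      nlinarith [sq_nonneg ‖p‖])
  refine ⟨r⁻¹, by positivity, fun ξ ↦ ?_⟩
  rw [abs_le, ← div_eq_inv_mul, neg_le, le_div_iff₀' hr, le_div_iff₀' hr]
  have h1 := pieceForm_le hq (isPieceFamily_jet x) hq (r₁ := r) (r₂ := 1) (r₃ := 0)
    (fun i hi t ht p ↦ by
      have := h i hi t ht p
      have := mul_le_mul_of_nonneg_left (le_abs_self (q i t p p)) hr.le
      linarith) ξ
  have h2 := pieceForm_le hq (isPieceFamily_jet x) hq (r₁ := -r) (r₂ := 1) (r₃ := 0)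
    (fun i hi t ht p ↦ by
      have := h i hi t ht p
      have := mul_le_mul_of_nonneg_left (neg_abs_le (q i t p p)) hr.le
      linarith) ξ
  constructor <;> linarith

variable (g x) in
/-- The Euclidean `H¹` norm is bounded by the norm of `H(x)`. -/
theorem exists_jetForm_le :
    ∃ C > 0, ∀ ξ : H1 g x, pieceForm (jetFamily n) ξ ξ ≤ C * ‖ξ‖ ^ 2 := by
  obtain ⟨r, hr, h⟩ := exists_uniform_pos x (P := fun i r ↦
    ∀ t ∈ Icc (node x i) (node x (i + 1)), ∀ p, r * jetFamily n i t p p ≤ metricFamily g x i t p p)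
    (fun i r r' _ hr' hP t ht p ↦ (mul_le_mul_of_nonneg_right hr'
      ((sq_nonneg _).trans (le_jetFamily i t p))).trans (hP t ht p))
    (fun i ↦ by
      obtain ⟨c, hc, hb⟩ := (isPieceFamily_metric g x i).exists_pos
        (metricForm_pos g x (inChart_node x i))
      refine ⟨c / 2, by positivity, fun t ht p ↦ (le_trans ?_ (hb t ht p))⟩
      have := jetFamily_le i t p
      nlinarith)
  refine ⟨r⁻¹, by positivity, fun ξ ↦ ?_⟩
  rw [← div_eq_inv_mul, le_div_iff₀' hr, norm_sq_eq_pieceForm]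
  have h1 := pieceForm_le (isPieceFamily_jet x) (isPieceFamily_metric g x)
    (isPieceFamily_metric g x) (r₁ := r) (r₂ := 1) (r₃ := 0)
    (fun i hi t ht p ↦ by have := h i hi t ht p; linarith) ξ
  linarith

theorem fiberForm_pos {L : Lagrangian n M} (hL : IsSmoothPeriodic T L)
    (hquad : IsQuadraticInVelocity L)
    (hconv : ∃ ℓ₀ : ℝ, 0 < ℓ₀ ∧ ∀ (t : ℝ) (q : M) (v w : TangentSpace (𝓡 n) q),
      ℓ₀ * g.inner q w w ≤ fiberHessian L t q v w w) {c : M} {t : ℝ}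
    (ht : x t ∈ (chartAt (Model n) c).source) {u : Model n} (hu : u ≠ 0) :
    0 < fiberForm L x c t u u := by
  obtain ⟨ℓ₀, hℓ, h⟩ := hconv
  rw [← fiberHessian_eq x hL hquad ht 0]
  refine lt_of_lt_of_le (mul_pos hℓ (g.pos _ _ fun h0 ↦ hu ?_)) (h t (x t) 0 _)
  rw [← coords_ofCoords ht u, h0, map_zero]

variable (g x) in
theorem exists_fieldForm_le {L : Lagrangian n M} (hL : IsSmoothPeriodic T L)
    (hquad : IsQuadraticInVelocity L)
    (hconv : ∃ ℓ₀ : ℝ, 0 < ℓ₀ ∧ ∀ (t : ℝ) (q : M) (v w : TangentSpace (𝓡 n) q),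
      ℓ₀ * g.inner q w w ≤ fiberHessian L t q v w w) :
    ∃ c > 0, ∀ ξ : H1 g x, c * pieceForm (fieldFamily n) ξ ξ ≤ alpha g L x ξ ξ := by
  obtain ⟨r, hr, h⟩ := exists_uniform_pos x (P := fun i r ↦
    ∀ t ∈ Icc (node x i) (node x (i + 1)), ∀ p : Model n × Model n,
      r * ‖p.1‖ ^ 2 ≤ fiberFamily x L i t p p)
    (fun i r r' _ hr' hP t ht p ↦ (mul_le_mul_of_nonneg_right hr' (sq_nonneg _)).trans (hP t ht p))
    (fun i ↦ by
      obtain ⟨c, hc, hb⟩ := (isSymmFamily_fiberForm x hL (inChart_node x i)).exists_pos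
        fun t ht u hu ↦ fiberForm_pos hL hquad hconv ((inChart_node x i).2 t ht) hu
      exact ⟨c, hc, fun t ht p ↦ hb t ht p.1⟩)
  refine ⟨r, hr, fun ξ ↦ ?_⟩
  rw [alpha_eq_pieceForm hL hquad]
  have h1 := pieceForm_le (isPieceFamily_field x) (isPieceFamily_fiber x hL)
    (isPieceFamily_fiber x hL) (r₁ := r) (r₂ := 1) (r₃ := 0)
    (fun i hi t ht p ↦ by
      have := h i hi t ht p
      simp only [fieldFamily, real_inner_self_eq_norm_sq]
      linarith) ξ
  linarith

variable (g x) in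
theorem exists_alpha_le {L : Lagrangian n M} (hL : IsSmoothPeriodic T L)
    (hquad : IsQuadraticInVelocity L) :
    ∃ C > 0, ∀ ξ : H1 g x, alpha g L x ξ ξ ≤ C * pieceForm (fieldFamily n) ξ ξ := by
  obtain ⟨r, hr, h⟩ := exists_uniform_pos x (P := fun i r ↦
    ∀ t ∈ Icc (node x i) (node x (i + 1)), ∀ p : Model n × Model n,
      r * |fiberFamily x L i t p p| ≤ ‖p.1‖ ^ 2)
    (fun i r r' _ hr' hP t ht p ↦
      (mul_le_mul_of_nonneg_right hr' (abs_nonneg _)).trans (hP t ht p))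
    (fun i ↦ by
      obtain ⟨C, hC, hb⟩ := (isSymmFamily_fiberForm x hL (inChart_node x i)).exists_bound
      refine ⟨(C + 1)⁻¹, by positivity, fun t ht p ↦ ?_⟩
      rw [inv_mul_le_iff₀ (by positivity)]
      have h1 : |fiberFamily x L i t p p| ≤ _ := hb t ht p.1 p.1
      nlinarith [sq_nonneg ‖p.1‖])
  refine ⟨r⁻¹, by positivity, fun ξ ↦ ?_⟩
  rw [alpha_eq_pieceForm hL hquad, ← div_eq_inv_mul, le_div_iff₀' hr]
  have h1 := pieceForm_le (isPieceFamily_fiber x hL) (isPieceFamily_field x)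
    (isPieceFamily_fiber x hL) (r₁ := r) (r₂ := 1) (r₃ := 0)
    (fun i hi t ht p ↦ by
      have h1 := h i hi t ht p
      have h2 := mul_le_mul_of_nonneg_left (le_abs_self (fiberFamily x L i t p p)) hr.le
      simp only [fieldFamily, real_inner_self_eq_norm_sq]
      linarith) ξ
  linarith

variable (g x) in
/-- The Gårding inequality for the second variation. -/
theorem exists_garding {L : Lagrangian n M} (hL : IsSmoothPeriodic T L)
    (hquad : IsQuadraticInVelocity L)
    (hconv : ∃ ℓ₀ : ℝ, 0 < ℓ₀ ∧ ∀ (t : ℝ) (q : M) (v w : TangentSpace (𝓡 n) q),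
      ℓ₀ * g.inner q w w ≤ fiberHessian L t q v w w) :
    ∃ c R, 0 < c ∧ 0 ≤ R ∧ ∀ ξ : H1 g x, c * pieceForm (jetFamily n) ξ ξ
      ≤ secondVariation g L x ξ ξ + R * pieceForm (fieldFamily n) ξ ξ := by
  -- The coercivity constant and the error constant are expressed through one parameter, as `r` and
  -- `r⁻¹`, so that shrinking `r` weakens both sides of the inequality.
  obtain ⟨r, hr, h⟩ := exists_uniform_pos x (P := fun i r ↦
    ∀ t ∈ Icc (node x i) (node x (i + 1)), ∀ p : Model n × Model n,
      r * jetFamily n i t p p ≤ hessFamily g x L i t p p + r⁻¹ * ‖p.1‖ ^ 2)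
    (fun i r r' hr0 hr' hP t ht p ↦ by
      have h1 := mul_le_mul_of_nonneg_right hr' ((sq_nonneg _).trans (le_jetFamily i t p))
      have h2 := mul_le_mul_of_nonneg_right (inv_anti₀ hr0 hr') (sq_nonneg ‖p.1‖)
      linarith [hP t ht p])
    (fun i ↦ by
      obtain ⟨c, R, hc, hR, hb⟩ := (isPieceFamily_hess g x hL i).garding fun t ht u hu ↦ by
        rw [hessFamily, hessForm_snd g x ((inChart_node x i).2 t ht)]
        exact fiberForm_pos hL hquad hconv ((inChart_node x i).2 t ht) hu
      refine ⟨min (c / 2) (R + 1)⁻¹, lt_min (by positivity) (by positivity), fun t ht p ↦ ?_⟩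
      have h1 := mul_le_mul_of_nonneg_right (min_le_left (c / 2) (R + 1)⁻¹)
        ((sq_nonneg _).trans (le_jetFamily i t p))
      have h2 : R + 1 ≤ (min (c / 2) (R + 1)⁻¹)⁻¹ := by
        rw [le_inv_comm₀ (by positivity) (lt_min (by positivity) (by positivity))]
        exact min_le_right _ _
      have h3 := mul_le_mul_of_nonneg_right h2 (sq_nonneg ‖p.1‖)
      have h4 := jetFamily_le i t p
      have h5 := hb t ht p
      nlinarith [sq_nonneg ‖p.1‖])
  refine ⟨r, r⁻¹, hr, by positivity, fun ξ ↦ ?_⟩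
  rw [secondVariation_eq_pieceForm]
  have h1 := pieceForm_le (isPieceFamily_jet x) (isPieceFamily_hess g x hL)
    (isPieceFamily_field x) (r₁ := r) (r₂ := 1) (r₃ := r⁻¹)
    (fun i hi t ht p ↦ by
      have := h i hi t ht p
      simp only [fieldFamily, real_inner_self_eq_norm_sq]
      linarith) ξ
  linarith

end PieceForm

/-! ### Poincaré inequalities on an interval. -/

section Poincare

theorem sq_intervalIntegral_le {f : ℝ → ℝ} {a b : ℝ} (hab : a ≤ b)
    (hf : MemLp f 2 (volume.restrict (Icc a b))) :
    (∫ t in a..b, f t) ^ 2 ≤ (b - a) * ∫ t in a..b, f t ^ 2 := by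
  have h1 : IntervalIntegrable f volume a b :=
    (intervalIntegrable_iff_integrableOn_Icc_of_le hab).2 (hf.integrable (by norm_num))
  have h2 : IntervalIntegrable (fun t ↦ f t ^ 2) volume a b :=
    (intervalIntegrable_iff_integrableOn_Icc_of_le hab).2 hf.integrable_sq
  rcases hab.eq_or_lt with rfl | hlt
  · simp
  set I := ∫ t in a..b, f t
  have hba : 0 < b - a := sub_pos.2 hlt
  -- Cauchy-Schwarz is obtained from the nonnegativity of the variance of `f`.
  have h3 : 0 ≤ ∫ t in a..b, (f t - I / (b - a)) ^ 2 :=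
    intervalIntegral.integral_nonneg hab fun t _ ↦ sq_nonneg _
  have h4 : ∫ t in a..b, (f t - I / (b - a)) ^ 2
      = (∫ t in a..b, f t ^ 2) - 2 * (I / (b - a)) * I + (b - a) * (I / (b - a)) ^ 2 := by
    have : ∀ t, (f t - I / (b - a)) ^ 2
        = f t ^ 2 - 2 * (I / (b - a)) * f t + (I / (b - a)) ^ 2 := fun t ↦ by ring
    simp only [this]
    rw [intervalIntegral.integral_add (h2.sub (h1.const_mul _)) intervalIntegrable_const,
      intervalIntegral.integral_sub h2 (h1.const_mul _), intervalIntegral.integral_const_mul,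
      intervalIntegral.integral_const, smul_eq_mul]
  rw [h4] at h3
  have h5 : (∫ t in a..b, f t ^ 2) - 2 * (I / (b - a)) * I + (b - a) * (I / (b - a)) ^ 2
      = (∫ t in a..b, f t ^ 2) - I ^ 2 / (b - a) := by field_simp; ring
  rw [h5, sub_nonneg, div_le_iff₀ hba] at h3
  linarith

variable {E : Type*} [NormedAddCommGroup E] [NormedSpace ℝ E]

theorem norm_sq_intervalIntegral_le {f : ℝ → E} {a b : ℝ}
    (hf : MemLp f 2 (volume.restrict (Icc a b))) {s t : ℝ} (hs : s ∈ Icc a b) (ht : t ∈ Icc a b) :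
    ‖∫ r in s..t, f r‖ ^ 2 ≤ (b - a) * ∫ r in a..b, ‖f r‖ ^ 2 := by
  have hab : a ≤ b := hs.1.trans hs.2
  refine le_trans ?_ (sq_intervalIntegral_le hab hf.norm)
  refine pow_le_pow_left₀ (norm_nonneg _) ?_ 2
  refine intervalIntegral.norm_integral_le_integral_norm_uIoc.trans ?_
  rw [intervalIntegral.integral_of_le hab]
  refine setIntegral_mono_set ?_ (ae_of_all _ fun _ ↦ norm_nonneg _) ?_
  · exact (hf.norm.integrable (by norm_num)).mono_measure
      (Measure.restrict_mono Ioc_subset_Icc_self le_rfl)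
  · exact (Ioc_subset_Ioc (le_min hs.1 ht.1) (max_le hs.2 ht.2)).eventuallyLE

theorem integral_norm_sq_le_of_zero {f f' : ℝ → E} {a b : ℝ} (hab : a ≤ b)
    (hf' : MemLp f' 2 (volume.restrict (Icc a b))) (hc : ContinuousOn f (Icc a b))
    (hprim : ∀ t ∈ Icc a b, f t = ∫ r in a..t, f' r) :
    ∫ t in a..b, ‖f t‖ ^ 2 ≤ (b - a) ^ 2 * ∫ t in a..b, ‖f' t‖ ^ 2 := by
  have h1 := intervalIntegral.integral_mono_on (μ := volume) hab (f := fun t ↦ ‖f t‖ ^ 2)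
    (g := fun _ ↦ (b - a) * ∫ t in a..b, ‖f' t‖ ^ 2)
    (ContinuousOn.intervalIntegrable (by rw [uIcc_of_le hab]; exact hc.norm.pow 2))
    intervalIntegrable_const fun t ht ↦ by
      rw [hprim t ht]
      exact norm_sq_intervalIntegral_le hf' (left_mem_Icc.2 hab) ht
  refine h1.trans_eq ?_
  rw [intervalIntegral.integral_const, smul_eq_mul]
  ring

/-- The Poincaré inequality for functions that vanish at equally spaced points. -/
theorem integral_norm_sq_le_of_grid {f f' : ℝ → E} {a b : ℝ} (hab : a ≤ b)
    (hf' : MemLp f' 2 (volume.restrict (Icc a b))) (hc : ContinuousOn f (Icc a b))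
    (hprim : ∀ s t, a ≤ s → s ≤ t → t ≤ b → f t - f s = ∫ r in s..t, f' r) {N : ℕ} (hN : 0 < N)
    (hzero : ∀ j < N, f (a + j * ((b - a) / N)) = 0) :
    ∫ t in a..b, ‖f t‖ ^ 2 ≤ ((b - a) / N) ^ 2 * ∫ t in a..b, ‖f' t‖ ^ 2 := by
  set h := (b - a) / N with hh
  have hN' : (0 : ℝ) < N := Nat.cast_pos.2 hN
  have hba : 0 ≤ b - a := sub_nonneg.2 hab
  have hh0 : 0 ≤ h := by positivity
  have hNh : N * h = b - a := by rw [hh]; field_simp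
  let r : ℕ → ℝ := fun j ↦ a + j * h
  have hr0 : r 0 = a := by simp [r]
  have hrN : r N = b := by simp only [r, hNh]; ring
  have hr1 : ∀ j, r (j + 1) - r j = h := fun j ↦ by simp only [r]; push_cast; ring
  have hra : ∀ j, a ≤ r j := fun j ↦ le_add_of_nonneg_right (by positivity)
  have hrb : ∀ j ≤ N, r j ≤ b := fun j hj ↦ by
    rw [← hrN]
    have : (j : ℝ) ≤ N := Nat.cast_le.2 hj
    simp only [r]
    gcongr
  have hle : ∀ j, r j ≤ r (j + 1) := fun j ↦ by linarith [hr1 j]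
  have hsub : ∀ j < N, Icc (r j) (r (j + 1)) ⊆ Icc a b := fun j hj ↦
    Icc_subset_Icc (hra j) (hrb _ hj)
  have hi1 : ∀ j < N, IntervalIntegrable (fun t ↦ ‖f t‖ ^ 2) volume (r j) (r (j + 1)) :=
    fun j hj ↦ ContinuousOn.intervalIntegrable (by
      rw [uIcc_of_le (hle j)]; exact (hc.mono (hsub j hj)).norm.pow 2)
  have hi2 : ∀ j < N, IntervalIntegrable (fun t ↦ ‖f' t‖ ^ 2) volume (r j) (r (j + 1)) :=
    fun j hj ↦ (intervalIntegrable_iff_integrableOn_Icc_of_le (hle j)).2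
      (IntegrableOn.mono_set hf'.norm.integrable_sq (hsub j hj))
  rw [← hr0, ← hrN, ← intervalIntegral.sum_integral_adjacent_intervals hi1,
    ← intervalIntegral.sum_integral_adjacent_intervals hi2, Finset.mul_sum]
  refine Finset.sum_le_sum fun j hj ↦ ?_
  rw [Finset.mem_range] at hj
  rw [← hr1 j]
  refine integral_norm_sq_le_of_zero (hle j)
    (hf'.mono_measure (Measure.restrict_mono (hsub j hj) le_rfl)) (hc.mono (hsub j hj))
    fun t ht ↦ ?_
  -- Only the value at the left end of each subinterval has to vanish, which is why the grid stops
  -- at `j < N`.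
  rw [← hprim _ _ (hra j) ht.1 (ht.2.trans (hrb _ hj)), show f (r j) = 0 from hzero j hj, sub_zero]

end Poincare

/-! ### Smallness of the `L²` norm in finite codimension, and the conclusion for complete `H(x)`. -/

section SmallSubspace

variable {n : ℕ} {M : Type*} [TopologicalSpace M] [ChartedSpace (Model n) M]
  [IsManifold (𝓡 n) ∞ M] {T : ℝ} {g : Metric n M} {x : Loop T n M}

theorem Loop.InChart.mono {c : M} {a b a' b' : ℝ} (hc : x.InChart c a b) (ha : a ≤ a')
    (hab : a' ≤ b') (hb : b' ≤ b) : x.InChart c a' b' :=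
  ⟨hab, fun t ht ↦ hc.2 t ⟨ha.trans ht.1, ht.2.trans hb⟩⟩

variable [Fact (0 < T)]

/-- Equally spaced points in the chart intervals. -/
def gridPoint (x : Loop T n M) (N i j : ℕ) : ℝ :=
  node x i + j * ((node x (i + 1) - node x i) / N)

variable (g x) in
/-- The values of a field, in components, at equally spaced points in the chart intervals. -/
def gridValues (N : ℕ) : H1 g x →ₗ[ℝ] (Fin (pieces x) × Fin N → Model n) where
  toFun ξ k := coords (center x k.1) (x (gridPoint x N k.1 k.2)) (ξ.field (gridPoint x N k.1 k.2))
  map_add' _ _ := funext fun _ ↦ (coords _ _).map_add _ _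
  map_smul' _ _ := funext fun _ ↦ (coords _ _).map_smul _ _

/-- The Poincaré inequality on the grid, where no subinterval is longer than `T / N`. -/
theorem fieldForm_le_of_gridValues {N : ℕ} (hN : 0 < N) {ξ : H1 g x}
    (h : gridValues g x N ξ = 0) :
    pieceForm (fieldFamily n) ξ ξ ≤ (T / N) ^ 2 * pieceForm (jetFamily n) ξ ξ := by
  simp only [pieceForm, Finset.mul_sum]
  refine Finset.sum_le_sum fun i hi ↦ ?_
  rw [Finset.mem_range] at hi
  have hc := inChart_node x i
  have h1 := integral_norm_sq_le_of_grid hc.1 (f := fun t ↦ (jet ξ (center x i) t).1)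
    (f' := fun t ↦ (jet ξ (center x i) t).2) (ξ.isCovDeriv.memLp_coordDeriv _ _ _ hc)
    (ξ.isCovDeriv.continuousOn hc)
    (fun s t hs hst ht ↦ ξ.isCovDeriv.primitive _ _ _ (hc.mono hs hst ht)) hN
    (fun j hj ↦ congrFun h (⟨i, hi⟩, ⟨j, hj⟩))
  have hj := (isPieceFamily_jet x).intervalIntegrable ξ ξ i
  have hf := (isPieceFamily_field x).intervalIntegrable ξ ξ i
  simp only [fieldFamily, jetFamily_self, real_inner_self_eq_norm_sq] at hj hf ⊢
  have h2 : ∫ t in (node x i)..(node x (i + 1)), ‖(jet ξ (center x i) t).2‖ ^ 2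
      ≤ ∫ t in (node x i)..(node x (i + 1)),
        (‖(jet ξ (center x i) t).1‖ ^ 2 + ‖(jet ξ (center x i) t).2‖ ^ 2) := by
    refine intervalIntegral.integral_mono_on hc.1 ?_ hj fun t _ ↦
      le_add_of_nonneg_left (sq_nonneg _)
    exact (hj.sub hf).congr fun t _ ↦ add_sub_cancel_left _ _
  have h3 : (node x (i + 1) - node x i) / N ≤ T / N := by
    have := node_le (x := x) (Nat.succ_le_of_lt hi)
    have := node_nonneg (x := x) i
    gcongr
    linarith
  have h4 : 0 ≤ (node x (i + 1) - node x i) / N :=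
    div_nonneg (sub_nonneg.2 hc.1) (Nat.cast_nonneg _)
  refine h1.trans (mul_le_mul (pow_le_pow_left₀ h4 h3 2) h2 ?_ (sq_nonneg _))
  exact intervalIntegral.integral_nonneg hc.1 fun t _ ↦ sq_nonneg _

variable (g x) in
/-- The `L²` norm is arbitrarily small, with respect to the `H¹` norm, on subspaces of finite
codimension. -/
theorem exists_coFG_fieldForm_le {κ : ℝ} (hκ : 0 < κ) : ∃ V : Submodule ℝ (H1 g x), V.CoFG ∧
    ∀ ξ ∈ V, pieceForm (fieldFamily n) ξ ξ ≤ κ * ‖ξ‖ ^ 2 := by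
  obtain ⟨C, hC, hb⟩ := exists_jetForm_le g x
  have hlim : Tendsto (fun N : ℕ ↦ (T / N) ^ 2 * C) atTop (𝓝 0) := by
    have := ((tendsto_const_div_atTop_nhds_zero_nat T).pow 2).mul_const C
    simpa using this
  obtain ⟨N, hN1, hN2⟩ := ((hlim.eventually (gt_mem_nhds hκ)).and (eventually_gt_atTop 0)).exists
  -- Vanishing at finitely many points is a finite set of linear conditions, and `N` is large enough
  -- that the Poincaré constant times `C` is below `κ`.
  refine ⟨LinearMap.ker (gridValues g x N), ?_, fun ξ hξ ↦ ?_⟩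
  · rw [LinearMap.ker_coFG_iff_hasFiniteRange]
    exact LinearMap.HasFiniteRange.of_isNoetherian_rng
  · refine (fieldForm_le_of_gridValues hN2 hξ).trans ?_
    have h1 := mul_le_mul_of_nonneg_left (hb ξ) (sq_nonneg (T / N))
    have h2 := mul_le_mul_of_nonneg_right hN1.le (sq_nonneg ‖ξ‖)
    linarith

/-- The conclusion, once `H(x)` is known to be complete. -/
theorem morseIndex_eq_spectralIndex [CompleteSpace (H1 g x)] {L : Lagrangian n M}
    (hL : IsSmoothPeriodic T L) (hquad : IsQuadraticInVelocity L)
    (hconv : ∃ ℓ₀ : ℝ, 0 < ℓ₀ ∧ ∀ (t : ℝ) (q : M) (v w : TangentSpace (𝓡 n) q),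
      ℓ₀ * g.inner q w w ≤ fiberHessian L t q v w w) :
    ∃ m : ℕ, morseIndex (secondVariation g L x) = m ∧
      ∀ k : ℤ, IsSpectralIndex g L x k ↔ k = m := by
  obtain ⟨C₁, hC₁, hjet⟩ := exists_jetForm_le g x
  obtain ⟨C₂, hC₂, hfib⟩ := exists_alpha_le g x hL hquad
  obtain ⟨c₃, hc₃, hfield⟩ := exists_fieldForm_le g x hL hquad hconv
  obtain ⟨c₄, R, hc₄, hR, hgard⟩ := exists_garding g x hL hquad hconv
  obtain ⟨C₅, hC₅, hmet⟩ := (isPieceFamily_metric g x).exists_le g x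
  have hsV : IsSymmBilin (secondVariation g L x) := (isPieceFamily_hess g x hL).isSymmBilin
  have hα : IsSymmBilin (alpha g L x) := by
    rw [alpha_eq_pieceForm hL hquad]
    exact (isPieceFamily_fiber x hL).isSymmBilin
  obtain ⟨A₀, hA₀⟩ : ∃ A : H1 g x →L[ℝ] H1 g x, ∀ u v,
      inner ℝ (A u) v = secondVariation g L x u v := by
    obtain ⟨C, hC, h⟩ := (isPieceFamily_hess g x hL).exists_le g x
    exact hsV.exists_operator (C := C * C₁) fun u ↦ (h u).trans (by
      rw [mul_assoc]; exact mul_le_mul_of_nonneg_left (hjet u) hC.le)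
  obtain ⟨K, hK⟩ : ∃ A : H1 g x →L[ℝ] H1 g x, ∀ u v, inner ℝ (A u) v = alpha g L x u v := by
    obtain ⟨C, hC, h⟩ := (isPieceFamily_fiber x hL).exists_le g x
    rw [← alpha_eq_pieceForm hL hquad] at h
    exact hα.exists_operator (C := C * C₁) fun u ↦ (h u).trans (by
      rw [mul_assoc]; exact mul_le_mul_of_nonneg_left (hjet u) hC.le)
  have hfield0 : ∀ ξ : H1 g x, 0 ≤ pieceForm (fieldFamily n) ξ ξ := fun ξ ↦
    pieceForm_self_nonneg (isPieceFamily_field x) (fun i _ t _ p ↦ by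
      simp only [fieldFamily, real_inner_self_eq_norm_sq]; positivity) ξ
  -- `c₄ / C₅` converts the Euclidean `H¹` norm in the Gårding inequality to the norm of `H(x)`, and
  -- `R / c₃` converts the `L²` error to `α`.
  refine morseIndex_eq_spectralFlow hA₀ hK hsV.symm hα.symm
    (fun ξ ↦ (mul_nonneg hc₃.le (hfield0 ξ)).trans (hfield ξ)) (c := c₄ / C₅) (C := R / c₃)
    (by positivity) (fun ξ ↦ ?_) (fun κ hκ ↦ ?_)
  · have h1 := (le_abs_self _).trans (hmet ξ)
    rw [← norm_sq_eq_pieceForm] at h1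
    have h2 : c₄ / C₅ * ‖ξ‖ ^ 2 ≤ c₄ * pieceForm (jetFamily n) ξ ξ := by
      rw [div_mul_eq_mul_div, div_le_iff₀ hC₅]
      nlinarith
    have h3 : R * pieceForm (fieldFamily n) ξ ξ ≤ R / c₃ * alpha g L x ξ ξ := by
      rw [div_mul_eq_mul_div, le_div_iff₀ hc₃]
      nlinarith [hfield ξ]
    linarith [hgard ξ]
  · obtain ⟨V, hV, h⟩ := exists_coFG_fieldForm_le g x (κ := κ / C₂) (by positivity)
    refine ⟨V, hV, fun ξ hξ ↦ (hfib ξ).trans ?_⟩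
    have := mul_le_mul_of_nonneg_left (h ξ hξ) hC₂.le
    rwa [← mul_assoc, mul_div_cancel₀ _ hC₂.ne'] at this

end SmallSubspace

/-! ### Completeness of `H(x)` -/

/-! ### Limits in `L²` on an interval. -/

section L2

variable {E : Type*} [NormedAddCommGroup E] [NormedSpace ℝ E] [CompleteSpace E]

/-- By Lebesgue's theorem both functions are almost everywhere the derivative of the same primitive.
-/
theorem ae_eq_of_intervalIntegral_eq {f f' : ℝ → E} {a b : ℝ} (hab : a ≤ b)
    (hf : IntervalIntegrable f volume a b) (hf' : IntervalIntegrable f' volume a b)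
    (e : ∀ t ∈ Icc a b, ∫ u in a..t, f u = ∫ u in a..t, f' u) :
    ∀ᵐ t ∂volume.restrict (Icc a b), f t = f' t := by
  have d := hf.ae_hasDerivAt_integral
  have d' := hf'.ae_hasDerivAt_integral
  rw [uIcc_of_le hab] at d d'
  rw [← restrict_Ioo_eq_restrict_Icc]
  refine (ae_restrict_iff' measurableSet_Ioo).2 ?_
  filter_upwards [d, d'] with t ht ht' ht0
  have h1 := ht (Ioo_subset_Icc_self ht0) a (left_mem_Icc.2 hab)
  have h2 := ht' (Ioo_subset_Icc_self ht0) a (left_mem_Icc.2 hab)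
  exact h1.unique (h2.congr_of_eventuallyEq (by
    filter_upwards [Ioo_mem_nhds ht0.1 ht0.2] with u hu using e u (Ioo_subset_Icc_self hu)))

theorem eLpNorm_two_eq {f : ℝ → E} {a b : ℝ} (hab : a ≤ b)
    (hf : MemLp f 2 (volume.restrict (Icc a b))) :
    eLpNorm f 2 (volume.restrict (Icc a b)) = ENNReal.ofReal √(∫ t in a..b, ‖f t‖ ^ 2) := by
  rw [hf.eLpNorm_eq_integral_rpow_norm (by norm_num) (by norm_num),
    intervalIntegral.integral_of_le hab, ← integral_Icc_eq_integral_Ioc, Real.sqrt_eq_rpow]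
  simp

theorem intervalIntegrable_norm_sq {f : ℝ → E} {a b : ℝ} (hab : a ≤ b)
    (hf : MemLp f 2 (volume.restrict (Icc a b))) :
    IntervalIntegrable (fun t ↦ ‖f t‖ ^ 2) volume a b := by
  rw [intervalIntegrable_iff_integrableOn_Icc_of_le hab]
  exact hf.integrable_norm_pow (by norm_num)

/-- A sequence that is Cauchy in `L²` at a geometric rate converges almost everywhere and in
`L²`. -/
theorem exists_limit_of_geometric {f : ℕ → ℝ → E} {a b C : ℝ} (hab : a ≤ b) (hC : 0 < C)
    (hf : ∀ i, MemLp (f i) 2 (volume.restrict (Icc a b)))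
    (h : ∀ N i j, N ≤ i → N ≤ j → ∫ t in a..b, ‖f i t - f j t‖ ^ 2 ≤ (C * (1 / 2) ^ N) ^ 2) :
    ∃ F : ℝ → E, MemLp F 2 (volume.restrict (Icc a b)) ∧
      (∀ᵐ t ∂volume.restrict (Icc a b), Tendsto (fun i ↦ f i t) atTop (𝓝 (F t))) ∧
      Tendsto (fun i ↦ ∫ t in a..b, ‖f i t - F t‖ ^ 2) atTop (𝓝 0) := by
  -- The factor `2` turns the hypothesis into the strict inequality of `hcau`.
  have hB : ∑' N : ℕ, ENNReal.ofReal (2 * C * (1 / 2) ^ N) ≠ ⊤ := by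
    have hs : Summable fun N : ℕ ↦ 2 * C * (1 / 2 : ℝ) ^ N :=
      (summable_geometric_of_lt_one (by norm_num) (by norm_num)).mul_left _
    exact hs.tsum_ofReal_ne_top
  have hcau : ∀ N i j : ℕ, N ≤ i → N ≤ j →
      eLpNorm (f i - f j) 2 (volume.restrict (Icc a b)) < ENNReal.ofReal (2 * C * (1 / 2) ^ N) := by
    intro N i j hi hj
    rw [eLpNorm_two_eq hab ((hf i).sub (hf j)), ENNReal.ofReal_lt_ofReal_iff (by positivity)]
    have h1 : √(∫ t in a..b, ‖(f i - f j) t‖ ^ 2) ≤ C * (1 / 2) ^ N :=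
      (Real.sqrt_le_sqrt (h N i j hi hj)).trans_eq (Real.sqrt_sq (by positivity))
    have h2 : 0 < C * (1 / 2 : ℝ) ^ N := by positivity
    linarith
  obtain ⟨F, hF, hlim⟩ := exists_stronglyMeasurable_limit_of_tendsto_ae (fun i ↦ (hf i).1)
    (Lp.ae_tendsto_of_cauchy_eLpNorm (fun i ↦ (hf i).1) (by norm_num) hB hcau)
  have hL := Lp.cauchy_tendsto_of_tendsto (fun i ↦ (hf i).1) F hB hcau hlim
  have hmem := Lp.memLp_of_cauchy_tendsto (by norm_num) hf F hF.aestronglyMeasurable hL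
  refine ⟨F, hmem, hlim, ?_⟩
  have h1 := ((ENNReal.tendsto_toReal ENNReal.zero_ne_top).comp hL).pow 2
  simp only [ENNReal.toReal_zero, ne_eq, OfNat.ofNat_ne_zero, not_false_eq_true, zero_pow] at h1
  refine h1.congr fun i ↦ ?_
  simp only [Function.comp]
  rw [eLpNorm_two_eq hab ((hf i).sub hmem), ENNReal.toReal_ofReal (Real.sqrt_nonneg _),
    Real.sq_sqrt (intervalIntegral.integral_nonneg hab fun t _ ↦ by positivity)]
  rfl

/-- By Cauchy-Schwarz, `L²` convergence on the interval controls all integrals over subintervals. -/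
theorem tendsto_intervalIntegral_of_sq {f : ℕ → ℝ → E} {F : ℝ → E} {a b s t : ℝ}
    (hf : ∀ i, MemLp (f i) 2 (volume.restrict (Icc a b)))
    (hF : MemLp F 2 (volume.restrict (Icc a b)))
    (h : Tendsto (fun i ↦ ∫ t in a..b, ‖f i t - F t‖ ^ 2) atTop (𝓝 0))
    (hs : s ∈ Icc a b) (ht : t ∈ Icc a b) :
    Tendsto (fun i ↦ ∫ r in s..t, f i r) atTop (𝓝 (∫ r in s..t, F r)) := by
  have hsub : uIcc s t ⊆ Icc a b := (convex_Icc a b).ordConnected.uIcc_subset hs ht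
  have hint : ∀ {f : ℝ → E}, MemLp f 2 (volume.restrict (Icc a b)) →
      IntervalIntegrable f volume s t := fun hf ↦
    (intervalIntegrable_iff_integrableOn_Icc_of_le (hs.1.trans hs.2)).2
      (hf.integrable (by norm_num)) |>.mono_set (by rwa [uIcc_of_le (hs.1.trans hs.2)])
  rw [tendsto_iff_norm_sub_tendsto_zero]
  have h1 : Tendsto (fun i ↦ √((b - a) * ∫ t in a..b, ‖f i t - F t‖ ^ 2)) atTop (𝓝 0) := by
    simpa using (h.const_mul (b - a)).sqrt
  refine squeeze_zero (fun _ ↦ norm_nonneg _) (fun i ↦ ?_) h1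
  rw [← intervalIntegral.integral_sub (hint (hf i)) (hint hF)]
  exact Real.le_sqrt_of_sq_le (norm_sq_intervalIntegral_le ((hf i).sub hF) hs ht)

end L2

/-! ### Components of fields on chart intervals anywhere on the real line. -/

section Charts

variable {n : ℕ} {M : Type*} [TopologicalSpace M] [ChartedSpace (Model n) M]
  [IsManifold (𝓡 n) ∞ M] {T : ℝ} {g : Metric n M} {x : Loop T n M}

/-- In a chart, the derivative of the components of a field is determined by its primitive. -/
theorem IsCovDeriv.coordDeriv_ae_eq {ξ η : x.Field} (h : IsCovDeriv g x ξ η) {c : M} {a b : ℝ}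
    (hc : x.InChart c a b) {f : ℝ → Model n} (hf : IntervalIntegrable f volume a b)
    (e : ∀ t ∈ Icc a b, coords c (x t) (ξ t) - coords c (x a) (ξ a) = ∫ u in a..t, f u) :
    ∀ᵐ t ∂volume.restrict (Icc a b), coordDeriv g x ξ η c t = f t :=
  ae_eq_of_intervalIntegral_eq hc.1 (h.intervalIntegrable hc) hf fun t ht ↦ by
    rw [← e t ht, h.primitive c a t (hc.mono le_rfl ht.1 ht.2)]

theorem Loop.periodic_int (x : Loop T n M) (k : ℤ) (t : ℝ) : x (t + k * T) = x t :=
  x.periodic.int_mul k t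

theorem Loop.InChart.shift {c : M} {a b : ℝ} (hc : x.InChart c a b) (k : ℤ) :
    x.InChart c (a + k * T) (b + k * T) := by
  refine ⟨by linarith [hc.1], fun t ht ↦ ?_⟩
  have h := hc.2 (t - k * T) ⟨by linarith [ht.1], by linarith [ht.2]⟩
  rwa [← x.periodic_int k, sub_add_cancel] at h

theorem coords_field_shift (ξ : H1 g x) (k : ℤ) (c : M) (t : ℝ) :
    coords c (x (t + k * T)) (ξ.field (t + k * T)) = coords c (x t) (ξ.field t) := by
  have hper : Function.Periodic (fun t ↦ (⟨x t, ξ.field t⟩ : TangentBundle (𝓡 n) M)) T := ξ.2.1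
  exact congrArg (fun p : TangentBundle (𝓡 n) M ↦ coords c p.proj p.snd) (hper.int_mul k t)

/-- A field in `H(x)` is periodic, but its covariant derivative is chosen up to null sets.
Periodicity of the derivative is recovered almost everywhere by comparing primitives. -/
theorem jet_shift (ξ : H1 g x) {c : M} {a b : ℝ} (hc : x.InChart c a b) (k : ℤ) :
    ∀ᵐ t ∂volume.restrict (Icc a b), jet ξ c (t + k * T) = jet ξ c t := by
  have hi := ξ.isCovDeriv.intervalIntegrable (hc.shift k)
  have h := ξ.isCovDeriv.coordDeriv_ae_eq hc
    (f := fun t ↦ coordDeriv g x ξ.field ξ.covDeriv c (t + k * T))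
    (by simpa using hi.comp_add_right (k * T)) (fun t ht ↦ by
      rw [intervalIntegral.integral_comp_add_right
        (fun t ↦ coordDeriv g x ξ.field ξ.covDeriv c t),
        ← ξ.isCovDeriv.primitive c _ _ ((hc.mono le_rfl ht.1 ht.2).shift k),
        coords_field_shift, coords_field_shift])
  filter_upwards [h] with t ht
  exact Prod.ext (coords_field_shift ξ k c t) ht.symm

theorem intervalIntegrable_jet_sq (ξ : H1 g x) {c : M} {a b : ℝ} (hc : x.InChart c a b) :
    IntervalIntegrable (fun t ↦ ‖jet ξ c t‖ ^ 2) volume a b :=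
  intervalIntegrable_norm_sq hc.1 (memLp_jet ξ hc)

theorem integral_jet_shift (ξ : H1 g x) {c : M} {a b : ℝ} (hc : x.InChart c a b) (k : ℤ) :
    ∫ t in (a + k * T)..(b + k * T), ‖jet ξ c t‖ ^ 2 = ∫ t in a..b, ‖jet ξ c t‖ ^ 2 := by
  rw [← intervalIntegral.integral_comp_add_right (fun t ↦ ‖jet ξ c t‖ ^ 2)]
  refine intervalIntegral.integral_congr_ae_restrict ?_
  rw [uIoc_of_le hc.1, restrict_Ioc_eq_restrict_Icc]
  filter_upwards [jet_shift ξ hc k] with t ht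
  rw [ht]

variable [Fact (0 < T)]

/-- In components the integrand of the squared norm is `metricForm`, which is uniformly positive
definite; being nonnegative, it may be integrated over all of `[0, T]`. -/
theorem exists_integral_jet_le_of_subset {c : M} {a b : ℝ} (hc : x.InChart c a b) (ha : 0 ≤ a)
    (hb : b ≤ T) : ∃ C > 0, ∀ ξ : H1 g x, ∫ t in a..b, ‖jet ξ c t‖ ^ 2 ≤ C * ‖ξ‖ ^ 2 := by
  obtain ⟨r, hr, h⟩ := (isSymmFamily_metricForm g x hc).exists_pos (metricForm_pos g x hc)
  refine ⟨r⁻¹, by positivity, fun ξ ↦ ?_⟩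
  rw [← div_eq_inv_mul, le_div_iff₀' hr, ← intervalIntegral.integral_const_mul]
  have hi := (H1.intervalIntegrable_covDeriv ξ ξ).add (H1.intervalIntegrable_field ξ ξ)
  have h0T : 0 ≤ T := (ha.trans hc.1).trans hb
  have hi' := hi.mono_set (c := a) (d := b) (by
    rw [uIcc_of_le hc.1, uIcc_of_le h0T]; exact Icc_subset_Icc ha hb)
  refine (intervalIntegral.integral_mono_on hc.1 ((intervalIntegrable_jet_sq ξ hc).const_mul r) hi'
    fun t ht ↦ ?_).trans ?_
  · refine (h t ht (jet ξ c t)).trans_eq ?_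
    have hs := hc.2 t ht
    rw [metricForm, ← coords_covDeriv_eq, chartMetric_coords hs]
    simp only [jet, chartMetric_coords hs]
  · rw [← real_inner_self_eq_norm_sq]
    exact intervalIntegral.integral_mono_interval ha hc.1 hb
      (ae_of_all _ fun t ↦ add_nonneg (H1.inner_self_nonneg _ _) (H1.inner_self_nonneg _ _)) hi

/-- In every chart, the Euclidean `H¹` norm is bounded by the norm of `H(x)`. -/
theorem exists_integral_jet_le {c : M} {a b : ℝ} (hc : x.InChart c a b) :
    ∃ C > 0, ∀ ξ : H1 g x, ∫ t in a..b, ‖jet ξ c t‖ ^ 2 ≤ C * ‖ξ‖ ^ 2 := by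
  have hT : 0 < T := Fact.out
  -- `IsCovDeriv` concerns all chart intervals, also those outside `[0, T]`. The interval is cut at
  -- multiples of `T`, by induction on the number of periods, and each part is translated into `[0,
  -- T]`; a preliminary translation makes `a` nonnegative.
  have key : ∀ (N : ℕ) (a b : ℝ), x.InChart c a b → 0 ≤ a → b ≤ N * T →
      ∃ C > 0, ∀ ξ : H1 g x, ∫ t in a..b, ‖jet ξ c t‖ ^ 2 ≤ C * ‖ξ‖ ^ 2 := by
    intro N
    induction N with
    | zero =>
      intro a b hc ha hb
      exact exists_integral_jet_le_of_subset hc ha (by simp at hb; linarith)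
    | succ N ih =>
      intro a b hc ha hb
      push_cast at hb
      have last : ∀ a, x.InChart c a b → N * T ≤ a →
          ∃ C > 0, ∀ ξ : H1 g x, ∫ t in a..b, ‖jet ξ c t‖ ^ 2 ≤ C * ‖ξ‖ ^ 2 := by
        intro a hc ha
        obtain ⟨C, hC, h⟩ := exists_integral_jet_le_of_subset (g := g) (hc.shift (-N))
          (by push_cast; linarith) (by push_cast; linarith)
        refine ⟨C, hC, fun ξ ↦ ?_⟩
        rw [← integral_jet_shift ξ hc (-N)]
        exact h ξ
      rcases le_total b (N * T) with h1 | h1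
      · exact ih a b hc ha h1
      rcases le_total (N * T) a with h2 | h2
      · exact last a hc h2
      obtain ⟨C, hC, h⟩ := ih a _ (hc.mono le_rfl h2 h1) ha le_rfl
      obtain ⟨C', hC', h'⟩ := last _ (hc.mono h2 h1 le_rfl) le_rfl
      refine ⟨C + C', by positivity, fun ξ ↦ ?_⟩
      rw [← intervalIntegral.integral_add_adjacent_intervals
        (intervalIntegrable_jet_sq ξ (hc.mono le_rfl h2 h1))
        (intervalIntegrable_jet_sq ξ (hc.mono h2 h1 le_rfl)), add_mul]
      exact add_le_add (h ξ) (h' ξ)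
  obtain ⟨k, hk⟩ := exists_nat_ge (-a / T)
  obtain ⟨N, hN⟩ := exists_nat_ge ((b + k * T) / T)
  rw [div_le_iff₀ hT] at hk hN
  obtain ⟨C, hC, h⟩ := key N _ _ (hc.shift k) (by push_cast; linarith) (by push_cast; linarith)
  refine ⟨C, hC, fun ξ ↦ ?_⟩
  rw [← integral_jet_shift ξ hc k]
  exact h ξ

theorem jet_sub (ξ ξ' : H1 g x) {c : M} {a b : ℝ} (hc : x.InChart c a b) :
    ∀ᵐ t ∂volume.restrict (Icc a b), jet (ξ - ξ') c t = jet ξ c t - jet ξ' c t := by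
  have hf : ∀ t, coords c (x t) ((ξ - ξ').field t)
      = coords c (x t) (ξ.field t) - coords c (x t) (ξ'.field t) := fun t ↦ map_sub _ _ _
  have h := (ξ - ξ').isCovDeriv.coordDeriv_ae_eq hc
    ((ξ.isCovDeriv.intervalIntegrable hc).sub (ξ'.isCovDeriv.intervalIntegrable hc))
    (fun t ht ↦ by
      have hm := hc.mono le_rfl ht.1 ht.2
      rw [intervalIntegral.integral_sub (ξ.isCovDeriv.intervalIntegrable hm)
        (ξ'.isCovDeriv.intervalIntegrable hm), ← ξ.isCovDeriv.primitive c a t hm,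
        ← ξ'.isCovDeriv.primitive c a t hm, hf, hf]
      abel)
  filter_upwards [h] with t ht
  exact Prod.ext (hf t) ht

end Charts

/-! ### Limits of controlled Cauchy sequences in `H(x)`. -/

section Complete

variable {n : ℕ} {M : Type*} [TopologicalSpace M] [ChartedSpace (Model n) M]
  [IsManifold (𝓡 n) ∞ M] {T : ℝ} {g : Metric n M} {x : Loop T n M} [Fact (0 < T)]

theorem exists_jet_limit {u : ℕ → H1 g x}
    (hu : ∀ N i j : ℕ, N ≤ i → N ≤ j → dist (u i) (u j) < (1 / 2) ^ N) {c : M} {a b : ℝ}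
    (hc : x.InChart c a b) :
    ∃ F : ℝ → Model n × Model n, MemLp F 2 (volume.restrict (Icc a b)) ∧
      (∀ᵐ t ∂volume.restrict (Icc a b), Tendsto (fun i ↦ jet (u i) c t) atTop (𝓝 (F t))) ∧
      Tendsto (fun i ↦ ∫ t in a..b, ‖jet (u i) c t - F t‖ ^ 2) atTop (𝓝 0) := by
  obtain ⟨C, hC, h⟩ := exists_integral_jet_le (g := g) hc
  refine exists_limit_of_geometric hc.1 (Real.sqrt_pos.2 hC) (fun i ↦ memLp_jet (u i) hc)
    fun N i j hi hj ↦ ?_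
  have e : ∫ t in a..b, ‖jet (u i) c t - jet (u j) c t‖ ^ 2
      = ∫ t in a..b, ‖jet (u i - u j) c t‖ ^ 2 := by
    refine intervalIntegral.integral_congr_ae_restrict ?_
    rw [uIoc_of_le hc.1, restrict_Ioc_eq_restrict_Icc]
    filter_upwards [jet_sub (u i) (u j) hc] with t ht
    rw [ht]
  rw [e, mul_pow, Real.sq_sqrt hC.le]
  refine (h _).trans (mul_le_mul_of_nonneg_left ?_ hC.le)
  rw [← dist_eq_norm]
  exact pow_le_pow_left₀ dist_nonneg (hu N i j hi hj).le 2

theorem Loop.exists_inChart (x : Loop T n M) (t : ℝ) : ∃ b, t < b ∧ x.InChart (x t) t b := by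
  have hopen : (fun s ↦ x s) ⁻¹' (chartAt (Model n) (x t)).source ∈ 𝓝 t :=
    ((chartAt (Model n) (x t)).open_source.preimage x.contMDiff.continuous).mem_nhds
      (mem_chart_source _ _)
  obtain ⟨b, hb, h⟩ := mem_nhdsGE_iff_exists_Icc_subset.1 (mem_nhdsWithin_of_mem_nhds hopen)
  exact ⟨b, hb, le_of_lt hb, h⟩

theorem tendsto_snd_sq {f : ℕ → ℝ → Model n × Model n} {F : ℝ → Model n × Model n} {a b : ℝ}
    (hab : a ≤ b) (hf : ∀ i, MemLp (f i) 2 (volume.restrict (Icc a b)))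
    (hF : MemLp F 2 (volume.restrict (Icc a b)))
    (h : Tendsto (fun i ↦ ∫ t in a..b, ‖f i t - F t‖ ^ 2) atTop (𝓝 0)) :
    Tendsto (fun i ↦ ∫ t in a..b, ‖(f i t).2 - (F t).2‖ ^ 2) atTop (𝓝 0) := by
  refine squeeze_zero (fun i ↦ intervalIntegral.integral_nonneg hab fun t _ ↦ by positivity)
    (fun i ↦ ?_) h
  exact intervalIntegral.integral_mono_on hab
    (intervalIntegrable_norm_sq hab ((hf i).snd.sub hF.snd))
    (intervalIntegrable_norm_sq hab ((hf i).sub hF))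
    fun t _ ↦ pow_le_pow_left₀ (norm_nonneg _) (norm_snd_le (f i t - F t)) 2

theorem field_sub_field (ξ : H1 g x) {c : M} {a b s t : ℝ} (hc : x.InChart c a b)
    (hs : s ∈ Icc a b) (ht : t ∈ Icc a b) :
    coords c (x t) (ξ.field t) - coords c (x s) (ξ.field s) = ∫ r in s..t, (jet ξ c r).2 := by
  rcases le_total s t with h | h
  · exact ξ.isCovDeriv.primitive c s t (hc.mono hs.1 h ht.2)
  · rw [intervalIntegral.integral_symm]
    change _ = -∫ r in t..s, coordDeriv g x ξ.field ξ.covDeriv c r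
    rw [← ξ.isCovDeriv.primitive c t s (hc.mono ht.1 h hs.2)]
    abel

/-- A sequence in `H(x)` that is Cauchy at a geometric rate converges pointwise. -/
theorem exists_field_limit {u : ℕ → H1 g x}
    (hu : ∀ N i j : ℕ, N ≤ i → N ≤ j → dist (u i) (u j) < (1 / 2) ^ N) (t : ℝ) :
    ∃ l : TangentSpace (𝓡 n) (x t), Tendsto (fun i ↦ (u i).field t) atTop (𝓝 l) := by
  obtain ⟨b, htb, hc⟩ := x.exists_inChart t
  obtain ⟨F, hF, hae, hL⟩ := exists_jet_limit hu hc
  have : (ae (volume.restrict (Icc t b))).NeBot := by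
    rw [ae_neBot, ne_eq, Measure.restrict_eq_zero]
    simp [htb]
  -- Convergence holds at some `s` in a chart interval that starts at `t`. It propagates to `t`
  -- because the integrals of the derivatives from `s` to `t` converge.
  obtain ⟨s, hs, hst⟩ := (hae.and (ae_restrict_mem measurableSet_Icc)).exists
  have h1 := tendsto_intervalIntegral_of_sq (fun i ↦ (memLp_jet (u i) hc).snd) hF.snd
    (tendsto_snd_sq hc.1 (fun i ↦ memLp_jet (u i) hc) hF hL) hst (left_mem_Icc.2 hc.1)
  have h2 := h1.add ((continuous_fst.tendsto _).comp hs)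
  have h3 : ∀ i, (u i).field t = ofCoords (x t) (x t)
      ((∫ r in s..t, (jet (u i) (x t) r).2) + (jet (u i) (x t) s).1) := fun i ↦ by
    rw [← field_sub_field (u i) hc hst (left_mem_Icc.2 hc.1)]
    simp only [jet, sub_add_cancel]
    rw [ofCoords_coords (mem_chart_source _ _)]
  refine ⟨_, Tendsto.congr (fun i ↦ (h3 i).symm)
    (((ofCoords (x t) (x t)).continuous.tendsto _).comp h2)⟩

instance (q : M) : T2Space (TangentSpace (𝓡 n) q) := inferInstanceAs (T2Space (Model n))

/-- The pointwise limit of a sequence of fields. -/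
def limField (ξ : ℕ → x.Field) : x.Field := fun t ↦ limUnder atTop fun i ↦ ξ i t

theorem tendsto_limField {ξ : ℕ → x.Field} {t : ℝ}
    (h : ∃ l : TangentSpace (𝓡 n) (x t), Tendsto (fun i ↦ ξ i t) atTop (𝓝 l)) :
    Tendsto (fun i ↦ ξ i t) atTop (𝓝 (limField ξ t)) :=
  tendsto_nhds_limUnder h

/-- In a chart, the limit of a sequence that is Cauchy at a geometric rate is represented by the
limit of the components in `L²`. -/
theorem exists_jet_limField {u : ℕ → H1 g x}
    (hu : ∀ N i j : ℕ, N ≤ i → N ≤ j → dist (u i) (u j) < (1 / 2) ^ N) {c : M} {a b : ℝ}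
    (hc : x.InChart c a b) :
    ∃ F : ℝ → Model n × Model n, MemLp F 2 (volume.restrict (Icc a b)) ∧
      Tendsto (fun i ↦ ∫ t in a..b, ‖jet (u i) c t - F t‖ ^ 2) atTop (𝓝 0) ∧
      (∀ t ∈ Icc a b, coords c (x t) (limField (fun i ↦ (u i).field) t)
        - coords c (x a) (limField (fun i ↦ (u i).field) a) = ∫ r in a..t, (F r).2) ∧
      ∀ᵐ t ∂volume.restrict (Icc a b), F t = (coords c (x t) (limField (fun i ↦ (u i).field) t),
        coordDeriv g x (limField fun i ↦ (u i).field) (limField fun i ↦ (u i).covDeriv) c t) := by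
  obtain ⟨F, hF, hae, hL⟩ := exists_jet_limit hu hc
  have hlim : ∀ t, Tendsto (fun i ↦ coords c (x t) ((u i).field t)) atTop
      (𝓝 (coords c (x t) (limField (fun i ↦ (u i).field) t))) := fun t ↦
    ((coords c (x t)).continuous.tendsto _).comp (tendsto_limField (exists_field_limit hu t))
  refine ⟨F, hF, hL, fun t ht ↦ ?_, ?_⟩
  · have h1 := tendsto_intervalIntegral_of_sq (fun i ↦ (memLp_jet (u i) hc).snd) hF.snd
      (tendsto_snd_sq hc.1 (fun i ↦ memLp_jet (u i) hc) hF hL) (left_mem_Icc.2 hc.1) ht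
    refine tendsto_nhds_unique (((hlim t).sub (hlim a)).congr fun i ↦ ?_) h1
    exact field_sub_field (u i) hc (left_mem_Icc.2 hc.1) ht
  · filter_upwards [hae, ae_restrict_mem measurableSet_Icc] with t ht hti
    have h1 : (F t).1 = coords c (x t) (limField (fun i ↦ (u i).field) t) :=
      tendsto_nhds_unique ((continuous_fst.tendsto _).comp ht) (hlim t)
    have hΓ : Continuous fun w ↦ christoffel g c (x.pos c t) (x.vel c t) w :=
      LinearMap.continuous_of_finiteDimensional
        (⟨⟨_, christoffel_add g c (x.pos c t) (x.vel c t)⟩,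
          fun r w ↦ christoffel_smul g c (x.pos c t) (x.vel c t) w r⟩ : Model n →ₗ[ℝ] Model n)
    -- The covariant derivatives converge at almost every time, so their pointwise limit is one
    -- field that serves all charts and no gluing of chartwise `L²` limits is needed. Where there is
    -- no limit, the value of `limField` is irrelevant.
    have h2 : Tendsto (fun i ↦ coords c (x t) ((u i).covDeriv t)) atTop
        (𝓝 ((F t).2 + christoffel g c (x.pos c t) (x.vel c t) (F t).1)) := by
      simp only [coords_covDeriv_eq]
      exact ((continuous_snd.tendsto _).comp ht).add
        ((hΓ.tendsto _).comp ((continuous_fst.tendsto _).comp ht))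
    have h3 : Tendsto (fun i ↦ coords c (x t) ((u i).covDeriv t)) atTop
        (𝓝 (coords c (x t) (limField (fun i ↦ (u i).covDeriv) t))) := by
      refine ((coords c (x t)).continuous.tendsto _).comp (tendsto_limField ⟨_,
        (((ofCoords c (x t)).continuous.tendsto _).comp h2).congr fun i ↦ ?_⟩)
      exact ofCoords_coords (hc.2 t hti) _
    refine Prod.ext h1 ?_
    simp only [coordDeriv]
    rw [← tendsto_nhds_unique h2 h3, ← h1, add_sub_cancel_right]

theorem isCovDeriv_limField {u : ℕ → H1 g x}
    (hu : ∀ N i j : ℕ, N ≤ i → N ≤ j → dist (u i) (u j) < (1 / 2) ^ N) :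
    IsCovDeriv g x (limField fun i ↦ (u i).field) (limField fun i ↦ (u i).covDeriv) := by
  have hmem : ∀ c a b, x.InChart c a b → MemLp (coordDeriv g x (limField fun i ↦ (u i).field)
      (limField fun i ↦ (u i).covDeriv) c) 2 (volume.restrict (Icc a b)) := fun c a b hc ↦ by
    obtain ⟨F, hF, -, -, hae⟩ := exists_jet_limField hu hc
    refine hF.snd.ae_eq ?_
    filter_upwards [hae] with t ht
    rw [ht]
  refine ⟨fun c a b hc ↦ ?_, hmem, fun c a b hc ↦ ?_⟩
  · obtain ⟨F, hF, -, hprim, -⟩ := exists_jet_limField hu hc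
    have hco : ContinuousOn (fun t ↦ coords c (x t) (limField (fun i ↦ (u i).field) t))
        (Icc a b) := by
      have hi : IntegrableOn (fun t ↦ (F t).2) (uIcc a b) := by
        rw [uIcc_of_le hc.1]; exact hF.snd.integrable (by norm_num)
      have h1 := intervalIntegral.continuousOn_primitive_interval hi
      rw [uIcc_of_le hc.1] at h1
      refine (h1.add_const
        (coords c (x a) (limField (fun i ↦ (u i).field) a))).congr fun t ht ↦ ?_
      simp only [← hprim t ht, sub_add_cancel]
    have hΓ := continuousOn_christoffel g c (x.continuousOn_pos hc) (x.continuousOn_vel hc) hco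
      (fun t ht ↦ x.pos_mem c (hc.2 t ht))
    obtain ⟨C, hC⟩ := isCompact_Icc.exists_bound_of_continuousOn hΓ
    have h2 : MemLp _ 2 (volume.restrict (Icc a b)) :=
      MemLp.of_bound (hΓ.aestronglyMeasurable measurableSet_Icc) C
        ((ae_restrict_iff' measurableSet_Icc).2 (ae_of_all _ hC))
    refine ((hmem c a b hc).add h2).ae_eq (ae_of_all _ fun t ↦ ?_)
    simp [coordDeriv]
  · obtain ⟨F, hF, -, hprim, hae⟩ := exists_jet_limField hu hc
    rw [hprim b (right_mem_Icc.2 hc.1)]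
    refine intervalIntegral.integral_congr_ae_restrict ?_
    rw [uIoc_of_le hc.1, restrict_Ioc_eq_restrict_Icc]
    filter_upwards [hae] with t ht
    rw [ht]

/-- The base points are kept as variables so that their equality can be substituted; uniqueness of
limits then takes place in a single tangent space. -/
theorem totalSpace_eq_of_tendsto {q q' : M} (hq : q = q') {v : ℕ → TangentSpace (𝓡 n) q}
    {v' : ℕ → TangentSpace (𝓡 n) q'} {l : TangentSpace (𝓡 n) q} {l' : TangentSpace (𝓡 n) q'}
    (hv : Tendsto v atTop (𝓝 l)) (hv' : Tendsto v' atTop (𝓝 l'))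
    (h : ∀ i, (⟨q, v i⟩ : TangentBundle (𝓡 n) M) = ⟨q', v' i⟩) :
    (⟨q, l⟩ : TangentBundle (𝓡 n) M) = ⟨q', l'⟩ := by
  subst hq
  have e : v = v' := funext fun i ↦ by simpa using h i
  rw [tendsto_nhds_unique hv (e ▸ hv')]

theorem limField_periodic {u : ℕ → H1 g x}
    (hu : ∀ N i j : ℕ, N ≤ i → N ≤ j → dist (u i) (u j) < (1 / 2) ^ N) (t : ℝ) :
    (⟨x (t + T), limField (fun i ↦ (u i).field) (t + T)⟩ : TangentBundle (𝓡 n) M)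
      = ⟨x t, limField (fun i ↦ (u i).field) t⟩ :=
  totalSpace_eq_of_tendsto (x.periodic t) (tendsto_limField (exists_field_limit hu (t + T)))
    (tendsto_limField (exists_field_limit hu t)) fun i ↦ (u i).2.1 t

variable (g x) in
theorem H1.completeSpace : CompleteSpace (H1 g x) := by
  refine Metric.complete_of_convergent_controlled_sequences (fun N ↦ (1 / 2) ^ N)
    (fun N ↦ by positivity) fun u hu ↦ ?_
  have hlim := isCovDeriv_limField hu
  let ξ : H1 g x := ⟨limField fun i ↦ (u i).field, limField_periodic hu, _, hlim⟩
  refine ⟨ξ, ?_⟩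
  obtain ⟨C, hC, h⟩ := (isPieceFamily_metric g x).exists_le g x
  have hjet : ∀ i, Tendsto (fun j ↦ ∫ t in (node x i)..(node x (i + 1)),
      2 * ‖jet (u j - ξ) (center x i) t‖ ^ 2) atTop (𝓝 0) := fun i ↦ by
    have hc := inChart_node x i
    obtain ⟨F, hF, hL, hprim, hae⟩ := exists_jet_limField hu hc
    -- The covariant derivative attached to `ξ` is a fresh choice, possibly different from the limit
    -- of the covariant derivatives; both have the same primitive in the chart.
    have h2 := ξ.isCovDeriv.coordDeriv_ae_eq hc
      ((intervalIntegrable_iff_integrableOn_Icc_of_le hc.1).2 (hF.snd.integrable (by norm_num)))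
      hprim
    have hL2 := hL.const_mul 2
    rw [mul_zero] at hL2
    refine hL2.congr fun j ↦ ?_
    rw [← intervalIntegral.integral_const_mul]
    refine intervalIntegral.integral_congr_ae_restrict ?_
    rw [uIoc_of_le hc.1, restrict_Ioc_eq_restrict_Icc]
    filter_upwards [jet_sub (u j) ξ hc, h2, hae] with t h1 h2 h3
    have h4 : F t = jet ξ (center x i) t := by
      refine Prod.ext ?_ h2.symm
      rw [h3]
      rfl
    rw [h1, h4]
  have hsum : Tendsto (fun j ↦ C * ∑ i ∈ Finset.range (pieces x),
      ∫ t in (node x i)..(node x (i + 1)), 2 * ‖jet (u j - ξ) (center x i) t‖ ^ 2) atTop (𝓝 0) := by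
    simpa using (tendsto_finsetSum (Finset.range (pieces x)) fun i _ ↦ hjet i).const_mul C
  have hsq : Tendsto (fun j ↦ ‖u j - ξ‖ ^ 2) atTop (𝓝 0) := by
    refine squeeze_zero (fun j ↦ by positivity) (fun j ↦ ?_) hsum
    rw [norm_sq_eq_pieceForm]
    refine (le_abs_self _).trans ((h _).trans (mul_le_mul_of_nonneg_left ?_ hC.le))
    refine Finset.sum_le_sum fun i _ ↦ ?_
    have hc := inChart_node x i
    exact intervalIntegral.integral_mono_on hc.1
      ((isPieceFamily_jet x).intervalIntegrable _ _ i)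
      ((intervalIntegrable_jet_sq _ hc).const_mul 2) fun t _ ↦ jetFamily_le i t _
  rw [tendsto_iff_norm_sub_tendsto_zero]
  simpa [Real.sqrt_sq] using hsq.sqrt

end Complete

end LagrangianIndex

end

theorem mainTheorem6 {n : ℕ} {M : Type*} [TopologicalSpace M] [T2Space M]
    [SecondCountableTopology M] [ChartedSpace (LagrangianIndex.Model n) M]
    [IsManifold (𝓡 n) ∞ M] (g : LagrangianIndex.Metric n M) {T : ℝ} [Fact (0 < T)]
    (L : LagrangianIndex.Lagrangian n M) (hL : LagrangianIndex.IsSmoothPeriodic T L)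
    (hquad : LagrangianIndex.IsQuadraticInVelocity L)
    (hconv : ∃ ℓ₀ : ℝ, 0 < ℓ₀ ∧ ∀ (t : ℝ) (q : M) (v w : TangentSpace (𝓡 n) q),
      ℓ₀ * g.inner q w w ≤ LagrangianIndex.fiberHessian L t q v w w)
    (x : LagrangianIndex.Loop T n M) (hx : LagrangianIndex.IsEulerLagrange L x) :
    ∃ m : ℕ, LagrangianIndex.morseIndex (LagrangianIndex.secondVariation g L x) = m ∧
      ∀ k : ℤ, LagrangianIndex.IsSpectralIndex g L x k ↔ k = m := by
  have := LagrangianIndex.H1.completeSpace g x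
  exact LagrangianIndex.morseIndex_eq_spectralIndex hL hquad hconv
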